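/- Let $B$ be a $C^*$-algebra, let $Y$ be a Hilbert $C^*$-module over $B$ and let $\mathcal{L}(Y)$ be the $C^*$-algebra of bounded adjointable operators on $Y$. Let $D : \mathcal{D}(D) \to Y$ be an unbounded selfadjoint and regular operator, and let $\Delta \in \mathcal{L}(Y)$ be positive with dense image. Suppose that (1) $\Delta(\mathcal{D}(D)) \subseteq \mathcal{D}(D)$ and the commutator $D\Delta - \Delta D : \mathcal{D}(D) \to Y$ is the restriction of an operator $d(\Delta) \in \mathcal{L}(Y)$; (2) the image of $d(\Delta)$ is contained in the image of $\Delta^{1/2}$, and $\Delta^{-1/2} d(\Delta) \Delta^{-1/2} : \mathrm{Im}(\Delta^{1/2}) \to Y$ is the restriction of an operator $\rho(\Delta) \in \mathcal{L}(Y)$. Let $r \in (\|\Delta\|^2, \infty)$ and, for $\lambda \geq 0$, put $R_\lambda := (\lambda + 1 + D^2)^{-1}$, $K := 1 - \Delta^2/r$ and $X_\lambda := \lambda R_\lambda K$. Let $F_D := D(1 + D^2)^{-1/2}$ be the bounded transform of $D$. Then for each $p \in [0, 1/2)$ the difference of unbounded operators \[ \Delta^5 F_D (1 + D^2)^p - \frac{1}{\pi}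 \int_0^\infty (\lambda r)^{-1/2} \Delta^3 (1 - X_\lambda)^{-1} \Delta^3 R_\lambda \, d\lambda \cdot D (1 + D^2)^p : \mathcal{D}(|D|^{2p+1}) \to Y \] has a bounded extension to $Y$, where the integral converges absolutely in operator norm. -/

import Mathlib

open MeasureTheory Set

noncomputable section

namespace HilbertModule

/-! Throughout, `Y` is a Hilbert C*-module over the (possibly non-unital) C*-algebra `B`. -/

section Adjointable

variable (B Y : Type*) [NonUnitalCStarAlgebra B] [PartialOrder B]
  [NormedAddCommGroup Y] [NormedSpace ℂ Y] [SMul B Y] [CStarModule B Y]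

/-- The bounded operators on `Y` that admit an adjoint with respect to the `B`-valued inner
product. -/
def adjointableSubalgebra : Subalgebra ℂ (Y →L[ℂ] Y) where
  carrier := {T | ∃ S : Y →L[ℂ] Y, ∀ x y, inner B (T x) y = inner B x (S y)}
  mul_mem' := by
    rintro T₁ T₂ ⟨S₁, h₁⟩ ⟨S₂, h₂⟩
    exact ⟨S₂ * S₁, fun x y => by simp [h₁, h₂]⟩
  add_mem' := by
    rintro T₁ T₂ ⟨S₁, h₁⟩ ⟨S₂, h₂⟩
    exact ⟨S₁ + S₂, fun x y => by simp [h₁, h₂]⟩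
  algebraMap_mem' := by
    intro c
    exact ⟨star c • 1, fun x y => by simp [Algebra.algebraMap_eq_smul_one]⟩

/-- The algebra of bounded adjointable operators on `Y`. -/
def AdjointableOp : Type _ := ↥(adjointableSubalgebra B Y)

/-- The ring structure and the operator norm are inherited from the bounded operators. -/
instance : NormedRing (AdjointableOp B Y) :=
  inferInstanceAs (NormedRing ↥(adjointableSubalgebra B Y))

instance : NormedAlgebra ℂ (AdjointableOp B Y) :=
  inferInstanceAs (NormedAlgebra ℂ ↥(adjointableSubalgebra B Y))

variable {B Y}

/-- The inclusion of the adjointable operators into the bounded operators. -/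
def AdjointableOp.toCLM : AdjointableOp B Y →ₐ[ℂ] (Y →L[ℂ] Y) :=
  (adjointableSubalgebra B Y).val

instance : CoeFun (AdjointableOp B Y) fun _ => Y → Y := ⟨fun T => T.toCLM⟩

lemma AdjointableOp.toCLM_injective :
    Function.Injective (AdjointableOp.toCLM : AdjointableOp B Y → (Y →L[ℂ] Y)) :=
  Subtype.val_injective

lemma AdjointableOp.norm_toCLM (T : AdjointableOp B Y) : ‖T.toCLM‖ = ‖T‖ := rfl

lemma eq_of_inner_eq {a b : Y} (h : ∀ x, inner B x a = inner B x b) : a = b := by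
  have h0 : inner B (a - b) (a - b) = 0 := by
    rw [CStarModule.inner_sub_right, h, sub_self]
  exact sub_eq_zero.mp (CStarModule.inner_self.mp h0)

instance : Star (AdjointableOp B Y) where
  star T := ⟨T.2.choose, T.1, fun x y => by
    rw [← CStarModule.star_inner, ← T.2.choose_spec, CStarModule.star_inner]⟩

/-- The star operation is the adjoint. -/
lemma inner_star (T : AdjointableOp B Y) (x y : Y) :
    inner B (T.toCLM x) y = inner B x ((star T).toCLM y) :=
  T.2.choose_spec x y

lemma star_eq_of_inner {T S : AdjointableOp B Y}
    (h : ∀ x y, inner B (T.toCLM x) y = inner B x (S.toCLM y)) : star T = S := by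
  apply AdjointableOp.toCLM_injective
  ext y
  exact eq_of_inner_eq (B := B) fun x => by rw [← inner_star, h]

instance : StarRing (AdjointableOp B Y) where
  star_involutive T := star_eq_of_inner fun x y => by
    rw [← CStarModule.star_inner, ← inner_star, CStarModule.star_inner]
  star_mul S T := star_eq_of_inner fun x y => by
    simp [inner_star]
  star_add S T := star_eq_of_inner fun x y => by
    simp [inner_star]

instance : StarModule ℂ (AdjointableOp B Y) where
  star_smul c T := star_eq_of_inner fun x y => by
    simp [inner_star]

variable [StarOrderedRing B]

instance : CStarRing (AdjointableOp B Y) where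
  norm_mul_self_le T := by
    have key : ‖T.toCLM‖ ≤ √‖star T * T‖ := by
      refine T.toCLM.opNorm_le_bound (Real.sqrt_nonneg _) fun x => ?_
      have h1 : ‖T.toCLM x‖ ^ 2 ≤ ‖star T * T‖ * ‖x‖ ^ 2 := by
        rw [CStarModule.norm_sq_eq (A := B), inner_star]
        calc ‖inner B x ((star T).toCLM (T.toCLM x))‖ ≤ ‖x‖ * ‖(star T * T).toCLM x‖ :=
              CStarModule.norm_inner_le Y
          _ ≤ ‖x‖ * (‖star T * T‖ * ‖x‖) := by
              gcongr
              exact (star T * T).toCLM.le_opNorm x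
          _ = ‖star T * T‖ * ‖x‖ ^ 2 := by ring
      calc ‖T.toCLM x‖ = √(‖T.toCLM x‖ ^ 2) := (Real.sqrt_sq (norm_nonneg _)).symm
        _ ≤ √(‖star T * T‖ * ‖x‖ ^ 2) := Real.sqrt_le_sqrt h1
        _ = √‖star T * T‖ * ‖x‖ := by
            rw [Real.sqrt_mul (norm_nonneg _), Real.sqrt_sq (norm_nonneg _)]
    have h2 := mul_self_le_mul_self (norm_nonneg T.toCLM) key
    rwa [Real.mul_self_sqrt (norm_nonneg _), AdjointableOp.norm_toCLM] at h2

instance [CompleteSpace Y] : CompleteSpace (AdjointableOp B Y) := by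
  refine Metric.complete_of_cauchySeq_tendsto fun u hu => ?_
  have hs : CauchySeq fun n => star (u n) := by
    rw [Metric.cauchySeq_iff] at hu ⊢
    intro ε hε
    obtain ⟨N, hN⟩ := hu ε hε
    refine ⟨N, fun m hm n hn => ?_⟩
    rw [dist_eq_norm, ← star_sub, norm_star, ← dist_eq_norm]
    exact hN m hm n hn
  have hc : ∀ v : ℕ → AdjointableOp B Y, CauchySeq v → CauchySeq fun n => (v n).toCLM :=
    fun v hv => hv.map (uniformContinuous_subtype_val (p := (· ∈ adjointableSubalgebra B Y)))
  obtain ⟨T, hT⟩ := cauchySeq_tendsto_of_complete (hc u hu)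
  obtain ⟨S, hS⟩ := cauchySeq_tendsto_of_complete (hc _ hs)
  have hmem : T ∈ adjointableSubalgebra B Y := by
    refine ⟨S, fun x y => ?_⟩
    have hTx : Filter.Tendsto (fun n => (u n).toCLM x) Filter.atTop (nhds (T x)) :=
      ((ContinuousLinearMap.apply ℂ Y x).continuous.tendsto T).comp hT
    have hSy : Filter.Tendsto (fun n => (star (u n)).toCLM y) Filter.atTop (nhds (S y)) :=
      ((ContinuousLinearMap.apply ℂ Y y).continuous.tendsto S).comp hS
    have h1 := ((CStarModule.continuous_inner (A := B) (E := Y)).tendsto (T x, y)).comp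
      (hTx.prodMk_nhds tendsto_const_nhds)
    have h2 := ((CStarModule.continuous_inner (A := B) (E := Y)).tendsto (x, S y)).comp
      (Filter.Tendsto.prodMk_nhds tendsto_const_nhds hSy)
    refine tendsto_nhds_unique h1 (h2.congr fun n => ?_)
    exact (inner_star (u n) x y).symm
  exact ⟨⟨T, hmem⟩, tendsto_subtype_rng.mpr hT⟩

variable [CompleteSpace Y]

/-- The bounded adjointable operators form a C*-algebra (with the operator norm). -/
instance : CStarAlgebra (AdjointableOp B Y) where

/-- The usual order of a C*-algebra: `0 ≤ T` means that `T` is selfadjoint with nonnegative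
spectrum. -/
instance : PartialOrder (AdjointableOp B Y) := CStarAlgebra.spectralOrder _

instance : StarOrderedRing (AdjointableOp B Y) := CStarAlgebra.spectralOrderedRing _

end Adjointable

/-! ### Unbounded operators -/

section Unbounded

variable {Y : Type*} [NormedAddCommGroup Y] [NormedSpace ℂ Y]

/-- The composition `T S` of unbounded operators, on its natural domain
`{x ∈ dom S | S x ∈ dom T}`. -/
def pcomp (T S : Y →ₗ.[ℂ] Y) : Y →ₗ.[ℂ] Y where
  domain := (T.domain.comap S.toFun).map S.domain.subtype
  toFun := T.toFun ∘ₗ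
    LinearMap.codRestrict T.domain
      (S.toFun ∘ₗ Submodule.inclusion (Submodule.map_subtype_le _ _))
      (by rintro ⟨x, ⟨y, hy, rfl⟩⟩; exact hy)

/-- The unbounded operator `c + T`, on the domain of `T`. -/
def addConst (c : ℝ) (T : Y →ₗ.[ℂ] Y) : Y →ₗ.[ℂ] Y :=
  ((c : ℂ) • (LinearMap.id : Y →ₗ[ℂ] Y)) +ᵥ T

variable {B : Type*} [NonUnitalCStarAlgebra B] [PartialOrder B] [SMul B Y] [CStarModule B Y]

/-- A bounded adjointable operator, regarded as an everywhere defined unbounded operator. -/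
def toPMap (T : AdjointableOp B Y) : Y →ₗ.[ℂ] Y :=
  T.toCLM.toLinearMap.toPMap ⊤

variable (B)

/-- The graph of the adjoint of `T`: the pairs `(y, z)` with `⟨T x, y⟩ = ⟨x, z⟩` for all `x` in
the domain of `T`. -/
def adjointGraph (T : Y →ₗ.[ℂ] Y) : Submodule ℂ (Y × Y) where
  carrier := {q | ∀ x : T.domain, inner B (T x) q.1 = inner B (x : Y) q.2}
  add_mem' := by
    intro a b ha hb x
    simp [ha x, hb x]
  zero_mem' := by
    intro x
    simp
  smul_mem' := by
    intro c a ha x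
    simp [ha x]

/-- The adjoint of a densely defined unbounded operator. -/
def adjoint (T : Y →ₗ.[ℂ] Y) : Y →ₗ.[ℂ] Y :=
  (adjointGraph B T).toLinearPMap

/-- Selfadjointness: `T` is densely defined and equal to its adjoint (same domain). -/
structure IsSelfAdjointOp (T : Y →ₗ.[ℂ] Y) : Prop where
  dense_domain : Dense (T.domain : Set Y)
  adjoint_eq : adjoint B T = T

/-- Regularity: `T` is closed and densely defined, its adjoint is densely defined, and
`1 + T* T` has dense range. -/
structure IsRegularOp (T : Y →ₗ.[ℂ] Y) : Prop where
  isClosed : T.IsClosed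
  dense_domain : Dense (T.domain : Set Y)
  dense_adjoint_domain : Dense ((adjoint B T).domain : Set Y)
  denseRange : DenseRange (addConst 1 (pcomp (adjoint B T) T))

open scoped Classical in
/-- The inverse of an unbounded operator `T`, as a bounded adjointable operator: the operator `S`
such that `(x, y)` lies in the graph of `T` if and only if `S y = x`. (It is set to be `0` if `T`
has no bounded adjointable inverse.) -/
def boundedInverse (T : Y →ₗ.[ℂ] Y) : AdjointableOp B Y :=
  if h : ∃ S : AdjointableOp B Y, ∀ x y, (x, y) ∈ T.graph ↔ S y = x
  then h.choose else 0

/-- The resolvent `R_l = (l + 1 + D²)⁻¹`. -/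
def resolventOp (D : Y →ₗ.[ℂ] Y) (l : ℝ) : AdjointableOp B Y :=
  boundedInverse B (addConst (l + 1) (pcomp D D))

variable [StarOrderedRing B] [CompleteSpace Y]

/-- The bounded positive operator `(1 + D²)^(-s)`, for `s ≥ 0`, obtained by functional calculus
from `(1 + D²)⁻¹`. -/
def negPow (D : Y →ₗ.[ℂ] Y) (s : ℝ) : AdjointableOp B Y :=
  resolventOp B D 0 ^ s

/-- The unbounded operator `(1 + D²)^s`, for `s ≥ 0`: the inverse of `(1 + D²)^(-s)`. -/
def posPow (D : Y →ₗ.[ℂ] Y) (s : ℝ) : Y →ₗ.[ℂ] Y :=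
  (toPMap (negPow B D s)).inverse

/-- The unbounded operator `|D|^s`, for `s ≥ 0`, defined as
`(D² (1 + D²)⁻¹)^(s/2) (1 + D²)^(s/2)`, where `D² (1 + D²)⁻¹ = 1 - (1 + D²)⁻¹` is bounded and
positive. Its domain is that of `(1 + D²)^(s/2)`. -/
def absPow (D : Y →ₗ.[ℂ] Y) (s : ℝ) : Y →ₗ.[ℂ] Y :=
  pcomp (toPMap ((1 - resolventOp B D 0) ^ (s / 2))) (posPow B D (s / 2))

/-- The bounded transform `F_D = D (1 + D²)^(-1/2)`. -/
def boundedTransform (D : Y →ₗ.[ℂ] Y) : Y →ₗ.[ℂ] Y :=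
  pcomp D (toPMap (negPow B D (1 / 2)))

variable {B}

/-- The commutator `D Δ - Δ D`, on its natural domain. -/
def commutator (D : Y →ₗ.[ℂ] Y) (Δ : AdjointableOp B Y) : Y →ₗ.[ℂ] Y :=
  pcomp D (toPMap Δ) - pcomp (toPMap Δ) D

/-- The unbounded operator `Δ^(-1/2)`, defined on the image of `Δ^(1/2)`. -/
def invSqrt (Δ : AdjointableOp B Y) : Y →ₗ.[ℂ] Y :=
  (toPMap (Δ ^ (1 / 2 : ℝ))).inverse

/-- The compatibility condition between `D` and `Δ`: the domain of `D` is invariant under `Δ`, the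
commutator `D Δ - Δ D` is the restriction of a bounded adjointable operator `d(Δ)`, the image of
`d(Δ)` is contained in the image of `Δ^(1/2)`, and `Δ^(-1/2) d(Δ) Δ^(-1/2)` (with domain the image
of `Δ^(1/2)`) is the restriction of a bounded adjointable operator `ρ(Δ)`. For unbounded operators,
`S ≤ T` means that `S` is a restriction of `T`. -/
def IsModularPair (D : Y →ₗ.[ℂ] Y) (Δ : AdjointableOp B Y) : Prop :=
  (∀ x ∈ D.domain, Δ x ∈ D.domain) ∧
  ∃ dΔ : AdjointableOp B Y,
    commutator D Δ ≤ toPMap dΔ ∧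
    range dΔ ⊆ range (Δ ^ (1 / 2 : ℝ) : AdjointableOp B Y) ∧
    ∃ ρΔ : AdjointableOp B Y,
      pcomp (invSqrt Δ) (pcomp (toPMap dΔ) (invSqrt Δ)) ≤ toPMap ρΔ

/-- `K = 1 - Δ² / r`. -/
def opK (Δ : AdjointableOp B Y) (r : ℝ) : AdjointableOp B Y :=
  1 - r⁻¹ • Δ ^ 2

/-- `X_l = l R_l K`. -/
def opX (D : Y →ₗ.[ℂ] Y) (Δ : AdjointableOp B Y) (r l : ℝ) : AdjointableOp B Y :=
  l • (resolventOp B D l * opK Δ r)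

/-- The integrand `(l r)^(-1/2) Δ³ (1 - X_l)⁻¹ Δ³ R_l`. -/
def integrand (D : Y →ₗ.[ℂ] Y) (Δ : AdjointableOp B Y) (r l : ℝ) : AdjointableOp B Y :=
  (l * r) ^ (-(1 / 2) : ℝ) •
    (Δ ^ 3 * Ring.inverse (1 - opX D Δ r l) * Δ ^ 3 * resolventOp B D l)

/-- `(1/π) ∫₀^∞ (l r)^(-1/2) Δ³ (1 - X_l)⁻¹ Δ³ R_l dl`, an integral with respect to the operator
norm. -/
def modularIntegral (D : Y →ₗ.[ℂ] Y) (Δ : AdjointableOp B Y) (r : ℝ) : AdjointableOp B Y :=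
  (1 / Real.pi) • ∫ l in Ioi (0 : ℝ), integrand D Δ r l

/-- The difference of unbounded operators
`Δ⁵ F_D (1 + D²)^p - ((1/π) ∫₀^∞ (l r)^(-1/2) Δ³ (1 - X_l)⁻¹ Δ³ R_l dl) D (1 + D²)^p`. -/
def transformDifference (D : Y →ₗ.[ℂ] Y) (Δ : AdjointableOp B Y) (r p : ℝ) : Y →ₗ.[ℂ] Y :=
  pcomp (toPMap (Δ ^ 5)) (pcomp (boundedTransform B D) (posPow B D p)) -
    pcomp (toPMap (modularIntegral D Δ r)) (pcomp D (posPow B D p))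

end Unbounded

end HilbertModule

end

/-!
Everything is reduced to bounded operators. A selfadjoint regular operator `D` is determined by
`A = (1 + D²)⁻¹` and its bounded transform `F` (`exists_isTransform`): `F² = 1 - A`, `F` commutes
with `A`, and `D` maps `A^(1/2) y` to `F y`. With `h = Δ^(1/2)` the hypotheses on `Δ` say that
`[D, Δ] = h ρ h`, and the Leibniz rule turns this into commutator relations between bounded operators
(`IsModularData`). The resolvent is `R_l = A (1 + l A)⁻¹`.

If `Δ` and `D` commuted, then `(1 - X_l)⁻¹ Δ³ R_l` would be the series `W_l = ∑ Δ³ Kⁿ (l R_l)ⁿ R_l`.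
Multiplied by `Δ³` and integrated against `(l r)^(-1/2) dl / π`, this series gives exactly
`Δ⁵ A^(1/2)` (`IsModularData.integral_commSeries`): the integral of `(l R_l)ⁿ R_l` is a multiple
`cₙ A^(1/2)`, and `∑ cₙ kⁿ = (1 - k)^(-1/2)`, so that `∑ cₙ Δ⁶ Kⁿ = √r Δ⁵`.

In general the error is `(1 - X_l)⁻¹ Δ³ R_l - W_l = l (1 - X_l)⁻¹ ∑ [R_l, Δ³ Kⁿ⁺¹] (l R_l)ⁿ R_l`. The
commutators are `-(D R_l d_n R_l + R_l d_n D R_l)`, where `d_n = [D, Δ³ Kⁿ⁺¹]` starts with a factor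
`h`, so that two estimates suffice. First, `Δ³ (1 - X_l)⁻¹ R_l h = O(l⁻¹)` and
`Δ³ (1 - X_l)⁻¹ D R_l h = O(l^(-1/2))` (`IsModularData.exists_parametrix`), because `(1 - X_l)⁻¹ R_l`
is `(1 + D² + l Δ² / r)⁻¹`. Second, the norms of `d_n`, which decay because `Δ` makes powers of `K`
small, are summable against those of the powers of `R_l` that remain on the right after a factor
`A^s` has been split off; for this `s` has to be at least `7/8`. The error multiplied by `Δ³` is
therefore `T_l A^s` with `T_l = O((1 + l)^(s - 3/2))` (`IsModularData.exists_factor`), which is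
integrable against `l^(-1/2)` for `s < 1`.

On a vector `x = A^(p+1/2) η` of the domain, the difference in the theorem is the value at `F η` of
`Δ⁵ A^(1/2)` minus the integral (`IsTransform.mem_graph_transformDifference`). It is bounded by a
multiple of `‖A^s F η‖ ≤ ‖x‖`, with `s ≥ p + 1/2`.
-/

noncomputable section

namespace HilbertModule

/-! ### Scalar inequalities, sums and integrals -/

lemma pow_mul_one_sub_le {k : ℝ} (h0 : 0 ≤ k) (h1 : k ≤ 1) (n : ℕ) :
    k ^ n * (1 - k) ≤ ((n : ℝ) + 1)⁻¹ := by
  have hsum : ((n : ℝ) + 1) * (k ^ n * (1 - k)) ≤ 1 := by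
    calc ((n : ℝ) + 1) * (k ^ n * (1 - k))
        = ∑ _i ∈ Finset.range (n + 1), k ^ n * (1 - k) := by simp
      _ ≤ ∑ i ∈ Finset.range (n + 1), k ^ i * (1 - k) := by
          refine Finset.sum_le_sum fun i hi => ?_
          have : k ^ n ≤ k ^ i :=
            pow_le_pow_of_le_one h0 h1 (Nat.lt_succ_iff.mp (Finset.mem_range.mp hi))
          exact mul_le_mul_of_nonneg_right this (by linarith)
      _ = 1 - k ^ (n + 1) := by
          rw [← Finset.sum_mul, geom_sum_mul_neg]
      _ ≤ 1 := by linarith [pow_nonneg h0 (n + 1)]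
  rw [← one_div, le_div_iff₀ (by positivity)]
  linarith

lemma pow_mul_one_sub_sq_le {k : ℝ} (h0 : 0 ≤ k) (h1 : k ≤ 1) (n : ℕ) :
    k ^ n * (1 - k) ^ 2 ≤ 4 * (((n : ℝ) + 1) ^ 2)⁻¹ := by
  have h2 : k ^ n ≤ (k ^ (n / 2)) ^ 2 := by
    rw [← pow_mul]
    exact pow_le_pow_of_le_one h0 h1 (by omega)
  have h3 := pow_mul_one_sub_le h0 h1 (n / 2)
  have h4 : (((n / 2 : ℕ) : ℝ) + 1)⁻¹ ≤ 2 * ((n : ℝ) + 1)⁻¹ := by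
    have h5 : (n : ℝ) + 1 ≤ 2 * (((n / 2 : ℕ) : ℝ) + 1) := by
      have : n + 1 ≤ 2 * (n / 2 + 1) := by omega
      exact_mod_cast this
    rw [← div_eq_mul_inv, le_div_iff₀ (by positivity), inv_mul_le_iff₀ (by positivity)]
    linarith
  calc k ^ n * (1 - k) ^ 2 ≤ (k ^ (n / 2)) ^ 2 * (1 - k) ^ 2 := by gcongr
    _ = (k ^ (n / 2) * (1 - k)) ^ 2 := by ring
    _ ≤ (2 * ((n : ℝ) + 1)⁻¹) ^ 2 := by
        refine pow_le_pow_left₀ ?_ (h3.trans h4) 2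
        exact mul_nonneg (pow_nonneg h0 _) (by linarith)
    _ = 4 * (((n : ℝ) + 1) ^ 2)⁻¹ := by rw [mul_pow, inv_pow]; norm_num

lemma pow_mul_one_sub_rpow_le {k s : ℝ} (h0 : 0 ≤ k) (h1 : k ≤ 1) (hs0 : 0 ≤ s) (hs1 : s ≤ 1)
    (n : ℕ) : k ^ n * (1 - k) ^ s ≤ ((n : ℝ) + 1) ^ (-s) := by
  have hkn : 0 ≤ k ^ n := pow_nonneg h0 n
  have h2 : k ^ n ≤ (k ^ n) ^ s := by
    rcases hkn.eq_or_lt with h | h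
    · rw [← h]; exact Real.rpow_nonneg le_rfl _
    · exact Real.self_le_rpow_of_le_one hkn (pow_le_one₀ h0 h1) hs1
  calc k ^ n * (1 - k) ^ s ≤ (k ^ n) ^ s * (1 - k) ^ s := by
        gcongr
    _ = (k ^ n * (1 - k)) ^ s := (Real.mul_rpow hkn (by linarith)).symm
    _ ≤ (((n : ℝ) + 1)⁻¹) ^ s :=
        Real.rpow_le_rpow (mul_nonneg hkn (by linarith)) (pow_mul_one_sub_le h0 h1 n) hs0
    _ = ((n : ℝ) + 1) ^ (-s) := by
        rw [Real.rpow_neg (by positivity), Real.inv_rpow (by positivity)]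

/-- The size of the commutator of `D` with `Δ³ Kⁿ⁺¹`, up to a constant: the first summand comes
from differentiating `Δ³`, the sum from differentiating the factors `K` one by one. -/
def commWeight (n : ℕ) : ℝ :=
  ((n : ℝ) + 1) ^ (-(1 / 4) : ℝ) +
    ∑ i ∈ Finset.range (n + 1), ((i : ℝ) + 1)⁻¹ * (((n - i : ℕ) : ℝ) + 1) ^ (-(1 / 4) : ℝ)

lemma commWeight_nonneg (n : ℕ) : 0 ≤ commWeight n := by
  unfold commWeight
  positivity

lemma summable_add_one_rpow {s : ℝ} (hs : s < -1) : Summable fun n : ℕ => ((n : ℝ) + 1) ^ s := by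
  have := (summable_nat_add_iff 1).mpr (Real.summable_nat_rpow.mpr hs)
  simpa using this

/-- Up to the exponents, `commWeight` is a convolution; the power of `n + 1` is distributed over the
two factors so that both become summable. -/
lemma summable_commWeight {s : ℝ} (hs : s ≤ -(7 / 8)) :
    Summable fun n : ℕ => commWeight n * ((n : ℝ) + 1) ^ s := by
  have hf := summable_add_one_rpow (s := -(17 / 16)) (by norm_num)
  have hconv := summable_norm_sum_mul_range_of_summable_norm hf.norm hf.norm
  have hconv' := hconv.of_norm
  refine Summable.of_nonneg_of_le (fun n => mul_nonneg (commWeight_nonneg n) (by positivity))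
    (fun n => ?_) ((summable_add_one_rpow (s := -(9 / 8)) (by norm_num)).add hconv')
  have hn1 : (1 : ℝ) ≤ (n : ℝ) + 1 := by linarith [Nat.cast_nonneg (α := ℝ) n]
  have hs' : ((n : ℝ) + 1) ^ s ≤ ((n : ℝ) + 1) ^ (-(7 / 8) : ℝ) :=
    Real.rpow_le_rpow_of_exponent_le hn1 hs
  refine (mul_le_mul_of_nonneg_left hs' (commWeight_nonneg n)).trans ?_
  rw [commWeight, add_mul, Finset.sum_mul]
  refine add_le_add ?_ (Finset.sum_le_sum fun i hi => ?_)
  · rw [← Real.rpow_add (by positivity)]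
    norm_num
  · have hin : i ≤ n := Nat.lt_succ_iff.mp (Finset.mem_range.mp hi)
    have h1 : ((n : ℝ) + 1) ^ (-(7 / 8) : ℝ) ≤
        ((i : ℝ) + 1) ^ (-(1 / 16) : ℝ) * (((n - i : ℕ) : ℝ) + 1) ^ (-(13 / 16) : ℝ) := by
      have e : ((n : ℝ) + 1) ^ (-(7 / 8) : ℝ) =
          ((n : ℝ) + 1) ^ (-(1 / 16) : ℝ) * ((n : ℝ) + 1) ^ (-(13 / 16) : ℝ) := by
        rw [← Real.rpow_add (by positivity)]
        norm_num
      rw [e]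
      have hi' : (i : ℝ) + 1 ≤ (n : ℝ) + 1 := by exact_mod_cast Nat.succ_le_succ hin
      have hj' : ((n - i : ℕ) : ℝ) + 1 ≤ (n : ℝ) + 1 := by
        exact_mod_cast Nat.succ_le_succ (Nat.sub_le n i)
      have a1 : ((n : ℝ) + 1) ^ (-(1 / 16) : ℝ) ≤ ((i : ℝ) + 1) ^ (-(1 / 16) : ℝ) :=
        Real.rpow_le_rpow_of_nonpos (by positivity) hi' (by norm_num)
      have a2 : ((n : ℝ) + 1) ^ (-(13 / 16) : ℝ) ≤ (((n - i : ℕ) : ℝ) + 1) ^ (-(13 / 16) : ℝ) :=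
        Real.rpow_le_rpow_of_nonpos (by positivity) hj' (by norm_num)
      gcongr
    calc ((i : ℝ) + 1)⁻¹ * (((n - i : ℕ) : ℝ) + 1) ^ (-(1 / 4) : ℝ) *
          ((n : ℝ) + 1) ^ (-(7 / 8) : ℝ)
        ≤ ((i : ℝ) + 1)⁻¹ * (((n - i : ℕ) : ℝ) + 1) ^ (-(1 / 4) : ℝ) *
          (((i : ℝ) + 1) ^ (-(1 / 16) : ℝ) * (((n - i : ℕ) : ℝ) + 1) ^ (-(13 / 16) : ℝ)) := by
          gcongr
      _ = (((i : ℝ) + 1) ^ (-1 : ℝ) * ((i : ℝ) + 1) ^ (-(1 / 16) : ℝ)) *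
          ((((n - i : ℕ) : ℝ) + 1) ^ (-(1 / 4) : ℝ) *
            (((n - i : ℕ) : ℝ) + 1) ^ (-(13 / 16) : ℝ)) := by
          rw [Real.rpow_neg_one]; ring
      _ = ((i : ℝ) + 1) ^ (-(17 / 16) : ℝ) * (((n - i : ℕ) : ℝ) + 1) ^ (-(17 / 16) : ℝ) := by
          rw [← Real.rpow_add (by positivity), ← Real.rpow_add (by positivity)]
          norm_num

lemma integrableOn_rpow_mul_one_add_rpow {t : ℝ} (ht : t < -(1 / 2)) :
    IntegrableOn (fun l : ℝ => l ^ (-(1 / 2) : ℝ) * (1 + l) ^ t) (Ioi 0) := by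
  have hcont : ContinuousOn (fun l : ℝ => l ^ (-(1 / 2) : ℝ) * (1 + l) ^ t) (Ioi 0) := by
    refine ContinuousOn.mul ?_ ?_
    · exact ContinuousOn.rpow_const continuousOn_id fun l hl => Or.inl (ne_of_gt hl)
    · exact ContinuousOn.rpow_const (by fun_prop) fun l hl => Or.inl (by
        have : (0 : ℝ) < l := hl
        positivity)
  have hmeas := hcont.aestronglyMeasurable (μ := volume) measurableSet_Ioi
  have hb1 : IntegrableOn (fun l : ℝ => l ^ (-(1 / 2) : ℝ)) (Ioc 0 1) := by
    rw [← intervalIntegrable_iff_integrableOn_Ioc_of_le zero_le_one]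
    exact intervalIntegral.intervalIntegrable_rpow' (by norm_num)
  have hb2 : IntegrableOn (fun l : ℝ => l ^ (-(1 / 2) + t)) (Ioi 1) :=
    integrableOn_Ioi_rpow_of_lt (by linarith) one_pos
  rw [← Ioc_union_Ioi_eq_Ioi (zero_le_one (α := ℝ))]
  refine IntegrableOn.union ?_ ?_
  · refine Integrable.mono' hb1 (hmeas.mono_set Ioc_subset_Ioi_self) ?_
    refine ae_restrict_of_forall_mem measurableSet_Ioc fun l hl => ?_
    have hl0 : 0 < l := hl.1
    rw [Real.norm_of_nonneg (by positivity)]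
    refine mul_le_of_le_one_right (by positivity) ?_
    exact Real.rpow_le_one_of_one_le_of_nonpos (by linarith) (by linarith)
  · refine Integrable.mono' hb2 (hmeas.mono_set (Ioi_subset_Ioi zero_le_one)) ?_
    refine ae_restrict_of_forall_mem measurableSet_Ioi fun l hl => ?_
    have hl0 : 0 < l := one_pos.trans hl
    rw [Real.norm_of_nonneg (by positivity), Real.rpow_add hl0]
    gcongr ?_ * ?_
    exact Real.rpow_le_rpow_of_nonpos hl0 (by linarith) (by linarith)

/-- The integrand of the identity `∫₀^∞ l^(-1/2) (l x / (1 + l x))ⁿ x / (1 + l x) dl = π cₙ √x`;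
the second argument is the integration variable. -/
def resKernel (n : ℕ) (l x : ℝ) : ℝ :=
  l ^ (-(1 / 2) : ℝ) * ((l * x / (1 + l * x)) ^ n * (x / (1 + l * x)))

/-- The numbers `cₙ`, which are the Taylor coefficients of `k ↦ (1 - k)^(-1/2)`. -/
def invSqrtCoeff (n : ℕ) : ℝ := Real.pi⁻¹ * ∫ l in Ioi (0 : ℝ), resKernel n l 1

lemma div_one_add_le {l x : ℝ} (hl : 0 ≤ l) (hx0 : 0 ≤ x) (hx1 : x ≤ 1) :
    x / (1 + l * x) ≤ (1 + l)⁻¹ := by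
  rw [← one_div, div_le_div_iff₀ (by positivity) (by positivity)]
  nlinarith

lemma mul_div_one_add_mem {l x : ℝ} (hl : 0 ≤ l) (hx0 : 0 ≤ x) :
    0 ≤ l * x / (1 + l * x) ∧ l * x / (1 + l * x) ≤ 1 :=
  ⟨by positivity, by rw [div_le_one (by positivity)]; linarith⟩

lemma resKernel_nonneg {n : ℕ} {l x : ℝ} (hl : 0 ≤ l) (hx0 : 0 ≤ x) : 0 ≤ resKernel n l x := by
  unfold resKernel
  positivity

lemma resKernel_le {n : ℕ} {l x : ℝ} (hl : 0 ≤ l) (hx0 : 0 ≤ x) (hx1 : x ≤ 1) :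
    resKernel n l x ≤ l ^ (-(1 / 2) : ℝ) * (1 + l) ^ (-1 : ℝ) := by
  unfold resKernel
  rw [Real.rpow_neg_one]
  have h := mul_div_one_add_mem hl hx0
  gcongr
  exact (mul_le_of_le_one_left (by positivity) (pow_le_one₀ h.1 h.2)).trans
    (div_one_add_le hl hx0 hx1)

lemma continuousOn_resKernel (n : ℕ) :
    ContinuousOn (Function.uncurry (resKernel n)) (Ioi 0 ×ˢ Icc 0 1) := by
  have h : ∀ q ∈ (Ioi 0 ×ˢ Icc 0 1 : Set (ℝ × ℝ)), 1 + q.1 * q.2 ≠ 0 := by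
    rintro ⟨l, x⟩ ⟨hl, hx⟩
    have h1 : (0 : ℝ) < l := hl
    have h2 : (0 : ℝ) ≤ x := hx.1
    have : (0 : ℝ) < 1 + l * x := by positivity
    exact this.ne'
  unfold resKernel Function.uncurry
  refine ContinuousOn.mul ?_ (ContinuousOn.mul (ContinuousOn.pow ?_ n) ?_)
  · exact ContinuousOn.rpow_const (by fun_prop) fun q hq => Or.inl (ne_of_gt hq.1)
  · exact ContinuousOn.div (by fun_prop) (by fun_prop) h
  · exact ContinuousOn.div (by fun_prop) (by fun_prop) h

lemma integrableOn_resKernel (n : ℕ) {x : ℝ} (hx0 : 0 ≤ x) (hx1 : x ≤ 1) :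
    IntegrableOn (fun l => resKernel n l x) (Ioi 0) := by
  refine Integrable.mono' (integrableOn_rpow_mul_one_add_rpow (t := -1) (by norm_num)) ?_ ?_
  · refine ContinuousOn.aestronglyMeasurable ?_ measurableSet_Ioi
    exact (continuousOn_resKernel n).comp (f := fun l : ℝ => (l, x)) (by fun_prop)
      fun l hl => ⟨hl, hx0, hx1⟩
  · refine ae_restrict_of_forall_mem measurableSet_Ioi fun l hl => ?_
    rw [Real.norm_of_nonneg (resKernel_nonneg (le_of_lt hl) hx0)]
    exact resKernel_le (le_of_lt hl) hx0 hx1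

lemma integral_resKernel (n : ℕ) {x : ℝ} (hx0 : 0 ≤ x) :
    ∫ l in Ioi (0 : ℝ), resKernel n l x = Real.pi * invSqrtCoeff n * √x := by
  rw [invSqrtCoeff, mul_inv_cancel_left₀ Real.pi_ne_zero]
  rcases hx0.eq_or_lt with rfl | hx
  · simp [resKernel]
  have h1 : ∫ l in Ioi (0 : ℝ), resKernel n (x * l) 1 =
      x⁻¹ * ∫ l in Ioi (0 : ℝ), resKernel n l 1 := by
    have := integral_comp_mul_left_Ioi (fun l => resKernel n l 1) 0 hx
    simpa using this
  have h2 : ∫ l in Ioi (0 : ℝ), resKernel n l x =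
      ∫ l in Ioi (0 : ℝ), (x * √x) * resKernel n (x * l) 1 := by
    refine setIntegral_congr_fun measurableSet_Ioi fun l hl => ?_
    have hl' : (0 : ℝ) < l := hl
    simp only [resKernel]
    rw [Real.mul_rpow hx.le hl'.le, Real.rpow_neg hx.le, ← Real.sqrt_eq_rpow]
    have : √x ≠ 0 := (Real.sqrt_pos.mpr hx).ne'
    field_simp
  rw [h2, integral_const_mul, h1]
  field_simp

lemma integral_rpow_neg_half_div {c : ℝ} (hc : 0 < c) :
    ∫ l in Ioi (0 : ℝ), l ^ (-(1 / 2) : ℝ) * (1 + c * l)⁻¹ = Real.pi / √c := by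
  have h1 : ∫ l in Ioi (0 : ℝ), l ^ (-(1 / 2) : ℝ) * (1 + l)⁻¹ = Real.pi := by
    have h := integral_comp_rpow_Ioi_of_pos (g := fun l : ℝ => l ^ (-(1 / 2) : ℝ) * (1 + l)⁻¹)
      (p := 2) two_pos
    rw [← h]
    have h3 : ∫ l in Ioi (0 : ℝ), (2 * l ^ ((2 : ℝ) - 1)) •
        ((l ^ (2 : ℝ)) ^ (-(1 / 2) : ℝ) * (1 + l ^ (2 : ℝ))⁻¹) =
        ∫ l in Ioi (0 : ℝ), 2 * (1 + l ^ 2)⁻¹ := by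
      refine setIntegral_congr_fun measurableSet_Ioi fun l hl => ?_
      have hl' : (0 : ℝ) < l := hl
      simp only [smul_eq_mul]
      rw [← Real.rpow_mul hl'.le]
      norm_num
      rw [Real.rpow_neg_one]
      field_simp
    rw [h3, integral_const_mul, integral_Ioi_inv_one_add_sq]
    simp
    ring
  have h2 := integral_comp_mul_left_Ioi (fun l : ℝ => l ^ (-(1 / 2) : ℝ) * (1 + l)⁻¹) 0 hc
  rw [mul_zero, h1] at h2
  have h4 : ∫ l in Ioi (0 : ℝ), l ^ (-(1 / 2) : ℝ) * (1 + c * l)⁻¹ =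
      ∫ l in Ioi (0 : ℝ), √c * ((c * l) ^ (-(1 / 2) : ℝ) * (1 + c * l)⁻¹) := by
    refine setIntegral_congr_fun measurableSet_Ioi fun l hl => ?_
    have hl' : (0 : ℝ) < l := hl
    rw [Real.mul_rpow hc.le hl'.le, Real.rpow_neg hc.le, ← Real.sqrt_eq_rpow]
    have : √c ≠ 0 := (Real.sqrt_pos.mpr hc).ne'
    field_simp
  rw [h4, integral_const_mul, h2, smul_eq_mul]
  have : √c ≠ 0 := (Real.sqrt_pos.mpr hc).ne'
  field_simp
  rw [Real.sq_sqrt hc.le]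

lemma invSqrtCoeff_nonneg (n : ℕ) : 0 ≤ invSqrtCoeff n := by
  refine mul_nonneg (by positivity) (setIntegral_nonneg measurableSet_Ioi fun l hl => ?_)
  exact resKernel_nonneg (le_of_lt hl) zero_le_one

lemma integral_resKernel_le_pi (n : ℕ) :
    ∫ l in Ioi (0 : ℝ), resKernel n l 1 ≤ Real.pi := by
  have h := integral_rpow_neg_half_div one_pos
  simp only [one_mul, Real.sqrt_one, div_one] at h
  rw [← h]
  have hi := integrableOn_rpow_mul_one_add_rpow (t := -1) (by norm_num)
  simp only [Real.rpow_neg_one] at hi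
  refine setIntegral_mono_on (integrableOn_resKernel n zero_le_one le_rfl) hi measurableSet_Ioi
    fun l hl => ?_
  have := resKernel_le (n := n) (le_of_lt hl) zero_le_one le_rfl
  rwa [Real.rpow_neg_one] at this

lemma invSqrtCoeff_le_one (n : ℕ) : invSqrtCoeff n ≤ 1 := by
  rw [invSqrtCoeff, inv_mul_le_iff₀ Real.pi_pos, mul_one]
  exact integral_resKernel_le_pi n

/-- The binomial series, from summing the geometric series under the integral. -/
lemma hasSum_invSqrtCoeff {k : ℝ} (h0 : 0 ≤ k) (h1 : k < 1) :
    HasSum (fun n => invSqrtCoeff n * k ^ n) (√(1 - k))⁻¹ := by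
  have hk : 0 < 1 - k := by linarith
  have hint : ∀ n, Integrable (fun l => resKernel n l 1 * k ^ n) (volume.restrict (Ioi 0)) :=
    fun n => (integrableOn_resKernel n zero_le_one le_rfl).mul_const _
  have hsum : Summable fun n => ∫ l in Ioi (0 : ℝ), ‖resKernel n l 1 * k ^ n‖ := by
    refine Summable.of_nonneg_of_le (fun n => integral_nonneg fun _ => norm_nonneg _) (fun n => ?_)
      ((summable_geometric_of_lt_one h0 h1).mul_left Real.pi)
    have e : ∫ l in Ioi (0 : ℝ), ‖resKernel n l 1 * k ^ n‖ =
        ∫ l in Ioi (0 : ℝ), resKernel n l 1 * k ^ n := by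
      refine setIntegral_congr_fun measurableSet_Ioi fun l hl => ?_
      exact Real.norm_of_nonneg
        (mul_nonneg (resKernel_nonneg (le_of_lt hl) zero_le_one) (pow_nonneg h0 n))
    rw [e, integral_mul_const]
    exact mul_le_mul_of_nonneg_right (integral_resKernel_le_pi n) (pow_nonneg h0 n)
  have h := hasSum_integral_of_summable_integral_norm hint hsum
  have hlim : ∫ l in Ioi (0 : ℝ), ∑' n, resKernel n l 1 * k ^ n = Real.pi / √(1 - k) := by
    rw [← integral_rpow_neg_half_div hk]
    refine setIntegral_congr_fun measurableSet_Ioi fun l hl => ?_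
    have hl' : (0 : ℝ) < l := hl
    have hq0 : 0 ≤ l / (1 + l) * k := by positivity
    have hq1 : l / (1 + l) * k < 1 := by
      rw [div_mul_eq_mul_div, div_lt_one (by positivity)]
      nlinarith
    have hg := (hasSum_geometric_of_lt_one hq0 hq1).mul_left (l ^ (-(1 / 2) : ℝ) * (1 + l)⁻¹)
    have e : (fun n => resKernel n l 1 * k ^ n) =
        fun n => l ^ (-(1 / 2) : ℝ) * (1 + l)⁻¹ * (l / (1 + l) * k) ^ n := by
      funext n
      simp only [resKernel, mul_one, mul_pow]
      ring
    rw [e, hg.tsum_eq]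
    have h3 : 1 - l / (1 + l) * k = (1 + (1 - k) * l) / (1 + l) := by field_simp; ring
    have h4 : (0 : ℝ) < 1 + (1 - k) * l := by positivity
    rw [h3]
    field_simp
  rw [hlim] at h
  have h5 := h.mul_left Real.pi⁻¹
  rw [div_eq_mul_inv, inv_mul_cancel_left₀ Real.pi_ne_zero] at h5
  refine h5.congr_fun fun n => ?_
  rw [integral_mul_const, invSqrtCoeff, mul_assoc]

section CStar

variable {𝒜 : Type*} [CStarAlgebra 𝒜] [PartialOrder 𝒜] [StarOrderedRing 𝒜]

/-! ### Functions of a positive contraction -/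

lemma spectrum_subset_Icc {A : 𝒜} (h0 : 0 ≤ A) (h1 : A ≤ 1) : spectrum ℝ A ⊆ Icc 0 1 := by
  intro x hx
  refine ⟨spectrum_nonneg_of_nonneg h0 hx, ?_⟩
  have hsa : IsSelfAdjoint A := .of_nonneg h0
  have h : A ≤ algebraMap ℝ 𝒜 1 := by simpa using h1
  exact (le_algebraMap_iff_spectrum_le (r := (1 : ℝ)) (a := A)).mp h x hx

lemma norm_cfc_le_of_Icc {A : 𝒜} (h0 : 0 ≤ A) (h1 : A ≤ 1) {f : ℝ → ℝ} {c : ℝ} (hc : 0 ≤ c)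
    (hf : ∀ x ∈ Icc (0 : ℝ) 1, |f x| ≤ c) : ‖cfc f A‖ ≤ c :=
  norm_cfc_le hc fun x hx => hf x (spectrum_subset_Icc h0 h1 hx)

/-- The resolvent `(l + A⁻¹)⁻¹ = A (1 + l A)⁻¹`. For `A = (1 + D²)⁻¹` this is `(l + 1 + D²)⁻¹`. -/
def resolv (A : 𝒜) (l : ℝ) : 𝒜 := cfc (fun x : ℝ => x / (1 + l * x)) A

/-- The damping factor `(1 + l A)⁻¹`. -/
def damp (A : 𝒜) (l : ℝ) : 𝒜 := cfc (fun x : ℝ => (1 + l * x)⁻¹) A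

lemma one_add_mul_ne_zero {l x : ℝ} (hl : 0 ≤ l) (hx : x ∈ Icc (0 : ℝ) 1) : 1 + l * x ≠ 0 := by
  have := hx.1
  positivity

lemma continuousOn_res {l : ℝ} (hl : 0 ≤ l) :
    ContinuousOn (fun x : ℝ => x / (1 + l * x)) (Icc 0 1) :=
  ContinuousOn.div (by fun_prop) (by fun_prop) fun _ hx => one_add_mul_ne_zero hl hx

lemma continuousOn_damp {l : ℝ} (hl : 0 ≤ l) :
    ContinuousOn (fun x : ℝ => (1 + l * x)⁻¹) (Icc 0 1) :=
  ContinuousOn.inv₀ (by fun_prop) fun _ hx => one_add_mul_ne_zero hl hx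

section UnitInterval

variable {A : 𝒜} (h0 : 0 ≤ A) (h1 : A ≤ 1)
include h0 h1

lemma cfc_mul_cfc_eq {f g k : ℝ → ℝ} (hf : ContinuousOn f (Icc 0 1)) (hg : ContinuousOn g (Icc 0 1))
    (hk : ∀ x ∈ Icc (0 : ℝ) 1, f x * g x = k x) : cfc f A * cfc g A = cfc k A := by
  have hs := spectrum_subset_Icc h0 h1
  rw [← cfc_mul f g A (hf.mono hs) (hg.mono hs)]
  exact cfc_congr fun x hx => hk x (hs hx)

lemma damp_mul_one_add {l : ℝ} (hl : 0 ≤ l) : damp A l * (1 + l • A) = 1 := by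
  have hsa : IsSelfAdjoint A := .of_nonneg h0
  have e : (1 : 𝒜) + l • A = cfc (fun x : ℝ => 1 + l * x) A := by
    rw [cfc_const_add 1 (fun x => l * x) A, cfc_const_mul l (fun x => x) A, cfc_id' ℝ A]
    simp
  rw [e, damp, cfc_mul_cfc_eq h0 h1 (continuousOn_damp hl) (k := fun _ => 1) (by fun_prop),
    cfc_const_one ℝ A]
  intro x hx
  exact inv_mul_cancel₀ (one_add_mul_ne_zero hl hx)

lemma damp_mul_self {l : ℝ} (hl : 0 ≤ l) : damp A l * A = resolv A l := by
  have hsa : IsSelfAdjoint A := .of_nonneg h0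
  calc damp A l * A = damp A l * cfc (fun x : ℝ => x) A := by rw [cfc_id' ℝ A]
    _ = resolv A l := cfc_mul_cfc_eq h0 h1 (continuousOn_damp hl) (by fun_prop)
        fun x _ => by rw [div_eq_mul_inv, mul_comm]

omit h1 in
lemma commute_damp (l : ℝ) : Commute (damp A l) A := by
  have hsa : IsSelfAdjoint A := .of_nonneg h0
  have h := cfc_commute_cfc (fun x : ℝ => (1 + l * x)⁻¹) (fun x => x) A
  rwa [cfc_id' ℝ A] at h

lemma one_sub_smul_resolv {l : ℝ} (hl : 0 ≤ l) : 1 - l • resolv A l = damp A l := by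
  rw [← damp_mul_self h0 h1 hl, ← mul_smul_comm]
  nth_rw 1 [← damp_mul_one_add h0 h1 hl]
  rw [mul_add, mul_one, add_sub_cancel_right]

lemma norm_resolv_le {l : ℝ} (hl : 0 ≤ l) : ‖resolv A l‖ ≤ (1 + l)⁻¹ := by
  refine norm_cfc_le_of_Icc h0 h1 (by positivity) fun x hx => ?_
  have := hx.1
  rw [abs_of_nonneg (by positivity)]
  exact div_one_add_le hl hx.1 hx.2

lemma one_add_mul_damp {l : ℝ} (hl : 0 ≤ l) : (1 + l • A) * damp A l = 1 := by
  have hc : Commute (damp A l) (1 + l • A) :=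
    (Commute.one_right _).add_right ((commute_damp h0 l).smul_right l)
  rw [← hc.eq, damp_mul_one_add h0 h1 hl]

lemma continuousOn_resolv : ContinuousOn (resolv A) (Ici 0) := by
  have hinv : ∀ l ∈ Ici (0 : ℝ), resolv A l = Ring.inverse (1 + l • A) * A := by
    intro l hl
    let u : 𝒜ˣ := ⟨1 + l • A, damp A l, one_add_mul_damp h0 h1 hl, damp_mul_one_add h0 h1 hl⟩
    have : Ring.inverse (1 + l • A) = damp A l := Ring.inverse_unit u
    rw [this, damp_mul_self h0 h1 hl]
  refine ContinuousOn.congr ?_ hinv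
  intro l hl
  let u : 𝒜ˣ := ⟨1 + l • A, damp A l, one_add_mul_damp h0 h1 hl, damp_mul_one_add h0 h1 hl⟩
  have hc : ContinuousAt (fun l : ℝ => Ring.inverse (1 + l • A)) l :=
    ContinuousAt.comp (g := Ring.inverse) (f := fun l : ℝ => 1 + l • A)
      (NormedRing.inverse_continuousAt u) (by fun_prop)
  exact (hc.mul continuousAt_const).continuousWithinAt

omit h1 in
lemma rpow_half_mul_self : A ^ (1 / 2 : ℝ) * A ^ (1 / 2 : ℝ) = A := by
  rw [← CFC.sqrt_eq_rpow, CFC.sqrt_mul_sqrt_self A h0]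

omit h0 h1 in
lemma continuousOn_rpow_Icc {s : ℝ} (hs : 0 ≤ s) :
    ContinuousOn (fun x : ℝ => x ^ s) (Icc 0 1) :=
  ContinuousOn.rpow_const continuousOn_id fun _ _ => Or.inr hs

lemma rpow_mul_rpow {s t : ℝ} (hs : 0 ≤ s) (ht : 0 ≤ t) : A ^ s * A ^ t = A ^ (s + t) := by
  rw [CFC.rpow_eq_cfc_real h0, CFC.rpow_eq_cfc_real h0, CFC.rpow_eq_cfc_real h0]
  exact cfc_mul_cfc_eq h0 h1 (continuousOn_rpow_Icc hs) (continuousOn_rpow_Icc ht) fun x hx =>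
    (Real.rpow_add_of_nonneg hx.1 hs ht).symm

lemma norm_rpow_le_one {s : ℝ} (hs : 0 ≤ s) : ‖A ^ s‖ ≤ 1 := by
  rw [CFC.rpow_eq_cfc_real h0]
  refine norm_cfc_le_of_Icc h0 h1 zero_le_one fun x hx => ?_
  rw [abs_of_nonneg (Real.rpow_nonneg hx.1 _)]
  exact Real.rpow_le_one hx.1 hx.2 hs

end UnitInterval

lemma rpow_mul_damp_sq_mul_pow_le {α s σ l x : ℝ} (hσ0 : 0 ≤ σ) (hσ1 : σ ≤ 1) (hsα : s ≤ α)
    (hσ : σ ≤ 2 - α + s) (hl : 0 ≤ l) (hx : x ∈ Icc (0 : ℝ) 1) (n : ℕ) :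
    x ^ (α - s) * ((1 + l * x)⁻¹ ^ 2 * (l * (x / (1 + l * x))) ^ n) ≤
      (1 + l) ^ (s - α) * ((n : ℝ) + 1) ^ (-σ) := by
  obtain ⟨hx0, hx1⟩ := hx
  have hpos : 0 < 1 + l * x := by positivity
  have he0 : 0 < (1 + l * x)⁻¹ := inv_pos.mpr hpos
  have he1 : (1 + l * x)⁻¹ ≤ 1 := inv_le_one_of_one_le₀ (by nlinarith)
  have hk : l * (x / (1 + l * x)) = 1 - (1 + l * x)⁻¹ := by field_simp; ring
  have hsq : (1 + l * x)⁻¹ ^ 2 = (1 + l * x)⁻¹ ^ (α - s) * (1 + l * x)⁻¹ ^ (2 - α + s) := by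
    rw [← Real.rpow_add he0, ← Real.rpow_natCast]
    congr 1
    push_cast
    ring
  have h1 : x ^ (α - s) * (1 + l * x)⁻¹ ^ (α - s) ≤ (1 + l) ^ (s - α) := by
    rw [← Real.mul_rpow hx0 he0.le, ← div_eq_mul_inv]
    refine (Real.rpow_le_rpow (by positivity) (div_one_add_le hl hx0 hx1) (by linarith)).trans ?_
    rw [Real.inv_rpow (by positivity), ← Real.rpow_neg (by positivity), neg_sub]
  have h2 : (1 + l * x)⁻¹ ^ (2 - α + s) ≤ (1 + l * x)⁻¹ ^ σ :=
    Real.rpow_le_rpow_of_exponent_ge he0 he1 hσ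
  have h3 := pow_mul_one_sub_rpow_le (k := 1 - (1 + l * x)⁻¹) (by linarith) (by linarith)
    hσ0 hσ1 n
  rw [sub_sub_cancel] at h3
  rw [hsq, hk]
  calc x ^ (α - s) * ((1 + l * x)⁻¹ ^ (α - s) * (1 + l * x)⁻¹ ^ (2 - α + s) *
        (1 - (1 + l * x)⁻¹) ^ n)
      = (x ^ (α - s) * (1 + l * x)⁻¹ ^ (α - s)) *
        ((1 - (1 + l * x)⁻¹) ^ n * (1 + l * x)⁻¹ ^ (2 - α + s)) := by ring
    _ ≤ (1 + l) ^ (s - α) * ((1 - (1 + l * x)⁻¹) ^ n * (1 + l * x)⁻¹ ^ σ) := by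
        have : 0 ≤ 1 - (1 + l * x)⁻¹ := by linarith
        gcongr
    _ ≤ _ := by gcongr

/-- A function of `A` that vanishes at `0` to order `α` is divisible by `A^s` for `s ≤ α`; the
powers of `l R` make the quotient small. -/
lemma exists_rpow_factor {A : 𝒜} (h0 : 0 ≤ A) (h1 : A ≤ 1) {α s σ l : ℝ} (hσ0 : 0 ≤ σ)
    (hσ1 : σ ≤ 1) (hs : 0 ≤ s) (hsα : s ≤ α) (hσ : σ ≤ 2 - α + s) (hl : 0 ≤ l) (n : ℕ) :
    ∃ f : 𝒜, A ^ α * (damp A l ^ 2 * (l • resolv A l) ^ n) = f * A ^ s ∧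
      ‖f‖ ≤ (1 + l) ^ (s - α) * ((n : ℝ) + 1) ^ (-σ) := by
  have hsa : IsSelfAdjoint A := .of_nonneg h0
  have hsp := spectrum_subset_Icc h0 h1
  have hE : ContinuousOn (fun x : ℝ => (1 + l * x)⁻¹ ^ 2) (Icc 0 1) := (continuousOn_damp hl).pow 2
  have hR : ContinuousOn (fun x : ℝ => (l * (x / (1 + l * x))) ^ n) (Icc 0 1) :=
    (continuousOn_const.mul (continuousOn_res hl)).pow n
  have hER : ContinuousOn (fun x : ℝ => (1 + l * x)⁻¹ ^ 2 * (l * (x / (1 + l * x))) ^ n)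
    (Icc 0 1) := hE.mul hR
  have hf : ContinuousOn (fun x : ℝ => x ^ (α - s) *
      ((1 + l * x)⁻¹ ^ 2 * (l * (x / (1 + l * x))) ^ n)) (Icc 0 1) :=
    (continuousOn_rpow_Icc (sub_nonneg.mpr hsα)).mul hER
  refine ⟨cfc (fun x : ℝ => x ^ (α - s) *
    ((1 + l * x)⁻¹ ^ 2 * (l * (x / (1 + l * x))) ^ n)) A, ?_, ?_⟩
  · have e1 : damp A l ^ 2 = cfc (fun x : ℝ => (1 + l * x)⁻¹ ^ 2) A :=
      (cfc_pow (fun x : ℝ => (1 + l * x)⁻¹) 2 A ((continuousOn_damp hl).mono hsp)).symm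
    have e2 : (l • resolv A l) ^ n = cfc (fun x : ℝ => (l * (x / (1 + l * x))) ^ n) A := by
      rw [cfc_pow (fun x : ℝ => l * (x / (1 + l * x))) n A
        ((continuousOn_const.mul (continuousOn_res hl)).mono hsp),
        cfc_const_mul l (fun x : ℝ => x / (1 + l * x)) A ((continuousOn_res hl).mono hsp), resolv]
    rw [e1, e2, CFC.rpow_eq_cfc_real h0, CFC.rpow_eq_cfc_real h0,
      cfc_mul_cfc_eq h0 h1 hE hR fun _ _ => rfl,
      cfc_mul_cfc_eq h0 h1 (continuousOn_rpow_Icc (hs.trans hsα)) hER fun _ _ => rfl,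
      cfc_mul_cfc_eq h0 h1 hf (continuousOn_rpow_Icc hs)]
    intro x hx
    have : x ^ α = x ^ (α - s) * x ^ s := by
      rw [← Real.rpow_add_of_nonneg hx.1 (sub_nonneg.mpr hsα) hs, sub_add_cancel]
    rw [this]
    ring
  · refine norm_cfc_le_of_Icc h0 h1 (by positivity) fun x hx => ?_
    have := hx.1
    rw [abs_of_nonneg (by positivity)]
    exact rpow_mul_damp_sq_mul_pow_le hσ0 hσ1 hsα hσ hl hx n

section Factor

variable {A : 𝒜} (h0 : 0 ≤ A) (h1 : A ≤ 1)
include h0 h1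

/-- The factor `A^s` split off from `R (l R)ⁿ R`. -/
lemma exists_resolv_pow_factor {s : ℝ} (hs0 : 0 ≤ s) (hs1 : s ≤ 1) {l : ℝ} (hl : 0 ≤ l) (n : ℕ) :
    ∃ f : 𝒜, resolv A l * ((l • resolv A l) ^ n * resolv A l) = f * A ^ s ∧
      ‖f‖ ≤ (1 + l) ^ (s - 2) * ((n : ℝ) + 1) ^ (-s) := by
  obtain ⟨f, hf, hf'⟩ := exists_rpow_factor h0 h1 (α := 2) hs0 hs1 hs0 (by linarith)
    (by linarith) hl n
  refine ⟨f, ?_, hf'⟩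
  rw [← hf, show (2 : ℝ) = ((2 : ℕ) : ℝ) by norm_num, CFC.rpow_natCast A 2 h0]
  have c1 : Commute ((l • resolv A l) ^ n) (resolv A l) :=
    ((Commute.refl (resolv A l)).smul_left l).pow_left n
  rw [c1.eq, ← mul_assoc, ← mul_assoc, ← pow_two]
  congr 1
  rw [← damp_mul_self h0 h1 hl, (commute_damp h0 l).mul_pow, ((commute_damp h0 l).pow_pow 2 2).eq]

/-- The factor `A^s` split off from `A^(1/2) (1 + l A)⁻¹ (l R)ⁿ R`, which is `D R (l R)ⁿ R` up to
the bounded transform of `D`. -/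
lemma exists_half_resolv_pow_factor {s : ℝ} (hs0 : 1 / 2 ≤ s) (hs1 : s ≤ 1) {l : ℝ} (hl : 0 ≤ l)
    (n : ℕ) :
    ∃ f : 𝒜, A ^ (1 / 2 : ℝ) * damp A l * ((l • resolv A l) ^ n * resolv A l) = f * A ^ s ∧
      ‖f‖ ≤ (1 + l) ^ (s - 3 / 2) * ((n : ℝ) + 1) ^ (-1 : ℝ) := by
  obtain ⟨f, hf, hf'⟩ := exists_rpow_factor h0 h1 (α := 3 / 2) (s := s) zero_le_one le_rfl
    (by linarith) (by linarith) (by linarith) hl n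
  refine ⟨f, ?_, hf'⟩
  have hsa : IsSelfAdjoint A := .of_nonneg h0
  have e : A ^ (3 / 2 : ℝ) = A ^ (1 / 2 : ℝ) * A := by
    rw [show (3 / 2 : ℝ) = 1 / 2 + 1 by norm_num,
      ← rpow_mul_rpow h0 h1 (by norm_num) zero_le_one, CFC.rpow_one A h0]
  have c1 : Commute ((l • resolv A l) ^ n) (resolv A l) :=
    ((Commute.refl (resolv A l)).smul_left l).pow_left n
  rw [← hf, e, c1.eq]
  simp only [← mul_assoc]
  congr 1
  rw [mul_assoc (A ^ (1 / 2 : ℝ)), mul_assoc (A ^ (1 / 2 : ℝ))]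
  congr 1
  rw [← damp_mul_self h0 h1 hl, ← mul_assoc, ← pow_two, ((commute_damp h0 l).pow_left 2).eq]

end Factor

end CStar

section Commutators

variable {𝒜 : Type*} [CStarAlgebra 𝒜]

/-- The element `K = 1 - Δ² / r`, in terms of `h = Δ^(1/2)`. -/
def cutoff (h : 𝒜) (r : ℝ) : 𝒜 := 1 - r⁻¹ • h ^ 4

/-- The commutator of `D` with `Δ³ Kⁿ⁺¹` given by the Leibniz rule from `[D, Δ] = h ρ h`, where
`h = Δ^(1/2)`. -/
def commCoeff (h ρ : 𝒜) (r : ℝ) (n : ℕ) : 𝒜 :=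
  h * (ρ * h ^ 4 + h ^ 2 * ρ * h ^ 2 + h ^ 4 * ρ) * h * cutoff h r ^ (n + 1) -
    r⁻¹ • ∑ i ∈ Finset.range (n + 1),
      h ^ 6 * cutoff h r ^ i * (h * (ρ * h ^ 2 + h ^ 2 * ρ) * h) * cutoff h r ^ (n - i)

lemma commute_cutoff (h : 𝒜) (r : ℝ) (m : ℕ) : Commute (h ^ m) (cutoff h r) :=
  (Commute.one_right _).sub_right (((Commute.refl h).pow_pow m 4).smul_right _)

variable [PartialOrder 𝒜] [StarOrderedRing 𝒜]

/-- The relation `[D, u] = d`, multiplied by `(1 + D²)^(-1/2)` from both sides so that only bounded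
operators appear: `A` stands for `(1 + D²)⁻¹` and `F` for `D (1 + D²)^(-1/2)`. -/
def HasBoundedComm (A F u d : 𝒜) : Prop :=
  F * u * A ^ (1 / 2 : ℝ) - A ^ (1 / 2 : ℝ) * u * F = A ^ (1 / 2 : ℝ) * d * A ^ (1 / 2 : ℝ)

/-- The bounded operators extracted from a selfadjoint regular operator `D` and a positive operator
`Δ` with `[D, Δ] = Δ^(1/2) ρ Δ^(1/2)`: `A = (1 + D²)⁻¹`, `F` is the bounded transform of `D`,
and `h = Δ^(1/2)`. -/
structure IsModularData (A F h ρ : 𝒜) (r : ℝ) : Prop where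
  nonneg : 0 ≤ A
  le_one : A ≤ 1
  norm_le : ‖F‖ ≤ 1
  sq_eq : F * F = 1 - A
  commute : Commute F A
  root_nonneg : 0 ≤ h
  norm_root : ‖h‖ ^ 4 < r
  comm_sq : HasBoundedComm A F (h ^ 2) (h * ρ * h)
  comm_pow : ∀ n, HasBoundedComm A F (h ^ 6 * cutoff h r ^ (n + 1)) (commCoeff h ρ r n)

/-! ### Commutators with the resolvent -/

/-- The bounded operator `D (l + 1 + D²)⁻¹`. -/
def dresolv (A F : 𝒜) (l : ℝ) : 𝒜 := F * (A ^ (1 / 2 : ℝ) * damp A l)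

lemma commute_rpow {A F : 𝒜} (hF : Commute F A) (s : ℝ) : Commute F (A ^ s) :=
  (hF.symm.cfc_nnreal _).symm

omit [PartialOrder 𝒜] [StarOrderedRing 𝒜] in
lemma commute_damp_of_commute {A F : 𝒜} (hF : Commute F A) (l : ℝ) : Commute F (damp A l) :=
  (hF.symm.cfc_real _).symm

/-- The identity `[u, R] = D R d R + R d D R` for `d = [D, u]`. -/
lemma commutator_resolv {A F u d : 𝒜} (h0 : 0 ≤ A) (h1 : A ≤ 1) (hF : F * F = 1 - A)
    (hFA : Commute F A) (hud : HasBoundedComm A F u d) {l : ℝ} (hl : 0 ≤ l) :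
    u * resolv A l - resolv A l * u =
      dresolv A F l * d * resolv A l + resolv A l * d * dresolv A F l := by
  set a := A ^ (1 / 2 : ℝ) with ha
  set E := damp A l with hE
  have haa : a * a = A := rpow_half_mul_self h0
  have hFa : F * a = a * F := (commute_rpow hFA _).eq
  have hFE : F * E = E * F := (commute_damp_of_commute hFA l).eq
  have haE : a * E = E * a := (commute_damp_of_commute (commute_rpow (Commute.refl A) _).symm l).eq
  have hR : resolv A l = E * A := (damp_mul_self h0 h1 hl).symm
  have hEA : E * A = A * E := (commute_damp h0 l).eq
  have hE1 : E * (1 + l • A) = 1 := damp_mul_one_add h0 h1 hl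
  have hE2 : (1 + l • A) * E = 1 := one_add_mul_damp h0 h1 hl
  have hud' : F * u * a - a * u * F = a * d * a := hud
  have e1 : dresolv A F l * d * resolv A l = E * F * (a * d * a) * (a * E) := by
    rw [dresolv, ← ha, ← hE, hR, hEA, haE, ← mul_assoc F, hFE]
    simp only [← haa, mul_assoc, haE]
  have e2 : resolv A l * d * dresolv A F l = E * a * (a * d * a) * (F * E) := by
    rw [dresolv, ← ha, ← hE, hR, ← haa, ← mul_assoc F, hFa]
    simp only [← mul_assoc]
  have e3 : dresolv A F l * d * resolv A l + resolv A l * d * dresolv A F l =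
      E * (u * A - A * u) * E := by
    rw [e1, e2, ← hud']
    have t1 : E * F * (F * u * a - a * u * F) * (a * E) =
        E * ((1 - A) * u * A) * E - E * (F * a * u * (F * a)) * E := by
      rw [← hF, ← haa]
      noncomm_ring
    have t2 : E * a * (F * u * a - a * u * F) * (F * E) =
        E * (F * a * u * (F * a)) * E - E * (A * u * (1 - A)) * E := by
      rw [← hF, ← haa, hFa]
      have : E * a * (F * u * a - a * u * F) * (F * E) =
        E * (a * F) * u * (a * F) * E - E * (a * a) * u * (F * F) * E := by noncomm_ring
      rw [this]
      noncomm_ring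
    rw [t1, t2]
    noncomm_ring
  rw [e3]
  have e4 : E * (u * A - A * u) * E =
      E * ((1 + l • A) * u * A - A * u * (1 + l • A)) * E := by
    congr 2
    rw [add_mul, mul_add, one_mul, mul_one, add_mul, smul_mul_assoc, mul_smul_comm, smul_mul_assoc]
    abel
  rw [e4, mul_sub, sub_mul, hR]
  congr 1
  · rw [show E * ((1 + l • A) * u * A) * E = (E * (1 + l • A)) * u * (A * E) by noncomm_ring, hE1,
      one_mul, hEA]
  · rw [show E * (A * u * (1 + l • A)) * E = E * A * u * ((1 + l • A) * E) by noncomm_ring, hE2,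
      mul_one]

/-! ### Size of the commutators -/

omit [PartialOrder 𝒜] [StarOrderedRing 𝒜] in
lemma le_norm_of_mem_spectrum {h : 𝒜} {t : ℝ} (ht : t ∈ spectrum ℝ h) : t ≤ ‖h‖ := by
  rcases subsingleton_or_nontrivial 𝒜 with _ | _
  · simp at ht
  · exact (le_abs_self t).trans (spectrum.norm_le_norm_of_mem ht)

lemma norm_cfc_root_le {h : 𝒜} (hh : 0 ≤ h) {r : ℝ} (hr : ‖h‖ ^ 4 < r) {f : ℝ → ℝ} {c : ℝ}
    (hc : 0 ≤ c) (hf : ∀ t, 0 ≤ t → t ^ 4 / r ≤ 1 → |f t| ≤ c) : ‖cfc f h‖ ≤ c := by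
  refine norm_cfc_le hc fun t ht => hf t (spectrum_nonneg_of_nonneg hh ht) ?_
  have h0 : 0 ≤ t := spectrum_nonneg_of_nonneg hh ht
  have h1 : t ≤ ‖h‖ := le_norm_of_mem_spectrum ht
  have hr0 : 0 < r := lt_of_le_of_lt (by positivity) hr
  rw [div_le_one hr0]
  exact (pow_le_pow_left₀ h0 h1 4).trans hr.le

lemma pow_mul_cutoff_pow {h : 𝒜} (hh : 0 ≤ h) (r : ℝ) (m n : ℕ) :
    h ^ m * cutoff h r ^ n = cfc (fun t : ℝ => t ^ m * (1 - t ^ 4 / r) ^ n) h := by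
  have hsa : IsSelfAdjoint h := .of_nonneg hh
  have e : cutoff h r = cfc (fun t : ℝ => 1 - t ^ 4 / r) h := by
    have : (fun t : ℝ => 1 - t ^ 4 / r) = fun t => 1 - r⁻¹ * t ^ 4 := by
      funext t; rw [div_eq_inv_mul]
    rw [this, cfc_sub (fun _ => (1 : ℝ)) (fun t => r⁻¹ * t ^ 4) h, cfc_const_one ℝ h,
      cfc_const_mul r⁻¹ (fun t => t ^ 4) h, cfc_pow_id h 4, cutoff]
  rw [cfc_mul (fun t : ℝ => t ^ m) (fun t => (1 - t ^ 4 / r) ^ n) h (by fun_prop) (by fun_prop),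
    cfc_pow_id h m, cfc_pow (fun t : ℝ => 1 - t ^ 4 / r) n h (by fun_prop), ← e]

section Bounds

variable {h : 𝒜} {r : ℝ} (hh : 0 ≤ h) (hr : ‖h‖ ^ 4 < r)
include hh hr

omit hh [PartialOrder 𝒜] [StarOrderedRing 𝒜] in
lemma pos_of_norm_pow_lt : 0 < r := lt_of_le_of_lt (by positivity) hr

lemma norm_cutoff_le : ‖cutoff h r‖ ≤ 1 := by
  have hr0 := pos_of_norm_pow_lt hr
  have := pow_mul_cutoff_pow hh r 0 1
  rw [pow_zero, one_mul, pow_one] at this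
  rw [this]
  refine norm_cfc_root_le hh hr zero_le_one fun t ht ht' => ?_
  have : 0 ≤ t ^ 4 / r := by positivity
  simp only [pow_zero, one_mul, pow_one]
  rw [abs_le]
  constructor <;> linarith

lemma norm_pow_four_mul_cutoff_le (n : ℕ) : ‖h ^ 4 * cutoff h r ^ n‖ ≤ r * ((n : ℝ) + 1)⁻¹ := by
  have hr0 := pos_of_norm_pow_lt hr
  rw [pow_mul_cutoff_pow hh]
  refine norm_cfc_root_le hh hr (by positivity) fun t ht ht' => ?_
  have h1 : 0 ≤ t ^ 4 / r := by positivity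
  have h2 := pow_mul_one_sub_le (k := 1 - t ^ 4 / r) (by linarith) (by linarith) n
  rw [sub_sub_cancel] at h2
  have h3 : 0 ≤ 1 - t ^ 4 / r := by linarith
  rw [abs_of_nonneg (by positivity)]
  calc t ^ 4 * (1 - t ^ 4 / r) ^ n = r * ((1 - t ^ 4 / r) ^ n * (t ^ 4 / r)) := by field_simp
    _ ≤ _ := by gcongr

lemma norm_mul_cutoff_le (n : ℕ) :
    ‖h * cutoff h r ^ n‖ ≤ r ^ (1 / 4 : ℝ) * ((n : ℝ) + 1) ^ (-(1 / 4) : ℝ) := by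
  have hr0 := pos_of_norm_pow_lt hr
  have := pow_mul_cutoff_pow hh r 1 n
  rw [pow_one] at this
  rw [this]
  refine norm_cfc_root_le hh hr (by positivity) fun t ht ht' => ?_
  have h1 : 0 ≤ t ^ 4 / r := by positivity
  have h2 := pow_mul_one_sub_rpow_le (k := 1 - t ^ 4 / r) (s := 1 / 4) (by linarith) (by linarith)
    (by norm_num) (by norm_num) n
  rw [sub_sub_cancel] at h2
  have h3 : 0 ≤ 1 - t ^ 4 / r := by linarith
  have h4 : t = r ^ (1 / 4 : ℝ) * (t ^ 4 / r) ^ (1 / 4 : ℝ) := by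
    rw [← Real.mul_rpow hr0.le h1, mul_div_cancel₀ _ hr0.ne', ← Real.rpow_natCast,
      ← Real.rpow_mul ht]
    norm_num
  rw [abs_of_nonneg (by positivity), pow_one]
  calc t * (1 - t ^ 4 / r) ^ n
      = r ^ (1 / 4 : ℝ) * ((1 - t ^ 4 / r) ^ n * (t ^ 4 / r) ^ (1 / 4 : ℝ)) := by
        nth_rw 1 [h4]; ring
    _ ≤ _ := by gcongr

lemma norm_pow_twelve_mul_cutoff_le (n : ℕ) :
    ‖h ^ 12 * cutoff h r ^ n‖ ≤ 4 * r ^ 3 * ((n : ℝ) + 1) ^ (-2 : ℝ) := by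
  have hr0 := pos_of_norm_pow_lt hr
  rw [pow_mul_cutoff_pow hh]
  refine norm_cfc_root_le hh hr (by positivity) fun t ht ht' => ?_
  have h1 : 0 ≤ t ^ 4 / r := by positivity
  have h2 := pow_mul_one_sub_sq_le (k := 1 - t ^ 4 / r) (by linarith) (by linarith) n
  rw [sub_sub_cancel] at h2
  have h3 : 0 ≤ 1 - t ^ 4 / r := by linarith
  rw [abs_of_nonneg (by positivity), Real.rpow_neg (by positivity), Real.rpow_ofNat]
  calc t ^ 12 * (1 - t ^ 4 / r) ^ n
      = r ^ 3 * ((t ^ 4 / r) * ((1 - t ^ 4 / r) ^ n * (t ^ 4 / r) ^ 2)) := by field_simp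
    _ ≤ r ^ 3 * (1 * (4 * (((n : ℝ) + 1) ^ 2)⁻¹)) := by gcongr
    _ = _ := by ring

/-- One factor `h` of `d = h ρ h` is absorbed by `L`; the other one, and the factors of `Δ³`, make
the powers of `K` small. -/
lemma norm_mul_commCoeff_le (ρ : 𝒜) :
    ∃ C, 0 ≤ C ∧ ∀ (L : 𝒜) (n : ℕ), ‖L * commCoeff h ρ r n‖ ≤ C * ‖L * h‖ * commWeight n := by
  have hr0 := pos_of_norm_pow_lt hr
  set e₃ := ρ * h ^ 4 + h ^ 2 * ρ * h ^ 2 + h ^ 4 * ρ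
  set e₂ := ρ * h ^ 2 + h ^ 2 * ρ
  set q := r ^ (1 / 4 : ℝ)
  have hq : 0 ≤ q := by positivity
  refine ⟨(‖e₃‖ + ‖h‖ ^ 2 * ‖e₂‖) * q, by positivity, fun L n => ?_⟩
  have hfirst : ‖L * (h * e₃ * h * cutoff h r ^ (n + 1))‖ ≤
      ‖L * h‖ * ‖e₃‖ * (q * ((n : ℝ) + 1) ^ (-(1 / 4) : ℝ)) := by
    have e : L * (h * e₃ * h * cutoff h r ^ (n + 1)) =
        (L * h) * e₃ * (h * cutoff h r ^ (n + 1)) := by simp only [mul_assoc]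
    rw [e]
    refine (norm_mul_le _ _).trans (mul_le_mul (norm_mul_le _ _) ?_ (norm_nonneg _) (by positivity))
    refine (norm_mul_cutoff_le hh hr (n + 1)).trans ?_
    refine mul_le_mul_of_nonneg_left ?_ hq
    refine Real.rpow_le_rpow_of_nonpos (by positivity) ?_ (by norm_num)
    push_cast
    linarith
  have hterm : ∀ i, ‖L * (h ^ 6 * cutoff h r ^ i * (h * e₂ * h) * cutoff h r ^ (n - i))‖ ≤
      r * (‖L * h‖ * (‖h‖ ^ 2 * ‖e₂‖) * q *
        (((i : ℝ) + 1)⁻¹ * (((n - i : ℕ) : ℝ) + 1) ^ (-(1 / 4) : ℝ))) := by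
    intro i
    have e : L * (h ^ 6 * cutoff h r ^ i * (h * e₂ * h) * cutoff h r ^ (n - i)) =
        (L * h) * (h * ((h ^ 4 * cutoff h r ^ i) * h)) * e₂ * (h * cutoff h r ^ (n - i)) := by
      rw [show h ^ 6 = h * h * h ^ 4 by noncomm_ring]
      simp only [mul_assoc]
    rw [e]
    calc _ ≤ ‖L * h‖ * (‖h‖ * (‖h ^ 4 * cutoff h r ^ i‖ * ‖h‖)) * ‖e₂‖ *
          ‖h * cutoff h r ^ (n - i)‖ := by
          refine (norm_mul_le _ _).trans (mul_le_mul_of_nonneg_right ?_ (norm_nonneg _))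
          refine (norm_mul_le _ _).trans (mul_le_mul_of_nonneg_right ?_ (norm_nonneg _))
          refine (norm_mul_le _ _).trans (mul_le_mul_of_nonneg_left ?_ (norm_nonneg _))
          refine (norm_mul_le _ _).trans (mul_le_mul_of_nonneg_left ?_ (norm_nonneg _))
          exact norm_mul_le _ _
      _ ≤ ‖L * h‖ * (‖h‖ * (r * ((i : ℝ) + 1)⁻¹ * ‖h‖)) * ‖e₂‖ *
          (q * (((n - i : ℕ) : ℝ) + 1) ^ (-(1 / 4) : ℝ)) := by
          gcongr
          · exact norm_pow_four_mul_cutoff_le hh hr i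
          · exact norm_mul_cutoff_le hh hr (n - i)
      _ = _ := by ring
  rw [commCoeff, mul_sub, mul_smul_comm, Finset.mul_sum]
  refine (norm_sub_le _ _).trans ?_
  have hsecond : ‖r⁻¹ • ∑ i ∈ Finset.range (n + 1),
      L * (h ^ 6 * cutoff h r ^ i * (h * e₂ * h) * cutoff h r ^ (n - i))‖ ≤
      ‖L * h‖ * (‖h‖ ^ 2 * ‖e₂‖) * q * ∑ i ∈ Finset.range (n + 1),
        ((i : ℝ) + 1)⁻¹ * (((n - i : ℕ) : ℝ) + 1) ^ (-(1 / 4) : ℝ) := by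
    rw [norm_smul, Real.norm_of_nonneg (by positivity), inv_mul_le_iff₀ hr0, Finset.mul_sum,
      Finset.mul_sum]
    exact (norm_sum_le _ _).trans (Finset.sum_le_sum fun i _ => hterm i)
  refine (add_le_add hfirst hsecond).trans ?_
  rw [commWeight]
  set x := ((n : ℝ) + 1) ^ (-(1 / 4) : ℝ)
  set y := ∑ i ∈ Finset.range (n + 1),
        ((i : ℝ) + 1)⁻¹ * (((n - i : ℕ) : ℝ) + 1) ^ (-(1 / 4) : ℝ)
  have hx : 0 ≤ x := by positivity
  have hy : 0 ≤ y := by positivity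
  have : (‖e₃‖ + ‖h‖ ^ 2 * ‖e₂‖) * q * ‖L * h‖ * (x + y) -
      (‖L * h‖ * ‖e₃‖ * (q * x) + ‖L * h‖ * (‖h‖ ^ 2 * ‖e₂‖) * q * y) =
      ‖L * h‖ * ‖e₃‖ * q * y + ‖L * h‖ * (‖h‖ ^ 2 * ‖e₂‖) * q * x := by ring
  have h2 : 0 ≤ ‖L * h‖ * ‖e₃‖ * q * y + ‖L * h‖ * (‖h‖ ^ 2 * ‖e₂‖) * q * x := by positivity
  linarith

end Bounds
end Commutators

section Parametrix

variable {𝒜 : Type*} [CStarAlgebra 𝒜] [PartialOrder 𝒜] [StarOrderedRing 𝒜]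

/-! ### The inverse of `1 + D² + l Δ² / r` -/

/-- The square root `p` of `(1 + c Q)⁻¹`. -/
lemma exists_sqrt_inverse {Q : 𝒜} (hQ : 0 ≤ Q) {c : ℝ} (hc : 0 < c) :
    ∃ p : 𝒜, IsSelfAdjoint p ∧ ‖p‖ ≤ 1 ∧ ‖p * Q * p‖ ≤ c⁻¹ ∧
      (1 + c • Q) * (p * p) = 1 ∧ p * p * (1 + c • Q) = 1 := by
  have hsa : IsSelfAdjoint Q := .of_nonneg hQ
  have hsp : ∀ x ∈ spectrum ℝ Q, 0 ≤ x := fun x hx => spectrum_nonneg_of_nonneg hQ hx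
  have hpos : ∀ x ∈ spectrum ℝ Q, 0 < 1 + c * x := fun x hx => by
    have := hsp x hx
    positivity
  set f : ℝ → ℝ := fun x => (√(1 + c * x))⁻¹ with hf
  have hfc : ContinuousOn f (spectrum ℝ Q) :=
    ContinuousOn.inv₀ (by fun_prop) fun x hx => (Real.sqrt_pos.mpr (hpos x hx)).ne'
  have hfc2 : ContinuousOn (fun x => f x * f x) (spectrum ℝ Q) := hfc.mul hfc
  have hl : ContinuousOn (fun x : ℝ => 1 + c * x) (spectrum ℝ Q) := by fun_prop
  have hff : ∀ x ∈ spectrum ℝ Q, f x * f x = (1 + c * x)⁻¹ := fun x hx => by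
    rw [hf, ← mul_inv, Real.mul_self_sqrt (hpos x hx).le]
  have hone : (1 : 𝒜) + c • Q = cfc (fun x : ℝ => 1 + c * x) Q := by
    rw [cfc_const_add 1 (fun x => c * x) Q, cfc_const_mul c (fun x => x) Q, cfc_id' ℝ Q]
    simp
  have hone' : (1 : 𝒜) = cfc (fun _ : ℝ => (1 : ℝ)) Q := (cfc_const_one ℝ Q).symm
  refine ⟨cfc f Q, cfc_predicate f Q, norm_cfc_le zero_le_one fun x hx => ?_, ?_, ?_, ?_⟩
  · have h0 := hsp x hx
    rw [hf, Real.norm_of_nonneg (by positivity)]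
    refine inv_le_one_of_one_le₀ (Real.one_le_sqrt.mpr ?_)
    nlinarith
  · have e : cfc f Q * Q * cfc f Q = cfc (fun x => f x * x * f x) Q := by
      rw [cfc_mul (fun x => f x * x) f Q (by fun_prop) hfc,
        cfc_mul f (fun x => x) Q hfc (by fun_prop), cfc_id' ℝ Q]
    rw [e]
    refine norm_cfc_le (by positivity) fun x hx => ?_
    have h0 := hsp x hx
    have h1 := hpos x hx
    rw [show f x * x * f x = x * (f x * f x) by ring, hff x hx, Real.norm_of_nonneg (by positivity),
      ← div_eq_mul_inv, ← one_div, div_le_div_iff₀ h1 hc]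
    linarith
  · rw [hone, ← cfc_mul f f Q hfc hfc, ← cfc_mul _ _ Q hl hfc2, hone']
    refine cfc_congr fun x hx => ?_
    rw [hff x hx, mul_inv_cancel₀ (hpos x hx).ne']
  · rw [hone, ← cfc_mul f f Q hfc hfc, ← cfc_mul _ _ Q hfc2 hl, hone']
    refine cfc_congr fun x hx => ?_
    rw [hff x hx, inv_mul_cancel₀ (hpos x hx).ne']

namespace IsModularData

variable {A F h ρ : 𝒜} {r : ℝ}

lemma r_pos (M : IsModularData A F h ρ r) : 0 < r := pos_of_norm_pow_lt M.norm_root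

lemma norm_smul_resolv_lt_one (M : IsModularData A F h ρ r) {l : ℝ} (hl : 0 ≤ l) :
    ‖l • resolv A l‖ < 1 := by
  rw [norm_smul, Real.norm_of_nonneg hl]
  refine (mul_le_mul_of_nonneg_left (norm_resolv_le M.nonneg M.le_one hl) hl).trans_lt ?_
  rw [← div_eq_mul_inv, div_lt_one (by positivity)]
  linarith

lemma isUnit_one_sub (M : IsModularData A F h ρ r) {l : ℝ} (hl : 0 ≤ l) :
    IsUnit (1 - l • (resolv A l * cutoff h r)) := by
  refine isUnit_one_sub_of_norm_lt_one ?_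
  rw [← smul_mul_assoc]
  refine (norm_mul_le _ _).trans_lt ?_
  exact (mul_le_of_le_one_right (norm_nonneg _) (norm_cutoff_le M.root_nonneg M.norm_root)).trans_lt
    (M.norm_smul_resolv_lt_one hl)

lemma isUnit_one_sub' (M : IsModularData A F h ρ r) {l : ℝ} (hl : 0 ≤ l) :
    IsUnit (1 - l • (cutoff h r * resolv A l)) := by
  refine isUnit_one_sub_of_norm_lt_one ?_
  rw [← mul_smul_comm]
  refine (norm_mul_le _ _).trans_lt ?_
  exact (mul_le_of_le_one_left (norm_nonneg _) (norm_cutoff_le M.root_nonneg M.norm_root)).trans_lt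
    (M.norm_smul_resolv_lt_one hl)

/-- `S` is the operator `(1 + D² + l Δ² / r)⁻¹`, and `H` is the closure of `S D`. Commuting one
power of `Δ` with `S` is what makes `Δ³ S Δ^(1/2)` decay like `l⁻¹`. -/
lemma exists_parametrix (M : IsModularData A F h ρ r) :
    ∃ C, 0 ≤ C ∧ ∀ l : ℝ, 0 < l → ∃ S H : 𝒜,
      (1 - l • (resolv A l * cutoff h r)) * S = resolv A l ∧
      (1 - l • (resolv A l * cutoff h r)) * H = dresolv A F l ∧
      ‖h ^ 6 * H * h‖ ≤ C * l ^ (-(1 / 2) : ℝ) ∧ ‖h ^ 6 * S * h‖ ≤ C * l⁻¹ := by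
  have hr := M.r_pos
  refine ⟨‖h‖ ^ 5 * √r + ‖h‖ ^ 3 * (1 + 2 * ‖ρ‖) * r, by positivity, fun l hl => ?_⟩
  set K := cutoff h r with hK
  set R := resolv A l with hR
  set E := damp A l with hE
  set a := A ^ (1 / 2 : ℝ) with ha
  have haa : a * a = A := rpow_half_mul_self M.nonneg
  have hFa : F * a = a * F := (commute_rpow M.commute _).eq
  have hFE : F * E = E * F := (commute_damp_of_commute M.commute l).eq
  have haE : a * E = E * a := (commute_damp_of_commute (commute_rpow (Commute.refl A) _).symm l).eq
  have hREA : R = E * A := (damp_mul_self M.nonneg M.le_one hl.le).symm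
  have hEA : E * A = A * E := (commute_damp M.nonneg l).eq
  have hasa : IsSelfAdjoint a := .of_nonneg CFC.rpow_nonneg
  have hhsa : IsSelfAdjoint h := .of_nonneg M.root_nonneg
  have hQ : 0 ≤ a * h ^ 4 * a := by
    have : a * h ^ 4 * a = star (h ^ 2 * a) * (h ^ 2 * a) := by
      rw [star_mul, star_pow, hasa.star_eq, hhsa.star_eq]; noncomm_ring
    rw [this]
    exact star_mul_self_nonneg _
  obtain ⟨p, hp, hp1, hpQ, hQp, hpQ'⟩ := exists_sqrt_inverse hQ (c := l / r) (by positivity)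
  have hY : 1 - l • (R * K) = E + (l / r) • (R * h ^ 4) := by
    rw [hE, ← one_sub_smul_resolv M.nonneg M.le_one hl.le, ← hR, hK, cutoff, mul_sub, mul_one,
      mul_smul_comm, smul_sub, smul_smul, div_eq_mul_inv]
    abel
  have hY' : 1 - l • (K * R) = E + (l / r) • (h ^ 4 * R) := by
    rw [hE, ← one_sub_smul_resolv M.nonneg M.le_one hl.le, ← hR, hK, cutoff, sub_mul, one_mul,
      smul_mul_assoc, smul_sub, smul_smul, div_eq_mul_inv]
    abel
  have hleft : ∀ x : 𝒜, (1 - l • (R * K)) * (a * (p * p) * x) = E * a * x := by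
    intro x
    have : (1 - l • (R * K)) * (a * (p * p) * x) =
        E * a * ((1 + (l / r) • (a * h ^ 4 * a)) * (p * p)) * x := by
      rw [hY, hREA, ← haa]
      simp only [add_mul, mul_add, smul_mul_assoc, mul_smul_comm, one_mul, ← mul_assoc]
    rw [this, hQp, mul_one]
  have hright : ∀ x : 𝒜, (x * (p * p) * a) * (1 - l • (K * R)) = x * a * E := by
    intro x
    have : (x * (p * p) * a) * (1 - l • (K * R)) =
        x * (p * p * (1 + (l / r) • (a * h ^ 4 * a))) * a * E := by
      rw [hY', hREA, hEA, ← haa]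
      simp only [add_mul, mul_add, smul_mul_assoc, mul_smul_comm, mul_one, ← mul_assoc]
    rw [this, hpQ', mul_one]
  set S := a * (p * p) * a with hS
  set H := a * (p * p) * F with hH
  set H' := F * (p * p) * a with hH'
  have hYS : (1 - l • (R * K)) * S = R := by rw [hS, hleft, mul_assoc, haa, hREA]
  have hG : dresolv A F l = E * a * F := by
    rw [dresolv, ← ha, ← hE, haE, ← mul_assoc, hFE, mul_assoc, hFa, mul_assoc]
  have hYH : (1 - l • (R * K)) * H = dresolv A F l := by rw [hH, hleft, hG]
  have hSY : S * (1 - l • (K * R)) = R := by rw [hS, hright, haa, hREA, hEA]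
  have hHY : H' * (1 - l • (K * R)) = dresolv A F l := by
    rw [hH', hright, dresolv, mul_assoc]
  -- The commutator of `Δ` with `S`.
  have hcomm : h ^ 2 * S - S * h ^ 2 = H * (h * ρ * h) * S + S * (h * ρ * h) * H' := by
    have hKh : K * h ^ 2 = h ^ 2 * K := (commute_cutoff h r 2).eq.symm
    have key := commutator_resolv M.nonneg M.le_one M.sq_eq M.commute M.comm_sq hl.le
    rw [← hR] at key
    refine (M.isUnit_one_sub hl.le).mul_left_cancel ((M.isUnit_one_sub' hl.le).mul_right_cancel ?_)
    rw [← hR, ← hK]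
    have e₁ : ∀ Y Y' : 𝒜, Y * (h ^ 2 * S - S * h ^ 2) * Y' =
        Y * h ^ 2 * (S * Y') - (Y * S) * h ^ 2 * Y' := fun Y Y' => by noncomm_ring
    have e₂ : ∀ Y Y' d : 𝒜, Y * H * d * (S * Y') + Y * S * d * (H' * Y') =
        Y * (H * d * S + S * d * H') * Y' := fun Y Y' d => by noncomm_ring
    calc (1 - l • (R * K)) * (h ^ 2 * S - S * h ^ 2) * (1 - l • (K * R))
        = (1 - l • (R * K)) * h ^ 2 * (S * (1 - l • (K * R))) -
          ((1 - l • (R * K)) * S) * h ^ 2 * (1 - l • (K * R)) := e₁ _ _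
      _ = h ^ 2 * R - R * h ^ 2 := by
          rw [hSY, hYS]
          simp only [sub_mul, mul_sub, one_mul, mul_one, smul_mul_assoc, mul_smul_comm]
          rw [mul_assoc R K, hKh]
          simp only [mul_assoc]
          abel
      _ = ((1 - l • (R * K)) * H) * (h * ρ * h) * (S * (1 - l • (K * R))) +
          ((1 - l • (R * K)) * S) * (h * ρ * h) * (H' * (1 - l • (K * R))) := by
          rw [key, hYH, hSY, hYS, hHY]
      _ = _ := e₂ _ _ _
  -- The basic estimates, in terms of `J = A^(1/2) p`.
  have ha1 : ‖a‖ ≤ 1 := norm_rpow_le_one M.nonneg M.le_one (by norm_num)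
  have hJ1 : ‖a * p‖ ≤ 1 := (norm_mul_le _ _).trans (mul_le_one₀ ha1 (norm_nonneg _) hp1)
  set t := ‖h ^ 2 * (a * p)‖ with ht
  set u := ‖h * (a * p)‖ with hu
  have hstar : star (a * p) = p * a := by rw [star_mul, hp.star_eq, hasa.star_eq]
  have ht2 : t ^ 2 ≤ r / l := by
    rw [pow_two, ht, ← CStarRing.norm_star_mul_self, star_mul, star_pow, hhsa.star_eq, hstar]
    have : p * a * h ^ 2 * (h ^ 2 * (a * p)) = p * (a * h ^ 4 * a) * p := by noncomm_ring
    rw [this]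
    simpa using hpQ
  have hu2 : u ^ 2 ≤ t := by
    rw [pow_two, hu, ← CStarRing.norm_star_mul_self, star_mul, hhsa.star_eq, hstar]
    have : p * a * h * (h * (a * p)) = p * a * (h ^ 2 * (a * p)) := by noncomm_ring
    rw [this]
    refine (norm_mul_le _ _).trans (mul_le_of_le_one_left (norm_nonneg _) ?_)
    rwa [← hstar, norm_star]
  have ht' : ‖p * a * h ^ 2‖ = t := by
    rw [ht, ← norm_star (h ^ 2 * (a * p)), star_mul, star_pow, hhsa.star_eq, hstar]
  have hu' : ‖p * a * h‖ = u := by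
    rw [hu, ← norm_star (h * (a * p)), star_mul, hhsa.star_eq, hstar]
  have ht0 : 0 ≤ t := norm_nonneg _
  have hu0 : 0 ≤ u := norm_nonneg _
  refine ⟨S, H, hYS, hYH, ?_, ?_⟩
  · have e : h ^ 6 * H * h = h ^ 4 * ((h ^ 2 * (a * p)) * (p * (F * h))) := by
      rw [hH]; noncomm_ring
    have htr : t ≤ √r * l ^ (-(1 / 2) : ℝ) := by
      rw [Real.rpow_neg hl.le, ← Real.sqrt_eq_rpow, ← div_eq_mul_inv, ← Real.sqrt_div hr.le]
      exact Real.le_sqrt_of_sq_le ht2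
    calc ‖h ^ 6 * H * h‖ ≤ ‖h‖ ^ 4 * (t * (1 * (1 * ‖h‖))) := by
          rw [e]
          refine (norm_mul_le _ _).trans (mul_le_mul (norm_pow_le' h (by norm_num)) ?_
            (norm_nonneg _) (by positivity))
          refine (norm_mul_le _ _).trans (mul_le_mul_of_nonneg_left ?_ ht0)
          refine (norm_mul_le _ _).trans (mul_le_mul hp1 ?_ (norm_nonneg _) zero_le_one)
          exact (norm_mul_le _ _).trans (mul_le_mul_of_nonneg_right M.norm_le (norm_nonneg _))
      _ = ‖h‖ ^ 5 * t := by ring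
      _ ≤ ‖h‖ ^ 5 * (√r * l ^ (-(1 / 2) : ℝ)) := by gcongr
      _ ≤ _ := by
          rw [add_mul, ← mul_assoc]
          exact le_add_of_nonneg_right (by positivity)
  · have e : h ^ 6 * S * h = h ^ 2 * ((h ^ 2 * (a * p)) * (p * a * h ^ 2) * h +
        (h ^ 2 * (a * p)) * (p * (F * h)) * ρ * ((h * (a * p)) * (p * a * h)) +
        (h ^ 2 * (a * p)) * (p * a * h) * ρ * (h * F * (p * (p * a * h)))) := by
      calc h ^ 6 * S * h = h ^ 2 * (h ^ 2 * (h ^ 2 * S - S * h ^ 2) * h + h ^ 2 * S * h ^ 3) := by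
            noncomm_ring
        _ = _ := by rw [hcomm, hS, hH, hH']; noncomm_ring
    have h1 : ‖(h ^ 2 * (a * p)) * (p * a * h ^ 2) * h‖ ≤ t * t * ‖h‖ := by
      refine (norm_mul_le _ _).trans (mul_le_mul_of_nonneg_right ?_ (norm_nonneg _))
      exact (norm_mul_le _ _).trans (by rw [ht'])
    have hpF : ‖p * (F * h)‖ ≤ ‖h‖ := by
      refine (norm_mul_le _ _).trans ((mul_le_of_le_one_left (norm_nonneg _) hp1).trans ?_)
      exact (norm_mul_le _ _).trans (mul_le_of_le_one_left (norm_nonneg _) M.norm_le)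
    have h2 : ‖(h ^ 2 * (a * p)) * (p * (F * h)) * ρ * ((h * (a * p)) * (p * a * h))‖ ≤
        t * ‖h‖ * ‖ρ‖ * (u * u) := by
      refine (norm_mul_le _ _).trans (mul_le_mul ?_ ?_ (norm_nonneg _) (by positivity))
      · refine (norm_mul_le _ _).trans (mul_le_mul_of_nonneg_right ?_ (norm_nonneg _))
        exact (norm_mul_le _ _).trans (mul_le_mul_of_nonneg_left hpF ht0)
      · exact (norm_mul_le _ _).trans (by rw [hu'])
    have h3 : ‖(h ^ 2 * (a * p)) * (p * a * h) * ρ * (h * F * (p * (p * a * h)))‖ ≤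
        t * u * ‖ρ‖ * (‖h‖ * u) := by
      refine (norm_mul_le _ _).trans (mul_le_mul ?_ ?_ (norm_nonneg _) (by positivity))
      · refine (norm_mul_le _ _).trans (mul_le_mul_of_nonneg_right ?_ (norm_nonneg _))
        exact (norm_mul_le _ _).trans (by rw [hu'])
      · refine (norm_mul_le _ _).trans (mul_le_mul ?_ ?_ (norm_nonneg _) (norm_nonneg _))
        · exact (norm_mul_le _ _).trans (mul_le_of_le_one_right (norm_nonneg _) M.norm_le)
        · exact (norm_mul_le _ _).trans
            ((mul_le_of_le_one_left (norm_nonneg _) hp1).trans hu'.le)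
    calc ‖h ^ 6 * S * h‖
        ≤ ‖h‖ ^ 2 * (t * t * ‖h‖ + t * ‖h‖ * ‖ρ‖ * (u * u) + t * u * ‖ρ‖ * (‖h‖ * u)) := by
          rw [e]
          refine (norm_mul_le _ _).trans (mul_le_mul (norm_pow_le' h (by norm_num)) ?_
            (norm_nonneg _) (by positivity))
          exact (norm_add₃_le).trans (add_le_add (add_le_add h1 h2) h3)
      _ = ‖h‖ ^ 3 * (t ^ 2 + 2 * ‖ρ‖ * (t * u ^ 2)) := by ring
      _ ≤ ‖h‖ ^ 3 * (t ^ 2 + 2 * ‖ρ‖ * (t * t)) := by gcongr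
      _ = ‖h‖ ^ 3 * (1 + 2 * ‖ρ‖) * t ^ 2 := by ring
      _ ≤ ‖h‖ ^ 3 * (1 + 2 * ‖ρ‖) * (r / l) := by gcongr
      _ = ‖h‖ ^ 3 * (1 + 2 * ‖ρ‖) * r * l⁻¹ := by ring
      _ ≤ _ := by
          rw [add_mul]
          exact le_add_of_nonneg_left (by positivity)

end IsModularData

end Parametrix

section Comparison

variable {𝒜 : Type*} [CStarAlgebra 𝒜] [PartialOrder 𝒜] [StarOrderedRing 𝒜]

/-! ### Comparison with the commuting expansion -/

/-- The operator `(1 - X_l)⁻¹ Δ³ R_l`. -/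
def modResolv (A h : 𝒜) (r l : ℝ) : 𝒜 :=
  Ring.inverse (1 - l • (resolv A l * cutoff h r)) * h ^ 6 * resolv A l

/-- The expansion `∑ Δ³ Kⁿ (l R_l)ⁿ R_l`, which is what the Neumann series of
`(1 - X_l)⁻¹ Δ³ R_l` would be if `Δ` and `D` commuted. -/
def commSeries (A h : 𝒜) (r l : ℝ) : 𝒜 :=
  ∑' n : ℕ, h ^ 6 * cutoff h r ^ n * ((l • resolv A l) ^ n * resolv A l)

namespace IsModularData

variable {A F h ρ : 𝒜} {r : ℝ}

omit [PartialOrder 𝒜] [StarOrderedRing 𝒜] in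
lemma norm_pow_mul_le (y x : 𝒜) (n : ℕ) : ‖y ^ n * x‖ ≤ ‖y‖ ^ n * ‖x‖ := by
  induction n with
  | zero => simp
  | succ n ih =>
    rw [pow_succ', mul_assoc, pow_succ', mul_assoc]
    exact (norm_mul_le _ _).trans (mul_le_mul_of_nonneg_left ih (norm_nonneg _))

lemma summable_commSeries (M : IsModularData A F h ρ r) {l : ℝ} (hl : 0 ≤ l) :
    Summable fun n : ℕ => h ^ 6 * cutoff h r ^ n * ((l • resolv A l) ^ n * resolv A l) := by
  refine .of_norm_bounded ((summable_geometric_of_lt_one (norm_nonneg _)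
    (M.norm_smul_resolv_lt_one hl)).mul_left (‖h ^ 6‖ * ‖resolv A l‖)) fun n => ?_
  have h1 : ‖h ^ 6 * cutoff h r ^ n‖ ≤ ‖h ^ 6‖ := by
    rw [((commute_cutoff h r 6).pow_right n).eq]
    refine (norm_pow_mul_le _ _ n).trans (mul_le_of_le_one_left (norm_nonneg _) ?_)
    exact pow_le_one₀ (norm_nonneg _) (norm_cutoff_le M.root_nonneg M.norm_root)
  calc _ ≤ ‖h ^ 6‖ * (‖l • resolv A l‖ ^ n * ‖resolv A l‖) :=
        (norm_mul_le _ _).trans (mul_le_mul h1 (norm_pow_mul_le _ _ n) (norm_nonneg _)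
          (norm_nonneg _))
    _ = _ := by ring

/-- The error of the commuting expansion, in terms of the commutators of `R` with `Δ³ Kⁿ⁺¹`. -/
lemma modResolv_sub_commSeries (M : IsModularData A F h ρ r) {l : ℝ} (hl : 0 ≤ l) :
    ∃ x : 𝒜, HasSum (fun n : ℕ => (resolv A l * (h ^ 6 * cutoff h r ^ (n + 1)) -
        h ^ 6 * cutoff h r ^ (n + 1) * resolv A l) * ((l • resolv A l) ^ n * resolv A l)) x ∧
      (1 - l • (resolv A l * cutoff h r)) * (modResolv A h r l - commSeries A h r l) = l • x := by
  set K := cutoff h r with hK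
  set R := resolv A l with hR
  set w : ℕ → 𝒜 := fun n => h ^ 6 * K ^ n * ((l • R) ^ n * R) with hw
  have hs : Summable w := M.summable_commSeries hl
  set W := commSeries A h r l with hWdef
  have hW : HasSum w W := hs.hasSum
  have hKh : ∀ n, K * (h ^ 6 * K ^ n) = h ^ 6 * K ^ (n + 1) := fun n => by
    rw [← mul_assoc, hK, (commute_cutoff h r 6).eq.symm, mul_assoc, pow_succ' (cutoff h r) n]
  have hrec : W = h ^ 6 * R + l • (K * W * R) := by
    have h1 := (hasSum_nat_add_iff' 1).mpr hW
    have h2 : HasSum (fun n => l • (K * w n * R)) (l • (K * W * R)) :=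
      ((hW.mul_left K).mul_right R).const_smul l
    have h3 : (fun n => w (n + 1)) = fun n => l • (K * w n * R) := by
      funext n
      have c : Commute ((l • R) ^ n) R := ((Commute.refl R).smul_left l).pow_left n
      simp only [hw]
      rw [← mul_assoc K, hKh, mul_assoc (h ^ 6 * K ^ (n + 1)), pow_succ (l • R), ← mul_smul_comm,
        mul_assoc ((l • R) ^ n), mul_assoc ((l • R) ^ n), smul_mul_assoc, mul_smul_comm]
    rw [h3] at h1
    have h4 := h1.unique h2
    simp only [Finset.sum_range_one, hw, pow_zero, mul_one, one_mul] at h4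
    rw [← h4]
    abel
  have hV : (1 - l • (R * K)) * modResolv A h r l = h ^ 6 * R := by
    rw [modResolv, ← hR, ← hK, ← mul_assoc, ← mul_assoc,
      Ring.mul_inverse_cancel _ (M.isUnit_one_sub hl), one_mul]
  have hmain : (1 - l • (R * K)) * (modResolv A h r l - W) = l • (R * K * W - K * W * R) := by
    rw [mul_sub, hV, sub_mul, one_mul, smul_mul_assoc, smul_sub]
    nth_rw 1 [hrec]
    abel
  refine ⟨_, ?_, hmain⟩
  have h5 : HasSum (fun n => R * K * w n - K * w n * R) (R * K * W - K * W * R) :=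
    (hW.mul_left (R * K)).sub ((hW.mul_left K).mul_right R)
  refine h5.congr_fun fun n => ?_
  have c : Commute ((l • R) ^ n) R := ((Commute.refl R).smul_left l).pow_left n
  simp only [hw]
  rw [mul_assoc R K, ← mul_assoc K, hKh, sub_mul, mul_assoc _ ((l • R) ^ n * R) R, c.eq]
  simp only [mul_assoc, c.eq]

/-- The error of the commuting expansion is divisible by `A^s` on the right, with a quotient that
decays in `l`. -/
lemma exists_factor (M : IsModularData A F h ρ r) {s : ℝ} (hs : 7 / 8 ≤ s) (hs1 : s ≤ 1) :
    ∃ C, 0 ≤ C ∧ ∀ l : ℝ, 0 < l → ∃ T : 𝒜,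
      h ^ 6 * (modResolv A h r l - commSeries A h r l) = T * A ^ s ∧
      ‖T‖ ≤ C * (1 + l) ^ (s - 3 / 2) := by
  obtain ⟨C₁, hC₁, hpar⟩ := M.exists_parametrix
  obtain ⟨C₂, hC₂, hcoeff⟩ := norm_mul_commCoeff_le M.root_nonneg M.norm_root ρ
  set σ := ∑' n, commWeight n * ((n : ℝ) + 1) ^ (-s) with hσ
  set σ' := ∑' n, commWeight n * ((n : ℝ) + 1) ^ (-1 : ℝ) with hσ'
  have hsum : Summable fun n : ℕ => commWeight n * ((n : ℝ) + 1) ^ (-s) :=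
    summable_commWeight (by linarith)
  have hsum' : Summable fun n : ℕ => commWeight n * ((n : ℝ) + 1) ^ (-1 : ℝ) :=
    summable_commWeight (by norm_num)
  have hσ0 : 0 ≤ σ := tsum_nonneg fun n => mul_nonneg (commWeight_nonneg n) (by positivity)
  have hσ0' : 0 ≤ σ' := tsum_nonneg fun n => mul_nonneg (commWeight_nonneg n) (by positivity)
  refine ⟨C₁ * C₂ * (σ + σ'), by positivity, fun l hl => ?_⟩
  obtain ⟨S, H, hS, hH, hHn, hSn⟩ := hpar l hl
  choose f hf hfn using exists_resolv_pow_factor M.nonneg M.le_one (s := s) (by linarith) hs1 hl.le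
  choose g hg hgn using
    exists_half_resolv_pow_factor M.nonneg M.le_one (s := s) (by linarith) hs1 hl.le
  set d := commCoeff h ρ r with hd
  set T : ℕ → 𝒜 := fun n => h ^ 6 * H * d n * f n + h ^ 6 * S * d n * (F * g n) with hT
  have hTn : ∀ n, ‖T n‖ ≤ C₁ * C₂ * (l⁻¹ * (1 + l) ^ (s - 3 / 2)) *
      (commWeight n * ((n : ℝ) + 1) ^ (-s) + commWeight n * ((n : ℝ) + 1) ^ (-1 : ℝ)) := by
    intro n
    have hw := commWeight_nonneg n
    have b1 : ‖h ^ 6 * H * d n * f n‖ ≤ C₂ * (C₁ * l ^ (-(1 / 2) : ℝ)) * commWeight n *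
        ((1 + l) ^ (s - 2) * ((n : ℝ) + 1) ^ (-s)) := by
      refine (norm_mul_le _ _).trans (mul_le_mul ?_ (hfn n) (norm_nonneg _) (by positivity))
      refine (hcoeff _ n).trans ?_
      gcongr
    have b2 : ‖h ^ 6 * S * d n * (F * g n)‖ ≤ C₂ * (C₁ * l⁻¹) * commWeight n *
        ((1 + l) ^ (s - 3 / 2) * ((n : ℝ) + 1) ^ (-1 : ℝ)) := by
      refine (norm_mul_le _ _).trans (mul_le_mul ?_ ?_ (norm_nonneg _) (by positivity))
      · refine (hcoeff _ n).trans ?_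
        gcongr
      · exact (norm_mul_le _ _).trans
          ((mul_le_of_le_one_left (norm_nonneg _) M.norm_le).trans (hgn n))
    have b3 : l ^ (-(1 / 2) : ℝ) * (1 + l) ^ (s - 2) ≤ l⁻¹ * (1 + l) ^ (s - 3 / 2) := by
      have e1 : l ^ (-(1 / 2) : ℝ) = l⁻¹ * l ^ (1 / 2 : ℝ) := by
        rw [← Real.rpow_neg_one, ← Real.rpow_add hl]
        norm_num
      have e2 : (1 + l) ^ (s - 3 / 2) = (1 + l) ^ (1 / 2 : ℝ) * (1 + l) ^ (s - 2) := by
        rw [← Real.rpow_add (by positivity)]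
        ring_nf
      rw [e1, e2, mul_assoc]
      gcongr
      linarith
    calc ‖T n‖ ≤ _ := (norm_add_le _ _).trans (add_le_add b1 b2)
      _ = C₁ * C₂ * (commWeight n * ((n : ℝ) + 1) ^ (-s)) *
            (l ^ (-(1 / 2) : ℝ) * (1 + l) ^ (s - 2)) +
          C₁ * C₂ * (commWeight n * ((n : ℝ) + 1) ^ (-1 : ℝ)) *
            (l⁻¹ * (1 + l) ^ (s - 3 / 2)) := by ring
      _ ≤ C₁ * C₂ * (commWeight n * ((n : ℝ) + 1) ^ (-s)) * (l⁻¹ * (1 + l) ^ (s - 3 / 2)) +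
          C₁ * C₂ * (commWeight n * ((n : ℝ) + 1) ^ (-1 : ℝ)) *
            (l⁻¹ * (1 + l) ^ (s - 3 / 2)) := by gcongr
      _ = _ := by ring
  have hbsum := (hsum.add hsum').mul_left (C₁ * C₂ * (l⁻¹ * (1 + l) ^ (s - 3 / 2)))
  have hTs : Summable T := .of_norm_bounded hbsum hTn
  refine ⟨-(l • ∑' n, T n), ?_, ?_⟩
  · have hkey : ∀ n, h ^ 6 * (Ring.inverse (1 - l • (resolv A l * cutoff h r)) *
        ((resolv A l * (h ^ 6 * cutoff h r ^ (n + 1)) -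
        h ^ 6 * cutoff h r ^ (n + 1) * resolv A l) * ((l • resolv A l) ^ n * resolv A l))) =
        -(T n * A ^ s) := by
      intro n
      have hcomm := commutator_resolv M.nonneg M.le_one M.sq_eq M.commute (M.comm_pow n) hl.le
      have hinv := Ring.inverse_mul_cancel _ (M.isUnit_one_sub hl.le)
      rw [← neg_sub (h ^ 6 * cutoff h r ^ (n + 1) * resolv A l), hcomm, ← hH]
      set Y := 1 - l • (resolv A l * cutoff h r) with hY
      set Z := Ring.inverse Y
      set B := (l • resolv A l) ^ n * resolv A l with hB
      have hf' : resolv A l * B = f n * A ^ s := hf n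
      have hg' : Y * H * B = F * (g n * A ^ s) := by
        rw [hH, dresolv, mul_assoc, hg n]
      have e : h ^ 6 * (Z * (-(Y * H * d n * resolv A l + resolv A l * d n * (Y * H)) * B)) =
          -(h ^ 6 * (Z * Y) * H * d n * (resolv A l * B) +
            h ^ 6 * (Z * resolv A l) * d n * (Y * H * B)) := by noncomm_ring
      have hZR : Z * resolv A l = S := by rw [← hS, ← mul_assoc, hinv, one_mul]
      rw [e, hZR, hinv, hf', hg', hT]
      noncomm_ring
    obtain ⟨x, hx, hx'⟩ := M.modResolv_sub_commSeries hl.le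
    have h2 : modResolv A h r l - commSeries A h r l =
        Ring.inverse (1 - l • (resolv A l * cutoff h r)) * (l • x) := by
      rw [← hx', ← mul_assoc, Ring.inverse_mul_cancel _ (M.isUnit_one_sub hl.le), one_mul]
    have h3 := (hx.mul_left (Ring.inverse (1 - l • (resolv A l * cutoff h r)))).mul_left (h ^ 6)
    simp only [hkey] at h3
    rw [h2, mul_smul_comm, mul_smul_comm, h3.unique ((hTs.hasSum.mul_right (A ^ s)).neg),
      smul_neg, neg_mul, smul_mul_assoc]
  · rw [norm_neg, norm_smul, Real.norm_of_nonneg hl.le]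
    have h3 : ‖∑' n, T n‖ ≤ C₁ * C₂ * (l⁻¹ * (1 + l) ^ (s - 3 / 2)) * (σ + σ') := by
      refine (norm_tsum_le_tsum_norm (.of_nonneg_of_le (fun _ => norm_nonneg _) hTn hbsum)).trans ?_
      refine (Summable.tsum_le_tsum hTn
        (.of_nonneg_of_le (fun _ => norm_nonneg _) hTn hbsum) hbsum).trans_eq ?_
      rw [tsum_mul_left, hsum.tsum_add hsum']
    calc l * ‖∑' n, T n‖ ≤ l * (C₁ * C₂ * (l⁻¹ * (1 + l) ^ (s - 3 / 2)) * (σ + σ')) := by gcongr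
      _ = _ := by field_simp

end IsModularData

end Comparison

section Integrals

variable {𝒜 : Type*} [CStarAlgebra 𝒜] [PartialOrder 𝒜] [StarOrderedRing 𝒜]

namespace IsModularData

variable {A F h ρ : 𝒜} {r : ℝ}

/-! ### The integral of the commuting expansion -/

lemma smul_resolv_pow_eq_cfc (M : IsModularData A F h ρ r) {l : ℝ} (hl : 0 ≤ l) (n : ℕ) :
    l ^ (-(1 / 2) : ℝ) • ((l • resolv A l) ^ n * resolv A l) = cfc (resKernel n l) A := by
  have hsa : IsSelfAdjoint A := .of_nonneg M.nonneg
  have hsp := spectrum_subset_Icc M.nonneg M.le_one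
  have hc := continuousOn_res hl
  have hR : ContinuousOn (fun x : ℝ => (l * (x / (1 + l * x))) ^ n) (Icc 0 1) :=
    (continuousOn_const.mul hc).pow n
  have e2 : (l • resolv A l) ^ n = cfc (fun x : ℝ => (l * (x / (1 + l * x))) ^ n) A := by
    rw [cfc_pow (fun x : ℝ => l * (x / (1 + l * x))) n A
      ((continuousOn_const.mul hc).mono hsp),
      cfc_const_mul l (fun x : ℝ => x / (1 + l * x)) A (hc.mono hsp), resolv]
  have e3 : ContinuousOn (fun x : ℝ => (l * (x / (1 + l * x))) ^ n * (x / (1 + l * x)))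
    (Icc 0 1) := hR.mul hc
  rw [e2, resolv, cfc_mul_cfc_eq M.nonneg M.le_one hR hc fun _ _ => rfl,
    ← cfc_const_mul _ _ A (e3.mono hsp)]
  refine cfc_congr fun x _ => ?_
  simp only [resKernel, mul_div_assoc]

lemma integrableOn_cfc_resKernel (M : IsModularData A F h ρ r) (n : ℕ) :
    IntegrableOn (fun l => cfc (resKernel n l) A) (Ioi 0) := by
  have hsa : IsSelfAdjoint A := .of_nonneg M.nonneg
  have hsp := spectrum_subset_Icc M.nonneg M.le_one
  refine integrableOn_cfc measurableSet_Ioi _ (fun l => l ^ (-(1 / 2) : ℝ) * (1 + l) ^ (-1 : ℝ)) A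
    ((continuousOn_resKernel n).mono (prod_mono_right hsp)) ?_
    (integrableOn_rpow_mul_one_add_rpow (by norm_num)).2
  refine ae_restrict_of_forall_mem measurableSet_Ioi fun l hl x hx => ?_
  rw [Real.norm_of_nonneg (resKernel_nonneg (le_of_lt hl) (hsp hx).1)]
  exact resKernel_le (le_of_lt hl) (hsp hx).1 (hsp hx).2

lemma integral_cfc_resKernel (M : IsModularData A F h ρ r) (n : ℕ) :
    ∫ l in Ioi (0 : ℝ), cfc (resKernel n l) A =
      (Real.pi * invSqrtCoeff n) • A ^ (1 / 2 : ℝ) := by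
  have hsa : IsSelfAdjoint A := .of_nonneg M.nonneg
  have hsp := spectrum_subset_Icc M.nonneg M.le_one
  rw [← cfc_setIntegral measurableSet_Ioi _
    (fun l => l ^ (-(1 / 2) : ℝ) * (1 + l) ^ (-1 : ℝ)) A
    ((continuousOn_resKernel n).mono (prod_mono_right hsp)) ?_
    (integrableOn_rpow_mul_one_add_rpow (by norm_num)).2, CFC.rpow_eq_cfc_real M.nonneg,
    ← cfc_const_mul _ _ A ((continuousOn_rpow_Icc (by norm_num)).mono hsp)]
  · refine cfc_congr fun x hx => ?_
    rw [integral_resKernel n (hsp hx).1, Real.sqrt_eq_rpow]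
  · refine ae_restrict_of_forall_mem measurableSet_Ioi fun l hl x hx => ?_
    rw [Real.norm_of_nonneg (resKernel_nonneg (le_of_lt hl) (hsp hx).1)]
    exact resKernel_le (le_of_lt hl) (hsp hx).1 (hsp hx).2

/-- The binomial series for `(1 - K)^(-1/2) = √r Δ⁻¹`, multiplied by `Δ⁶` so that it converges in
norm. -/
lemma hasSum_invSqrtCoeff_cutoff (M : IsModularData A F h ρ r) :
    HasSum (fun n => invSqrtCoeff n • (h ^ 12 * cutoff h r ^ n)) (√r • h ^ 10) := by
  have hr := M.r_pos
  have hh := M.root_nonneg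
  have hsa : IsSelfAdjoint h := .of_nonneg hh
  have hsp : ∀ t ∈ spectrum ℝ h, 0 ≤ t ∧ t ^ 4 / r < 1 := fun t ht => by
    have h0 : 0 ≤ t := spectrum_nonneg_of_nonneg hh ht
    have h1 : t ≤ ‖h‖ := le_norm_of_mem_spectrum ht
    refine ⟨h0, ?_⟩
    rw [div_lt_one hr]
    exact (pow_le_pow_left₀ h0 h1 4).trans_lt M.norm_root
  set f : ℕ → ℝ → ℝ := fun n t => invSqrtCoeff n * (t ^ 12 * (1 - t ^ 4 / r) ^ n) with hf
  have hfe : ∀ n, invSqrtCoeff n • (h ^ 12 * cutoff h r ^ n) = cfc (f n) h := fun n => by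
    rw [pow_mul_cutoff_pow hh, ← cfc_const_mul _ _ h (by fun_prop)]
  set u : ℕ → ℝ := fun n => r ^ 3 * (4 * ((n : ℝ) + 1) ^ (-2 : ℝ)) with hu
  have hus : Summable u := ((summable_add_one_rpow (by norm_num)).mul_left 4).mul_left _
  have hfu : ∀ n, ∀ t ∈ spectrum ℝ h, ‖f n t‖ ≤ u n := by
    intro n t ht
    obtain ⟨h0, h1⟩ := hsp t ht
    have h2 : 0 ≤ t ^ 4 / r := by positivity
    have h3 : 0 ≤ 1 - t ^ 4 / r := by linarith
    have h4 := pow_mul_one_sub_sq_le h3 (by linarith) n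
    rw [sub_sub_cancel] at h4
    have hc0 := invSqrtCoeff_nonneg n
    simp only [hf, hu]
    rw [Real.norm_of_nonneg (by positivity), Real.rpow_neg (by positivity), Real.rpow_ofNat]
    calc invSqrtCoeff n * (t ^ 12 * (1 - t ^ 4 / r) ^ n)
        ≤ 1 * (t ^ 12 * (1 - t ^ 4 / r) ^ n) := by
          gcongr
          exact invSqrtCoeff_le_one n
      _ = r ^ 3 * ((t ^ 4 / r) * ((1 - t ^ 4 / r) ^ n * (t ^ 4 / r) ^ 2)) := by field_simp
      _ ≤ r ^ 3 * (1 * (4 * (((n : ℝ) + 1) ^ 2)⁻¹)) := by gcongr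
      _ = _ := by rw [one_mul]
  have hlim := tendstoUniformlyOn_tsum_nat hus hfu
  have htend := tendsto_cfc_fun (a := h) hlim (Filter.Eventually.of_forall fun N => by fun_prop)
  have hval : cfc (fun t => ∑' n, f n t) h = √r • h ^ 10 := by
    rw [← cfc_pow_id (R := ℝ) h 10, ← cfc_const_mul _ _ h (by fun_prop)]
    refine cfc_congr fun t ht => ?_
    obtain ⟨h0, h1⟩ := hsp t ht
    rcases h0.eq_or_lt with rfl | h0'
    · simp [hf]
    have h2 : 0 < t ^ 4 / r := by positivity
    have h3 := (hasSum_invSqrtCoeff (k := 1 - t ^ 4 / r) (by linarith) (by linarith)).mul_left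
      (t ^ 12)
    rw [sub_sub_cancel] at h3
    have h4 : (fun n => f n t) = fun n => t ^ 12 * (invSqrtCoeff n * (1 - t ^ 4 / r) ^ n) := by
      funext n
      simp only [hf]
      ring
    rw [h4, h3.tsum_eq, Real.sqrt_div (by positivity), show t ^ 4 = (t ^ 2) ^ 2 by ring,
      Real.sqrt_sq (by positivity)]
    field_simp
  have hsum : Summable fun n => invSqrtCoeff n • (h ^ 12 * cutoff h r ^ n) := by
    refine .of_norm_bounded hus fun n => ?_
    rw [hfe]
    exact norm_cfc_le (by positivity) (hfu n)
  rw [hval] at htend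
  refine (hsum.hasSum_iff_tendsto_nat).mpr (htend.congr fun N => ?_)
  have e : (fun t => ∑ n ∈ Finset.range N, f n t) = ∑ n ∈ Finset.range N, f n := by
    funext t
    rw [Finset.sum_apply]
  rw [e, cfc_sum f h _ fun n _ => by fun_prop]
  exact Finset.sum_congr rfl fun n _ => (hfe n).symm

lemma hasSum_mul_commSeries (M : IsModularData A F h ρ r) {l : ℝ} (hl : 0 ≤ l) :
    HasSum (fun n => h ^ 12 * cutoff h r ^ n * cfc (resKernel n l) A)
      (l ^ (-(1 / 2) : ℝ) • (h ^ 6 * commSeries A h r l)) := by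
  have := (((M.summable_commSeries hl).hasSum).mul_left (h ^ 6)).const_smul (l ^ (-(1 / 2) : ℝ))
  refine this.congr_fun fun n => ?_
  rw [← M.smul_resolv_pow_eq_cfc hl, mul_smul_comm, ← mul_assoc (h ^ 6), ← mul_assoc (h ^ 6),
    ← pow_add]

lemma norm_commSeries_term_le (M : IsModularData A F h ρ r) {l : ℝ} (hl : 0 ≤ l) (n : ℕ) :
    ‖h ^ 12 * cutoff h r ^ n * cfc (resKernel n l) A‖ ≤
      4 * r ^ 3 * ((n : ℝ) + 1) ^ (-2 : ℝ) * (l ^ (-(1 / 2) : ℝ) * (1 + l) ^ (-1 : ℝ)) := by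
  have hr := M.r_pos
  refine (norm_mul_le _ _).trans (mul_le_mul
    (norm_pow_twelve_mul_cutoff_le M.root_nonneg M.norm_root n) ?_ (norm_nonneg _) (by positivity))
  refine norm_cfc_le_of_Icc M.nonneg M.le_one (by positivity) fun x hx => ?_
  rw [abs_of_nonneg (resKernel_nonneg hl hx.1)]
  exact resKernel_le hl hx.1 hx.2

lemma integrableOn_commSeries (M : IsModularData A F h ρ r) :
    IntegrableOn (fun l : ℝ => l ^ (-(1 / 2) : ℝ) • (h ^ 6 * commSeries A h r l)) (Ioi 0) := by
  have hint : ∀ n : ℕ, IntegrableOn (fun l => h ^ 12 * cutoff h r ^ n * cfc (resKernel n l) A)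
    (Ioi 0) := fun n => (M.integrableOn_cfc_resKernel n).const_mul' _
  have hσ : Summable fun n : ℕ => 4 * r ^ 3 * ((n : ℝ) + 1) ^ (-2 : ℝ) :=
    (summable_add_one_rpow (by norm_num)).mul_left _
  refine Integrable.mono' ((integrableOn_rpow_mul_one_add_rpow (t := -1) (by norm_num)).const_mul
    (∑' n : ℕ, 4 * r ^ 3 * ((n : ℝ) + 1) ^ (-2 : ℝ))) ?_ ?_
  · refine aestronglyMeasurable_of_tendsto_ae (u := Filter.atTop)
      (f := fun (N : ℕ) l => ∑ n ∈ Finset.range N,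
        h ^ 12 * cutoff h r ^ n * cfc (resKernel n l) A) ?_ ?_
    · intro N
      exact (integrable_finsetSum _ fun n _ => hint n).aestronglyMeasurable
    · exact ae_restrict_of_forall_mem measurableSet_Ioi fun l hl =>
        (M.hasSum_mul_commSeries (le_of_lt hl)).tendsto_sum_nat
  · refine ae_restrict_of_forall_mem measurableSet_Ioi fun l hl => ?_
    have hs := M.hasSum_mul_commSeries (le_of_lt hl)
    rw [← hs.tsum_eq, ← tsum_mul_right]
    have hb := hσ.mul_right (l ^ (-(1 / 2) : ℝ) * (1 + l) ^ (-1 : ℝ))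
    exact tsum_of_norm_bounded hb.hasSum fun n => M.norm_commSeries_term_le (le_of_lt hl) n

lemma integral_commSeries (M : IsModularData A F h ρ r) :
    ∫ l in Ioi (0 : ℝ), l ^ (-(1 / 2) : ℝ) • (h ^ 6 * commSeries A h r l) =
      (Real.pi * √r) • (h ^ 10 * A ^ (1 / 2 : ℝ)) := by
  have hr := M.r_pos
  have hint : ∀ n : ℕ, IntegrableOn (fun l => h ^ 12 * cutoff h r ^ n * cfc (resKernel n l) A)
    (Ioi 0) := fun n => (M.integrableOn_cfc_resKernel n).const_mul' _
  have hbi := integrableOn_rpow_mul_one_add_rpow (t := -1) (by norm_num)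
  have hsum : Summable fun n : ℕ => ∫ l in Ioi (0 : ℝ),
      ‖h ^ 12 * cutoff h r ^ n * cfc (resKernel n l) A‖ := by
    refine Summable.of_nonneg_of_le (fun n => integral_nonneg fun _ => norm_nonneg _) (fun n => ?_)
      (((summable_add_one_rpow (s := -2) (by norm_num)).mul_left (4 * r ^ 3)).mul_right
        (∫ l in Ioi (0 : ℝ), l ^ (-(1 / 2) : ℝ) * (1 + l) ^ (-1 : ℝ)))
    rw [← integral_const_mul]
    exact setIntegral_mono_on (hint n).norm (hbi.const_mul _) measurableSet_Ioi fun l hl =>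
      M.norm_commSeries_term_le (le_of_lt hl) n
  have h1 := hasSum_integral_of_summable_integral_norm hint hsum
  have h2 : ∫ l in Ioi (0 : ℝ), ∑' n, h ^ 12 * cutoff h r ^ n * cfc (resKernel n l) A =
      ∫ l in Ioi (0 : ℝ), l ^ (-(1 / 2) : ℝ) • (h ^ 6 * commSeries A h r l) :=
    setIntegral_congr_fun measurableSet_Ioi fun l hl =>
      (M.hasSum_mul_commSeries (le_of_lt hl)).tsum_eq
  have h3 := (M.hasSum_invSqrtCoeff_cutoff.mul_right (A ^ (1 / 2 : ℝ))).const_smul Real.pi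
  have h4 : (fun n => ∫ l in Ioi (0 : ℝ), h ^ 12 * cutoff h r ^ n * cfc (resKernel n l) A) =
      fun n => Real.pi • (invSqrtCoeff n • (h ^ 12 * cutoff h r ^ n) * A ^ (1 / 2 : ℝ)) := by
    funext n
    rw [integral_const_mul_of_integrable (f := fun l => cfc (resKernel n l) A)
      (M.integrableOn_cfc_resKernel n), M.integral_cfc_resKernel, mul_smul_comm, mul_smul,
      smul_mul_assoc]
  rw [h4] at h1
  rw [← h2, h1.unique h3, smul_mul_assoc, smul_smul]

/-! ### The integral of the modular resolvent -/

lemma continuousOn_modResolv (M : IsModularData A F h ρ r) :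
    ContinuousOn (modResolv A h r) (Ioi 0) := by
  have hR : ContinuousOn (resolv A) (Ioi 0) :=
    (continuousOn_resolv M.nonneg M.le_one).mono Ioi_subset_Ici_self
  have hY : ContinuousOn (fun l : ℝ => 1 - l • (resolv A l * cutoff h r)) (Ioi 0) :=
    continuousOn_const.sub (continuousOn_id.smul (hR.mul continuousOn_const))
  have hinv : ContinuousOn (fun l : ℝ => Ring.inverse (1 - l • (resolv A l * cutoff h r)))
      (Ioi 0) := by
    intro l hl
    obtain ⟨y, hy⟩ := M.isUnit_one_sub (le_of_lt hl)
    have hc := NormedRing.inverse_continuousAt y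
    rw [hy] at hc
    exact ContinuousAt.comp_continuousWithinAt (g := Ring.inverse) hc (hY l hl)
  exact (hinv.mul continuousOn_const).mul hR

lemma integrableOn_sub (M : IsModularData A F h ρ r) :
    IntegrableOn (fun l : ℝ => l ^ (-(1 / 2) : ℝ) •
      (h ^ 6 * (modResolv A h r l - commSeries A h r l))) (Ioi 0) := by
  obtain ⟨C, hC, hT⟩ := M.exists_factor (s := 7 / 8) le_rfl (by norm_num)
  refine Integrable.mono' ((integrableOn_rpow_mul_one_add_rpow (t := 7 / 8 - 3 / 2)
    (by norm_num)).const_mul (C * ‖A ^ (7 / 8 : ℝ)‖)) ?_ ?_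
  · have h1 : ContinuousOn (fun l : ℝ => l ^ (-(1 / 2) : ℝ) • (h ^ 6 * modResolv A h r l))
        (Ioi 0) :=
      (ContinuousOn.rpow_const continuousOn_id fun l hl => Or.inl (ne_of_gt hl)).smul
        (continuousOn_const.mul M.continuousOn_modResolv)
    refine ((h1.aestronglyMeasurable measurableSet_Ioi).sub
      M.integrableOn_commSeries.aestronglyMeasurable).congr (.of_forall fun l => ?_)
    simp only [Pi.sub_apply, mul_sub, smul_sub]
  · refine ae_restrict_of_forall_mem measurableSet_Ioi fun l hl => ?_
    have hl' : (0 : ℝ) < l := hl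
    obtain ⟨T, hT1, hT2⟩ := hT l hl'
    rw [hT1, norm_smul, Real.norm_of_nonneg (by positivity)]
    calc l ^ (-(1 / 2) : ℝ) * ‖T * A ^ (7 / 8 : ℝ)‖
        ≤ l ^ (-(1 / 2) : ℝ) * (C * (1 + l) ^ (7 / 8 - 3 / 2 : ℝ) * ‖A ^ (7 / 8 : ℝ)‖) := by
          gcongr
          exact (norm_mul_le _ _).trans (mul_le_mul_of_nonneg_right hT2 (norm_nonneg _))
      _ = _ := by ring

lemma smul_modResolv_eq (M : IsModularData A F h ρ r) {l : ℝ} (hl : 0 < l) :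
    (l * r) ^ (-(1 / 2) : ℝ) • (h ^ 6 * modResolv A h r l) =
      (√r)⁻¹ • (l ^ (-(1 / 2) : ℝ) • (h ^ 6 * (modResolv A h r l - commSeries A h r l)) +
        l ^ (-(1 / 2) : ℝ) • (h ^ 6 * commSeries A h r l)) := by
  rw [← smul_add, ← mul_add, sub_add_cancel, smul_smul, Real.mul_rpow hl.le M.r_pos.le,
    Real.rpow_neg M.r_pos.le, ← Real.sqrt_eq_rpow, mul_comm]

lemma integrableOn_modResolv (M : IsModularData A F h ρ r) :
    IntegrableOn (fun l : ℝ => (l * r) ^ (-(1 / 2) : ℝ) • (h ^ 6 * modResolv A h r l)) (Ioi 0) :=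
  (integrableOn_congr_fun (fun _ hl => M.smul_modResolv_eq hl) measurableSet_Ioi).mpr
    ((M.integrableOn_sub.add M.integrableOn_commSeries).smul (√r)⁻¹)

lemma integral_modResolv_sub (M : IsModularData A F h ρ r) :
    Real.pi⁻¹ • ∫ l in Ioi (0 : ℝ), (l * r) ^ (-(1 / 2) : ℝ) • (h ^ 6 * modResolv A h r l) =
      h ^ 10 * A ^ (1 / 2 : ℝ) + (Real.pi⁻¹ * (√r)⁻¹) • ∫ l in Ioi (0 : ℝ), l ^ (-(1 / 2) : ℝ) •
        (h ^ 6 * (modResolv A h r l - commSeries A h r l)) := by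
  have hr : √r ≠ 0 := (Real.sqrt_pos.mpr M.r_pos).ne'
  rw [setIntegral_congr_fun measurableSet_Ioi fun _ hl => M.smul_modResolv_eq hl,
    integral_smul, integral_add M.integrableOn_sub M.integrableOn_commSeries,
    M.integral_commSeries, smul_add, smul_add, smul_smul, smul_smul, smul_smul, add_comm]
  congr 1
  rw [show Real.pi⁻¹ * (√r)⁻¹ * (Real.pi * √r) = 1 by field_simp, one_smul]

/-- `Δ⁵ (1 + D²)^(-1/2)` minus the integral of the modular resolvent behaves like an operator of the
form `T A^s`, for every `s < 1` close to `1`. The linear maps `φ` that matter are the evaluations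
`T ↦ T y` at vectors of the module. -/
theorem exists_bound (M : IsModularData A F h ρ r) {s : ℝ} (hs : 7 / 8 ≤ s) (hs1 : s < 1)
    {G : Type*} [NormedAddCommGroup G] [NormedSpace ℝ G] [CompleteSpace G] :
    ∃ C, 0 ≤ C ∧ ∀ (φ : 𝒜 →L[ℝ] G) (c : ℝ), (∀ T, ‖φ (T * A ^ s)‖ ≤ ‖T‖ * c) → 0 ≤ c →
      ‖φ (h ^ 10 * A ^ (1 / 2 : ℝ) - Real.pi⁻¹ • ∫ l in Ioi (0 : ℝ),
        (l * r) ^ (-(1 / 2) : ℝ) • (h ^ 6 * modResolv A h r l))‖ ≤ C * c := by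
  obtain ⟨C, hC, hT⟩ := M.exists_factor hs hs1.le
  set I := ∫ l in Ioi (0 : ℝ), l ^ (-(1 / 2) : ℝ) * (1 + l) ^ (s - 3 / 2) with hI
  have hI0 : 0 ≤ I := setIntegral_nonneg measurableSet_Ioi fun l hl => by
    have : (0 : ℝ) < l := hl
    positivity
  refine ⟨Real.pi⁻¹ * (√r)⁻¹ * (C * I), by positivity, fun φ c hφ hc => ?_⟩
  rw [M.integral_modResolv_sub, sub_add_cancel_left, map_neg, norm_neg, map_smul, norm_smul,
    Real.norm_of_nonneg (by positivity), ← φ.integral_comp_comm M.integrableOn_sub,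
    mul_assoc _ (C * I) c]
  refine mul_le_mul_of_nonneg_left ?_ (by positivity)
  calc ‖∫ l in Ioi (0 : ℝ), φ (l ^ (-(1 / 2) : ℝ) •
        (h ^ 6 * (modResolv A h r l - commSeries A h r l)))‖
      ≤ ∫ l in Ioi (0 : ℝ), C * c * (l ^ (-(1 / 2) : ℝ) * (1 + l) ^ (s - 3 / 2)) := by
        refine norm_integral_le_of_norm_le
          ((integrableOn_rpow_mul_one_add_rpow (by linarith)).const_mul _) ?_
        refine ae_restrict_of_forall_mem measurableSet_Ioi fun l hl => ?_
        have hl' : (0 : ℝ) < l := hl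
        obtain ⟨T, hT1, hT2⟩ := hT l hl'
        rw [hT1, map_smul, norm_smul, Real.norm_of_nonneg (by positivity)]
        calc l ^ (-(1 / 2) : ℝ) * ‖φ (T * A ^ s)‖
            ≤ l ^ (-(1 / 2) : ℝ) * (C * (1 + l) ^ (s - 3 / 2) * c) := by
              gcongr
              exact (hφ T).trans (mul_le_mul_of_nonneg_right hT2 hc)
          _ = _ := by ring
    _ = C * I * c := by rw [integral_const_mul]; ring

end IsModularData
end Integrals

/-! ### Graphs of the unbounded operators -/

section Graphs

variable {Y : Type*} [NormedAddCommGroup Y] [NormedSpace ℂ Y]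

lemma mem_graph_pcomp {T S : Y →ₗ.[ℂ] Y} {x z : Y} :
    (x, z) ∈ (pcomp T S).graph ↔ ∃ y, (x, y) ∈ S.graph ∧ (y, z) ∈ T.graph := by
  constructor
  · intro h
    obtain ⟨⟨x', w, hw, rfl⟩, hx, hz⟩ := (LinearPMap.mem_graph_iff _).mp h
    simp only at hx hz
    subst hx hz
    exact ⟨S w, S.mem_graph w, T.mem_graph ⟨S w, hw⟩⟩
  · rintro ⟨y, hxy, hyz⟩
    obtain ⟨x', hx, hy⟩ := (LinearPMap.mem_graph_iff _).mp hxy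
    obtain ⟨y', hy', hz⟩ := (LinearPMap.mem_graph_iff _).mp hyz
    simp only at hx hy hy' hz
    subst hx hz
    have hmem : S x' ∈ T.domain := by
      rw [hy, ← hy']
      exact y'.2
    refine (LinearPMap.mem_graph_iff _).mpr ⟨⟨x', x', hmem, rfl⟩, rfl, ?_⟩
    change T ⟨S x', hmem⟩ = T y'
    congr 1
    ext
    exact hy.trans hy'.symm

lemma mem_graph_addConst {c : ℝ} {T : Y →ₗ.[ℂ] Y} {x z : Y} :
    (x, z) ∈ (addConst c T).graph ↔ ∃ y, (x, y) ∈ T.graph ∧ z = (c : ℂ) • x + y := by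
  constructor
  · intro h
    obtain ⟨x', hx, hz⟩ := (LinearPMap.mem_graph_iff _).mp h
    simp only at hx hz
    subst hx
    exact ⟨T x', T.mem_graph x', hz.symm⟩
  · rintro ⟨y, hxy, rfl⟩
    obtain ⟨x', hx, hy⟩ := (LinearPMap.mem_graph_iff _).mp hxy
    simp only at hx hy
    subst hx hy
    exact (LinearPMap.mem_graph_iff _).mpr ⟨x', rfl, rfl⟩

lemma mem_graph_sub {S T : Y →ₗ.[ℂ] Y} {x z : Y} :
    (x, z) ∈ (S - T).graph ↔ ∃ y w, (x, y) ∈ S.graph ∧ (x, w) ∈ T.graph ∧ z = y - w := by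
  constructor
  · intro h
    obtain ⟨⟨x', hS, hT⟩, hx, hz⟩ := (LinearPMap.mem_graph_iff _).mp h
    simp only at hx hz
    subst hx hz
    exact ⟨_, _, S.mem_graph ⟨x', hS⟩, T.mem_graph ⟨x', hT⟩, rfl⟩
  · rintro ⟨y, w, hS, hT, rfl⟩
    obtain ⟨⟨x₁, hx₁⟩, h₁, rfl⟩ := (LinearPMap.mem_graph_iff _).mp hS
    obtain ⟨⟨x₂, hx₂⟩, h₂, rfl⟩ := (LinearPMap.mem_graph_iff _).mp hT
    simp only at h₁ h₂
    subst h₁ h₂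
    exact (LinearPMap.mem_graph_iff _).mpr ⟨⟨_, hx₁, hx₂⟩, rfl, rfl⟩

lemma exists_extension [CompleteSpace Y] {S : Y →ₗ.[ℂ] Y} (hS : Dense (S.domain : Set Y)) {C : ℝ}
    (hC : ∀ x z, (x, z) ∈ S.graph → ‖z‖ ≤ C * ‖x‖) :
    ∃ T : Y →L[ℂ] Y, S ≤ T.toLinearMap.toPMap ⊤ := by
  let f : S.domain →L[ℂ] Y := S.toFun.mkContinuous C fun x => hC _ _ (S.mem_graph x)
  have hd : DenseRange S.domain.subtypeL := by
    simpa [DenseRange, Subtype.range_coe] using hS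
  refine ⟨f.extend S.domain.subtypeL, le_top, fun x y hxy => ?_⟩
  have := f.extend_eq (e := S.domain.subtypeL) hd (isUniformInducing_val _) x
  change S x = f.extend S.domain.subtypeL (y : Y)
  rw [← hxy]
  exact this.symm

variable {B : Type*} [NonUnitalCStarAlgebra B] [PartialOrder B] [SMul B Y] [CStarModule B Y]

lemma mem_graph_toPMap {T : AdjointableOp B Y} {x y : Y} :
    (x, y) ∈ (toPMap T).graph ↔ y = T x := by
  constructor
  · intro h
    obtain ⟨x', hx, hy⟩ := (LinearPMap.mem_graph_iff _).mp h
    simp only at hx hy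
    subst hx hy
    rfl
  · rintro rfl
    exact (LinearPMap.mem_graph_iff _).mpr ⟨⟨x, trivial⟩, rfl, rfl⟩

lemma mem_graph_inverse_toPMap {T : AdjointableOp B Y} (hT : Function.Injective T) {x y : Y} :
    (x, y) ∈ (toPMap T).inverse.graph ↔ x = T y := by
  have hker : (toPMap T).toFun.ker = ⊥ := by
    rw [LinearMap.ker_eq_bot']
    intro m hm
    ext
    exact hT (hm.trans (map_zero T.toCLM).symm)
  rw [LinearPMap.inverse_graph hker, ← mem_graph_toPMap]
  constructor
  · rintro ⟨⟨u, v⟩, huv, h⟩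
    simp only [LinearEquiv.coe_coe, LinearEquiv.prodComm_apply, Prod.swap_prod_mk,
      Prod.mk.injEq] at h
    obtain ⟨rfl, rfl⟩ := h
    exact huv
  · intro h
    exact ⟨(y, x), h, rfl⟩

lemma AdjointableOp.mul_apply (S T : AdjointableOp B Y) (y : Y) : (S * T) y = S (T y) := by
  rw [map_mul]
  rfl

lemma AdjointableOp.sub_apply (S T : AdjointableOp B Y) (y : Y) : (S - T) y = S y - T y := by
  rw [map_sub]
  rfl

lemma AdjointableOp.add_apply (S T : AdjointableOp B Y) (y : Y) : (S + T) y = S y + T y := by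
  rw [map_add]
  rfl

lemma AdjointableOp.one_apply (y : Y) : (1 : AdjointableOp B Y) y = y := by
  rw [map_one]
  rfl

lemma AdjointableOp.ext_apply {S T : AdjointableOp B Y} (h : ∀ y, S y = T y) : S = T :=
  AdjointableOp.toCLM_injective (ContinuousLinearMap.ext h)

lemma AdjointableOp.real_smul_apply (c : ℝ) (T : AdjointableOp B Y) (y : Y) :
    (c • T) y = (c : ℂ) • T y := by
  have : c • T = (c : ℂ) • T := (Complex.coe_smul c T).symm
  rw [this, map_smul]
  rfl

/-- Operators of dense range can be cancelled on the right. -/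
lemma AdjointableOp.eq_of_mul_eq_mul {S T A : AdjointableOp B Y} (hA : DenseRange A)
    (h : S * A = T * A) : S = T := by
  refine AdjointableOp.toCLM_injective (ContinuousLinearMap.coeFn_injective ?_)
  refine hA.equalizer S.toCLM.continuous T.toCLM.continuous (funext fun y => ?_)
  have := congrArg (fun U : AdjointableOp B Y => U y) h
  simpa [AdjointableOp.mul_apply] using this

lemma dense_range_of_mul {S T U : AdjointableOp B Y} (hA : DenseRange U) (h : S * T = U) :
    DenseRange S := by
  refine hA.mono ?_
  rintro _ ⟨y, rfl⟩
  exact ⟨T y, by rw [← h, AdjointableOp.mul_apply]⟩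

end Graphs

/-! ### The resolvent and the bounded transform of a selfadjoint regular operator -/

section Transform

variable {B Y : Type*} [NonUnitalCStarAlgebra B] [PartialOrder B] [StarOrderedRing B]
    [NormedAddCommGroup Y] [NormedSpace ℂ Y] [SMul B Y] [CStarModule B Y]

lemma IsSelfAdjointOp.symmetric {D : Y →ₗ.[ℂ] Y} (hD : IsSelfAdjointOp B D) {x v y w : Y}
    (hx : (x, v) ∈ D.graph) (hy : (y, w) ∈ D.graph) : inner B v y = inner B x w := by
  have hsv : ∀ q ∈ adjointGraph B D, q.1 = 0 → q.2 = 0 := by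
    rintro ⟨a, b⟩ hq (rfl : a = 0)
    have h0 : ∀ x ∈ D.domain, inner B x b = 0 := fun x hx => by
      have := hq ⟨x, hx⟩
      simpa using this.symm
    have h1 : ∀ z : Y, inner B z b = 0 := by
      have hc : Continuous fun z : Y => (inner B z b : B) :=
        (CStarModule.continuous_inner (A := B) (E := Y)).comp
          (Continuous.prodMk continuous_id continuous_const)
      have := hc.ext_on hD.dense_domain (continuous_const (y := (0 : B))) fun z hz => h0 z hz
      exact fun z => congrFun this z
    exact CStarModule.inner_self.mp (h1 b)
  have hgr : D.graph = adjointGraph B D := by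
    conv_lhs => rw [← hD.adjoint_eq]
    exact Submodule.toLinearPMap_graph_eq _ hsv
  rw [hgr] at hy
  obtain ⟨x', hx1, hx2⟩ := (LinearPMap.mem_graph_iff _).mp hx
  simp only at hx1 hx2
  subst hx1 hx2
  exact hy x'

/-- The a priori estimate behind the invertibility of `1 + D²`. -/
lemma IsSelfAdjointOp.norm_le {D : Y →ₗ.[ℂ] Y} (hD : IsSelfAdjointOp B D) {x v w : Y}
    (hx : (x, v) ∈ D.graph) (hv : (v, w) ∈ D.graph) : ‖x‖ ≤ ‖x + w‖ ∧ ‖v‖ ≤ ‖x + w‖ := by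
  have h1 : inner B x (x + w) = inner B x x + inner B v v := by
    rw [CStarModule.inner_add_right, hD.symmetric hx hv]
  have hxx : (0 : B) ≤ inner B x x := CStarModule.inner_self_nonneg
  have hvv : (0 : B) ≤ inner B v v := CStarModule.inner_self_nonneg
  have h2 : ‖x‖ ^ 2 ≤ ‖x‖ * ‖x + w‖ := by
    rw [CStarModule.norm_sq_eq (A := B)]
    refine (CStarAlgebra.norm_le_norm_of_nonneg_of_le hxx ?_).trans
      (CStarModule.norm_inner_le (A := B) Y)
    rw [h1]
    exact le_add_of_nonneg_right hvv
  have h3 : ‖v‖ ^ 2 ≤ ‖x‖ * ‖x + w‖ := by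
    rw [CStarModule.norm_sq_eq (A := B)]
    refine (CStarAlgebra.norm_le_norm_of_nonneg_of_le hvv ?_).trans
      (CStarModule.norm_inner_le (A := B) Y)
    rw [h1]
    exact le_add_of_nonneg_left hxx
  have h4 : ‖x‖ ≤ ‖x + w‖ := by
    rcases (norm_nonneg x).eq_or_lt with h | h
    · rw [← h]
      exact norm_nonneg _
    · nlinarith
  refine ⟨h4, ?_⟩
  refine abs_le_of_sq_le_sq' ?_ (norm_nonneg _) |>.2
  nlinarith [norm_nonneg (x + w)]

/-- `1 + D²` is onto: its range is dense, and closed by the a priori estimate. -/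
lemma exists_solution [CompleteSpace Y] {D : Y →ₗ.[ℂ] Y} (hD : IsSelfAdjointOp B D)
    (hreg : IsRegularOp B D) (y : Y) : ∃ x v, (x, v) ∈ D.graph ∧ (v, y - x) ∈ D.graph := by
  have hdense := hreg.denseRange
  rw [hD.adjoint_eq] at hdense
  obtain ⟨u, hu, hlim⟩ := mem_closure_iff_seq_limit.mp (hdense y)
  have hgr : ∀ n, ∃ x v, (x, v) ∈ D.graph ∧ (v, u n - x) ∈ D.graph := by
    intro n
    obtain ⟨x, hx⟩ := hu n
    have := (addConst 1 (pcomp D D)).mem_graph x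
    rw [hx] at this
    obtain ⟨w, hw, hw'⟩ := mem_graph_addConst.mp this
    obtain ⟨v, hxv, hvw⟩ := mem_graph_pcomp.mp hw
    refine ⟨x, v, hxv, ?_⟩
    rw [hw']
    simpa using hvw
  choose x v hxv hvw using hgr
  have hdiff : ∀ m n, ‖x m - x n‖ ≤ ‖u m - u n‖ ∧ ‖v m - v n‖ ≤ ‖u m - u n‖ := by
    intro m n
    have := hD.norm_le (D.graph.sub_mem (hxv m) (hxv n)) (D.graph.sub_mem (hvw m) (hvw n))
    have e : x m - x n + (u m - x m - (u n - x n)) = u m - u n := by abel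
    simpa only [Prod.mk_sub_mk, e] using this
  have hcu := hlim.cauchySeq
  have hcauchy : ∀ f : ℕ → Y, (∀ m n, ‖f m - f n‖ ≤ ‖u m - u n‖) → CauchySeq f := by
    intro f hf
    rw [Metric.cauchySeq_iff] at hcu ⊢
    intro ε hε
    obtain ⟨N, hN⟩ := hcu ε hε
    refine ⟨N, fun m hm n hn => lt_of_le_of_lt ?_ (hN m hm n hn)⟩
    rw [dist_eq_norm, dist_eq_norm]
    exact hf m n
  have hcx : CauchySeq x := hcauchy x fun m n => (hdiff m n).1
  have hcv : CauchySeq v := hcauchy v fun m n => (hdiff m n).2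
  obtain ⟨x₀, hx₀⟩ := cauchySeq_tendsto_of_complete hcx
  obtain ⟨v₀, hv₀⟩ := cauchySeq_tendsto_of_complete hcv
  have hcl : IsClosed (D.graph : Set (Y × Y)) := hreg.isClosed
  exact ⟨x₀, v₀, hcl.mem_of_tendsto (hx₀.prodMk_nhds hv₀) (.of_forall hxv),
    hcl.mem_of_tendsto (hv₀.prodMk_nhds (hlim.sub hx₀)) (.of_forall hvw)⟩

/-- The operators `A = (1 + D²)⁻¹` and `G = D (1 + D²)⁻¹`. -/
lemma exists_resolvent [CompleteSpace Y] {D : Y →ₗ.[ℂ] Y} (hD : IsSelfAdjointOp B D)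
    (hreg : IsRegularOp B D) :
    ∃ A G : AdjointableOp B Y, (∀ y, (A y, G y) ∈ D.graph ∧ (G y, y - A y) ∈ D.graph) ∧
      ‖A‖ ≤ 1 ∧ star A = A ∧ star G = G := by
  choose a g ha hg using exists_solution hD hreg
  have hunique : ∀ {y x v : Y}, (x, v) ∈ D.graph → (v, y - x) ∈ D.graph → x = a y ∧ v = g y := by
    intro y x v hx hv
    have := hD.norm_le (D.graph.sub_mem hx (ha y)) (D.graph.sub_mem hv (hg y))
    have e : x - a y + (y - x - (y - a y)) = 0 := by abel
    simp only [e, norm_zero, norm_le_zero_iff, sub_eq_zero] at this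
    exact this
  have hadd : ∀ x y, a (x + y) = a x + a y ∧ g (x + y) = g x + g y := fun x y => by
    have h1 := D.graph.add_mem (ha x) (ha y)
    have h2 := D.graph.add_mem (hg x) (hg y)
    have := hunique (y := x + y) h1 (by
      convert h2 using 1
      simp only [Prod.mk_add_mk, Prod.mk.injEq, true_and]
      abel)
    exact ⟨this.1.symm, this.2.symm⟩
  have hsmul : ∀ (c : ℂ) y, a (c • y) = c • a y ∧ g (c • y) = c • g y := fun c y => by
    have h1 := D.graph.smul_mem c (ha y)
    have h2 := D.graph.smul_mem c (hg y)
    have := hunique (y := c • y) h1 (by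
      convert h2 using 1
      simp only [Prod.smul_mk, Prod.mk.injEq, true_and]
      rw [smul_sub])
    exact ⟨this.1.symm, this.2.symm⟩
  have hbound : ∀ y, ‖a y‖ ≤ ‖y‖ ∧ ‖g y‖ ≤ ‖y‖ := fun y => by
    have := hD.norm_le (ha y) (hg y)
    rwa [add_sub_cancel] at this
  let Aₗ : Y →ₗ[ℂ] Y := ⟨⟨a, fun x y => (hadd x y).1⟩, fun c y => (hsmul c y).1⟩
  let Gₗ : Y →ₗ[ℂ] Y := ⟨⟨g, fun x y => (hadd x y).2⟩, fun c y => (hsmul c y).2⟩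
  let Ac : Y →L[ℂ] Y := Aₗ.mkContinuous 1 fun y => by rw [one_mul]; exact (hbound y).1
  let Gc : Y →L[ℂ] Y := Gₗ.mkContinuous 1 fun y => by rw [one_mul]; exact (hbound y).2
  have hAsym : ∀ x y, inner B (a x) y = inner B x (a y) := fun x y => by
    have e1 : (inner B (a x) y : B) = inner B (a x) (a y) + inner B (a x) (y - a y) := by
      rw [← CStarModule.inner_add_right, add_sub_cancel]
    have e2 : (inner B x (a y) : B) = inner B (a x) (a y) + inner B (x - a x) (a y) := by
      rw [← CStarModule.inner_add_left, add_sub_cancel]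
    rw [e1, e2, ← hD.symmetric (ha x) (hg y), hD.symmetric (hg x) (ha y)]
  have hGsym : ∀ x y, inner B (g x) y = inner B x (g y) := fun x y => by
    have e1 : (inner B (g x) y : B) = inner B (g x) (a y) + inner B (g x) (y - a y) := by
      rw [← CStarModule.inner_add_right, add_sub_cancel]
    have e2 : (inner B x (g y) : B) = inner B (a x) (g y) + inner B (x - a x) (g y) := by
      rw [← CStarModule.inner_add_left, add_sub_cancel]
    rw [e1, e2, hD.symmetric (ha x) (ha y), ← hD.symmetric (hg x) (hg y)]
  let A : AdjointableOp B Y := ⟨Ac, Ac, hAsym⟩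
  let G : AdjointableOp B Y := ⟨Gc, Gc, hGsym⟩
  refine ⟨A, G, fun y => ⟨ha y, hg y⟩, ?_, star_eq_of_inner hAsym, star_eq_of_inner hGsym⟩
  exact Aₗ.mkContinuous_norm_le zero_le_one fun y => by rw [one_mul]; exact (hbound y).1

end Transform

section Transform

variable {B Y : Type*} [NonUnitalCStarAlgebra B] [PartialOrder B] [StarOrderedRing B]
    [NormedAddCommGroup Y] [NormedSpace ℂ Y] [SMul B Y] [CStarModule B Y]

lemma injective_of_denseRange {T : AdjointableOp B Y} (hT : star T = T) (hd : DenseRange T) :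
    Function.Injective T := by
  intro y z hyz
  refine eq_of_inner_eq (B := B) fun x => ?_
  have hc : ∀ w : Y, Continuous fun x : Y => (inner B x w : B) := fun w =>
    (CStarModule.continuous_inner (A := B) (E := Y)).comp (continuous_id.prodMk continuous_const)
  refine congrFun (hd.equalizer (hc y) (hc z) (funext fun u => ?_)) x
  simp only [Function.comp_apply]
  rw [inner_star, inner_star, hT, hyz]

omit [StarOrderedRing B] in
lemma AdjointableOp.norm_apply_le (T : AdjointableOp B Y) (y : Y) : ‖T y‖ ≤ ‖T‖ * ‖y‖ :=
  T.toCLM.le_opNorm y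

variable [CompleteSpace Y]

/-- `A = (1 + D²)⁻¹` and `F = D (1 + D²)^(-1/2)` as bounded operators. The last field says that
`D = F A^(-1/2)`, with the range of `A^(1/2)` as its domain. -/
structure IsTransform (D : Y →ₗ.[ℂ] Y) (A F : AdjointableOp B Y) : Prop where
  nonneg : 0 ≤ A
  le_one : A ≤ 1
  norm_le : ‖F‖ ≤ 1
  sq_eq : F * F = 1 - A
  commute : Commute F A
  denseRange : DenseRange A
  mem_graph : ∀ x v, (x, v) ∈ D.graph ↔ ∃ y, (A ^ (1 / 2 : ℝ)) y = x ∧ F y = v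

/-- `D (1 + D²)⁻¹ (1 + l (1 + D²)⁻¹)⁻¹` is small for large `l`. -/
lemma norm_mul_damp_sq_le {A G : AdjointableOp B Y} (h0 : 0 ≤ A) (h1 : A ≤ 1) (hG : star G = G)
    (hGG : G * G = A - A * A) {l : ℝ} (hl : 0 ≤ l) : ‖G * damp A l‖ ^ 2 ≤ (1 + l)⁻¹ := by
  have hstar : star (damp A l) = damp A l := (cfc_predicate (p := IsSelfAdjoint) _ A).star_eq
  have hnorm : ∀ {f : ℝ → ℝ}, (∀ x ∈ Icc (0 : ℝ) 1, |f x| ≤ 1) → ‖cfc f A‖ ≤ 1 := fun hf =>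
    norm_cfc_le_of_Icc h0 h1 zero_le_one hf
  have hdamp : ‖damp A l‖ ≤ 1 := hnorm fun x hx => by
    have := hx.1
    rw [abs_of_nonneg (by positivity)]
    exact inv_le_one_of_one_le₀ (by nlinarith [mul_nonneg hl this])
  have hsub : ‖1 - A‖ ≤ 1 := by
    rw [CStarAlgebra.norm_le_one_iff_of_nonneg _ (sub_nonneg.mpr h1)]
    exact sub_le_self _ h0
  have e : star (G * damp A l) * (G * damp A l) = resolv A l * (1 - A) * damp A l := by
    rw [star_mul, hG, hstar, ← damp_mul_self h0 h1 hl]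
    calc damp A l * G * (G * damp A l) = damp A l * (G * G) * damp A l := by
          simp only [mul_assoc]
      _ = _ := by rw [hGG]; noncomm_ring
  rw [sq, ← CStarRing.norm_star_mul_self, e]
  calc ‖resolv A l * (1 - A) * damp A l‖ ≤ ‖resolv A l‖ * ‖1 - A‖ * ‖damp A l‖ :=
        (norm_mul_le _ _).trans (by gcongr; exact norm_mul_le _ _)
    _ ≤ (1 + l)⁻¹ * 1 * 1 := by gcongr; exact norm_resolv_le h0 h1 hl
    _ = (1 + l)⁻¹ := by ring

/-- The domain of `D²` is dense: `D` has dense domain, every `x` in it is `A x + G (D x)`, and `G v`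
is the limit of `G v - G (1 + n A)⁻¹ v`, which lies in the range of `A`. -/
lemma denseRange_resolvent {D : Y →ₗ.[ℂ] Y} (hd : Dense (D.domain : Set Y))
    {A G : AdjointableOp B Y} (h0 : 0 ≤ A) (h1 : A ≤ 1) (hG : star G = G)
    (hGG : G * G = A - A * A) (hGA : Commute G A)
    (hD : ∀ x v, (x, v) ∈ D.graph → x = A x + G v) : DenseRange A := by
  have hGv : ∀ v, G v ∈ closure (range A) := by
    intro v
    have hlim : Filter.Tendsto (fun n : ℕ => (G * damp A n) v) Filter.atTop (nhds 0) := by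
      have h2 : Filter.Tendsto (fun n : ℕ => √((1 + (n : ℝ))⁻¹) * ‖v‖) Filter.atTop (nhds 0) := by
        have h3 : Filter.Tendsto (fun n : ℕ => (1 + (n : ℝ))⁻¹) Filter.atTop (nhds 0) :=
          tendsto_inv_atTop_zero.comp
            (Filter.tendsto_atTop_add_const_left _ _ tendsto_natCast_atTop_atTop)
        simpa using (h3.sqrt).mul_const ‖v‖
      refine squeeze_zero_norm (fun n => ?_) h2
      refine ((G * damp A n).norm_apply_le v).trans ?_
      gcongr
      exact Real.le_sqrt_of_sq_le (norm_mul_damp_sq_le h0 h1 hG hGG n.cast_nonneg)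
    have hlim' := (tendsto_const_nhds (x := G v)).sub hlim
    rw [sub_zero] at hlim'
    refine mem_closure_of_tendsto hlim' (.of_forall fun n => ?_)
    refine ⟨(G * ((n : ℝ) • damp A n)) v, ?_⟩
    rw [← AdjointableOp.mul_apply, ← AdjointableOp.sub_apply]
    congr 2
    have e := damp_mul_one_add h0 h1 (l := n) n.cast_nonneg
    have e' : A * damp A n = damp A n * A := (commute_damp h0 _).eq.symm
    calc A * (G * ((n : ℝ) • damp A n)) = G * (damp A n * ((n : ℝ) • A)) := by
          rw [← mul_assoc, ← hGA.eq, mul_assoc]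
          simp only [mul_smul_comm, e']
      _ = G * (damp A n * (1 + (n : ℝ) • A)) - G * damp A n := by noncomm_ring
      _ = G - G * damp A n := by rw [e, mul_one]
  have hsub : (D.domain : Set Y) ⊆ closure (range A) := by
    intro x hx
    obtain ⟨v, hv⟩ := LinearPMap.mem_domain_iff.mp hx
    have hcl : closure (range A) = (A.toCLM.toLinearMap.range.topologicalClosure : Set Y) := rfl
    rw [hD x v hv, hcl]
    refine Submodule.add_mem _ ?_ (hGv v)
    exact subset_closure ⟨x, rfl⟩
  exact fun y => closure_minimal hsub isClosed_closure (hd y)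

/-- The structure theorem for selfadjoint regular operators: the bounded transform exists and
determines the operator. -/
theorem exists_isTransform {D : Y →ₗ.[ℂ] Y} (hD : IsSelfAdjointOp B D)
    (hreg : IsRegularOp B D) : ∃ A F : AdjointableOp B Y, IsTransform D A F := by
  obtain ⟨A, G, hAG, hA1, hA, hG⟩ := exists_resolvent hD hreg
  have hAsym : ∀ x y, inner B (A x) y = inner B x (A y) := fun x y => by
    rw [inner_star, hA]
  have hGsym : ∀ x y, inner B (G x) y = inner B x (G y) := fun x y => by
    rw [inner_star, hG]
  have hunique : ∀ {x v w : Y}, (x, v) ∈ D.graph → (v, w) ∈ D.graph → A (x + w) = x := by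
    intro x v w hx hv
    obtain ⟨h1, h2⟩ := hAG (x + w)
    have := (hD.norm_le (D.graph.sub_mem h1 hx) (D.graph.sub_mem h2 hv)).1
    have e : A (x + w) - x + (x + w - A (x + w) - w) = 0 := by abel
    rw [e, norm_zero] at this
    exact sub_eq_zero.mp (norm_le_zero_iff.mp this)
  have hdecomp : ∀ x v, (x, v) ∈ D.graph → x = A x + G v := by
    intro x v hx
    refine eq_of_inner_eq (B := B) fun z => ?_
    rw [CStarModule.inner_add_right, ← hGsym, ← hD.symmetric (hAG z).2 hx,
      CStarModule.inner_sub_left, hAsym, add_sub_cancel]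
  have hcomm : Commute G A := by
    refine AdjointableOp.ext_apply fun y => ?_
    rw [AdjointableOp.mul_apply, AdjointableOp.mul_apply]
    have h1 := hAG (A y)
    have h2 : (A y - A (A y), G y - G (A y)) ∈ D.graph := D.graph.sub_mem (hAG y).1 h1.1
    have := hunique h1.2 h2
    rw [← this]
    congr 1
    abel
  have hGG : G * G = A - A * A := by
    refine AdjointableOp.ext_apply fun y => ?_
    have := hdecomp _ _ (hAG y).1
    rw [AdjointableOp.mul_apply, AdjointableOp.sub_apply, AdjointableOp.mul_apply]
    exact eq_sub_of_add_eq' this.symm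
  have h0 : 0 ≤ A := by
    have e : A = star A * A + star G * G := by rw [hA, hG, hGG]; abel
    rw [e]
    exact add_nonneg (star_mul_self_nonneg A) (star_mul_self_nonneg G)
  have h1 : A ≤ 1 := (CStarAlgebra.norm_le_one_iff_of_nonneg A h0).mp hA1
  have hdense : DenseRange A := denseRange_resolvent hD.dense_domain h0 h1 hG hGG hcomm hdecomp
  set a := A ^ (1 / 2 : ℝ) with ha
  have haa : a * a = A := rpow_half_mul_self h0
  have haay : ∀ y, a (a y) = A y := fun y => by rw [← AdjointableOp.mul_apply, haa]
  have hastar : star a = a := (IsSelfAdjoint.of_nonneg CFC.rpow_nonneg).star_eq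
  have hasym : ∀ x y, inner B (a x) y = inner B x (a y) := fun x y => by
    rw [inner_star, hastar]
  have hdense' : DenseRange a := dense_range_of_mul hdense haa
  have hGa : Commute G a := commute_rpow hcomm _
  have hGay : ∀ y, G (a y) = a (G y) := fun y => by
    rw [← AdjointableOp.mul_apply, hGa.eq, AdjointableOp.mul_apply]
  have hnorm : ∀ z, ‖G z‖ ≤ ‖a z‖ := by
    intro z
    have e : (inner B (a z) (a z) : B) = inner B (A z) (A z) + inner B (G z) (G z) := by
      rw [hasym, haay, hAsym, hGsym, ← CStarModule.inner_add_right]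
      congr 1
      exact hdecomp _ _ (hAG z).1
    refine abs_le_of_sq_le_sq' ?_ (norm_nonneg _) |>.2
    rw [CStarModule.norm_sq_eq (A := B), CStarModule.norm_sq_eq (A := B) (x := a z)]
    refine CStarAlgebra.norm_le_norm_of_nonneg_of_le CStarModule.inner_self_nonneg ?_
    rw [e]
    exact le_add_of_nonneg_left CStarModule.inner_self_nonneg
  have hcl : IsClosed (D.graph : Set (Y × Y)) := hreg.isClosed
  have hex : ∀ y, ∃ v, (a y, v) ∈ D.graph ∧ ‖v‖ ≤ ‖y‖ := by
    intro y
    obtain ⟨u, hu, hlim⟩ := mem_closure_iff_seq_limit.mp (hdense' y)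
    choose z hz using hu
    have hlim' : Filter.Tendsto (fun n => a (z n)) Filter.atTop (nhds y) := by simpa only [hz]
    have hcu := hlim'.cauchySeq
    have hcG : CauchySeq fun n => G (z n) := by
      rw [Metric.cauchySeq_iff] at hcu ⊢
      intro ε hε
      obtain ⟨N, hN⟩ := hcu ε hε
      refine ⟨N, fun m hm n hn => lt_of_le_of_lt ?_ (hN m hm n hn)⟩
      rw [dist_eq_norm, dist_eq_norm, ← map_sub, ← map_sub]
      exact hnorm _
    obtain ⟨v, hv⟩ := cauchySeq_tendsto_of_complete hcG
    refine ⟨v, ?_, le_of_tendsto_of_tendsto' hv.norm hlim'.norm fun n => hnorm _⟩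
    have h3 := (a.toCLM.continuous.tendsto y).comp hlim'
    refine hcl.mem_of_tendsto (h3.prodMk_nhds hv) (.of_forall fun n => ?_)
    simp only [Function.comp_apply, haay]
    exact (hAG (z n)).1
  choose f hf hf' using hex
  have hfun : ∀ {x v w : Y}, (x, v) ∈ D.graph → (x, w) ∈ D.graph → v = w := fun h h' =>
    D.mem_graph_snd_inj h h' rfl
  -- `f y = D A^(1/2) y`, obtained from the estimate `‖G z‖ ≤ ‖A^(1/2) z‖` and closedness of `D`.
  let Fₗ : Y →ₗ[ℂ] Y :=
    { toFun := f
      map_add' := fun x y => hfun (hf (x + y)) (by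
        rw [map_add]
        exact D.graph.add_mem (hf x) (hf y))
      map_smul' := fun c y => hfun (hf (c • y)) (by
        rw [map_smul]
        exact D.graph.smul_mem c (hf y)) }
  let Fc : Y →L[ℂ] Y := Fₗ.mkContinuous 1 fun y => by rw [one_mul]; exact hf' y
  have hFca : ∀ y, Fc (a y) = G y := fun y => hfun (hf (a y)) (by rw [haay]; exact (hAG y).1)
  have hFsym : ∀ x y, inner B (Fc x) y = inner B x (Fc y) := by
    have hin := CStarModule.continuous_inner (A := B) (E := Y)
    have := (hdense'.prodMap hdense').equalizer
      (hin.comp ((Fc.continuous.comp continuous_fst).prodMk continuous_snd))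
      (hin.comp (continuous_fst.prodMk (Fc.continuous.comp continuous_snd)))
      (funext fun q => by
        change (inner B (Fc (a q.1)) (a q.2) : B) = inner B (a q.1) (Fc (a q.2))
        rw [hFca, hFca, ← hasym, ← hGay, hGsym])
    exact fun x y => congrFun this (x, y)
  let F : AdjointableOp B Y := ⟨Fc, Fc, hFsym⟩
  have hFstar : star F = F := star_eq_of_inner hFsym
  have hFa : F * a = G := AdjointableOp.ext_apply fun y => by
    rw [AdjointableOp.mul_apply]
    exact hFca y
  have haF : a * F = G := by
    have := congrArg star hFa
    rwa [star_mul, hFstar, hastar, hG] at this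
  refine ⟨A, F, h0, h1, ?_, ?_, ?_, hdense, fun x v => ⟨fun hx => ?_, ?_⟩⟩
  · exact Fₗ.mkContinuous_norm_le zero_le_one fun y => by rw [one_mul]; exact hf' y
  · refine AdjointableOp.eq_of_mul_eq_mul hdense ?_
    calc F * F * A = F * (F * a) * a := by rw [← haa]; simp only [mul_assoc]
      _ = F * (a * F) * a := by rw [hFa, haF]
      _ = (F * a) * (F * a) := by simp only [mul_assoc]
      _ = (1 - A) * A := by rw [hFa, hGG]; noncomm_ring
  · change F * A = A * F
    rw [← haa, ← mul_assoc, hFa, mul_assoc, haF, hGa.eq]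
  · have hy : a (a x + F v) = x := by
      rw [map_add, haay, ← AdjointableOp.mul_apply, haF]
      exact (hdecomp x v hx).symm
    refine ⟨a x + F v, hy, ?_⟩
    have := hf (a x + F v)
    rw [hy] at this
    exact hfun this hx
  · rintro ⟨y, rfl, rfl⟩
    exact hf y

end Transform

/-! ### Commutators with the unbounded operator -/

section Commutator

variable {B Y : Type*} [NonUnitalCStarAlgebra B] [PartialOrder B]
    [NormedAddCommGroup Y] [NormedSpace ℂ Y] [SMul B Y] [CStarModule B Y]

/-- `u` preserves the domain of `D`, and `D u - u D` is the restriction of `d`. -/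
def HasComm (D : Y →ₗ.[ℂ] Y) (u d : AdjointableOp B Y) : Prop :=
  ∀ x v, (x, v) ∈ D.graph → (u x, u v + d x) ∈ D.graph

variable {D : Y →ₗ.[ℂ] Y} {u d w e : AdjointableOp B Y}

lemma HasComm.one : HasComm (B := B) D 1 0 := fun x v hx => by
  rw [AdjointableOp.one_apply, AdjointableOp.one_apply, map_zero]
  change (x, v + 0) ∈ D.graph
  rwa [add_zero]

lemma HasComm.mul (hu : HasComm D u d) (hw : HasComm D w e) :
    HasComm D (u * w) (u * e + d * w) := fun x v hx => by
  have := hu _ _ (hw x v hx)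
  simp only [AdjointableOp.mul_apply, AdjointableOp.add_apply]
  rwa [map_add, add_assoc] at this

lemma HasComm.sub (hu : HasComm D u d) (hw : HasComm D w e) :
    HasComm D (u - w) (d - e) := fun x v hx => by
  have := D.graph.sub_mem (hu x v hx) (hw x v hx)
  simp only [AdjointableOp.sub_apply]
  rwa [Prod.mk_sub_mk, add_sub_add_comm] at this

lemma HasComm.smul (c : ℝ) (hu : HasComm D u d) : HasComm D (c • u) (c • d) := fun x v hx => by
  have := D.graph.smul_mem (c : ℂ) (hu x v hx)
  simp only [AdjointableOp.real_smul_apply]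
  rwa [Prod.smul_mk, smul_add] at this

lemma HasComm.pow_succ (hu : HasComm D u d) (n : ℕ) :
    HasComm D (u ^ (n + 1)) (∑ i ∈ Finset.range (n + 1), u ^ i * d * u ^ (n - i)) := by
  induction n with
  | zero => simpa using hu
  | succ n ih =>
    have := ih.mul hu
    rw [← _root_.pow_succ] at this
    convert this using 1
    rw [Finset.sum_range_succ, Nat.sub_self, pow_zero, mul_one, add_comm, Finset.sum_mul]
    congr 1
    refine Finset.sum_congr rfl fun i hi => ?_
    have hi' : n + 1 - i = (n - i) + 1 := by
      have := Finset.mem_range.mp hi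
      omega
    rw [hi', _root_.pow_succ, ← mul_assoc]

end Commutator

section ModularData

variable {B Y : Type*} [NonUnitalCStarAlgebra B] [PartialOrder B] [StarOrderedRing B]
    [NormedAddCommGroup Y] [NormedSpace ℂ Y] [SMul B Y] [CStarModule B Y] [CompleteSpace Y]

variable {D : Y →ₗ.[ℂ] Y} {A F : AdjointableOp B Y}

lemma IsTransform.hasBoundedComm (hT : IsTransform D A F) {u d : AdjointableOp B Y}
    (hu : HasComm D u d) : HasBoundedComm A F u d := by
  refine AdjointableOp.ext_apply fun y => ?_
  obtain ⟨y', h1, h2⟩ := (hT.mem_graph _ _).mp (hu _ _ ((hT.mem_graph _ _).mpr ⟨y, rfl, rfl⟩))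
  have e : F ((A ^ (1 / 2 : ℝ)) y') = (A ^ (1 / 2 : ℝ)) (F y') := by
    rw [← AdjointableOp.mul_apply, (commute_rpow hT.commute _).eq, AdjointableOp.mul_apply]
  rw [h1, h2, map_add] at e
  simp only [AdjointableOp.mul_apply, AdjointableOp.sub_apply]
  exact sub_eq_of_eq_add' e

variable {Δ : AdjointableOp B Y}

/-- The condition on `Δ` says that `[D, Δ] = h ρ h`, where `h = Δ^(1/2)`. -/
lemma IsModularPair.exists_hasComm (hΔ : 0 ≤ Δ) (hd : DenseRange Δ) (h : IsModularPair D Δ) :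
    ∃ ρ : AdjointableOp B Y,
      HasComm D Δ (Δ ^ (1 / 2 : ℝ) * ρ * Δ ^ (1 / 2 : ℝ)) := by
  obtain ⟨hdom, dΔ, hcomm, hrange, ρ, hρ⟩ := h
  have hinj : Function.Injective (Δ ^ (1 / 2 : ℝ) : AdjointableOp B Y) :=
    injective_of_denseRange (IsSelfAdjoint.of_nonneg CFC.rpow_nonneg).star_eq
      (dense_range_of_mul hd (rpow_half_mul_self hΔ))
  have hdρ : dΔ = Δ ^ (1 / 2 : ℝ) * ρ * Δ ^ (1 / 2 : ℝ) := by
    refine AdjointableOp.ext_apply fun y => ?_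
    obtain ⟨z, hz⟩ := hrange ⟨y, rfl⟩
    have hmem : ((Δ ^ (1 / 2 : ℝ)) y, z) ∈
        (pcomp (invSqrt Δ) (pcomp (toPMap dΔ) (invSqrt Δ))).graph :=
      mem_graph_pcomp.mpr ⟨dΔ y, mem_graph_pcomp.mpr
        ⟨y, (mem_graph_inverse_toPMap hinj).mpr rfl, mem_graph_toPMap.mpr rfl⟩,
        (mem_graph_inverse_toPMap hinj).mpr hz.symm⟩
    have := mem_graph_toPMap.mp (LinearPMap.le_graph_of_le hρ hmem)
    rw [AdjointableOp.mul_apply, AdjointableOp.mul_apply, ← this, hz]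
  refine ⟨ρ, fun x v hx => ?_⟩
  rw [← hdρ]
  obtain ⟨z, hz⟩ := LinearPMap.mem_domain_iff.mp
    (hdom x (LinearPMap.mem_domain_of_mem_graph hx))
  have hmem : (x, z - Δ v) ∈ (commutator D Δ).graph :=
    mem_graph_sub.mpr ⟨z, Δ v, mem_graph_pcomp.mpr ⟨Δ x, mem_graph_toPMap.mpr rfl, hz⟩,
      mem_graph_pcomp.mpr ⟨v, hx, mem_graph_toPMap.mpr rfl⟩, rfl⟩
  have := mem_graph_toPMap.mp (LinearPMap.le_graph_of_le hcomm hmem)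
  rwa [← this, add_sub_cancel]

lemma IsTransform.exists_isModularData (hT : IsTransform D A F) (hΔ : 0 ≤ Δ) (hd : DenseRange Δ)
    (h : IsModularPair D Δ) {r : ℝ} (hr : ‖Δ‖ ^ 2 < r) :
    ∃ ρ, IsModularData A F (Δ ^ (1 / 2 : ℝ)) ρ r := by
  obtain ⟨ρ, hρ⟩ := h.exists_hasComm hΔ hd
  set h := Δ ^ (1 / 2 : ℝ)
  have hh : h ^ 2 = Δ := by rw [sq, rpow_half_mul_self hΔ]
  have hh0 : 0 ≤ h := CFC.rpow_nonneg
  rw [← hh] at hρ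
  have h4 : HasComm D (h ^ 4) (h * (ρ * h ^ 2 + h ^ 2 * ρ) * h) := by
    convert hρ.mul hρ using 1 <;> noncomm_ring
  have h6 : HasComm D (h ^ 6) (h * (ρ * h ^ 4 + h ^ 2 * ρ * h ^ 2 + h ^ 4 * ρ) * h) := by
    convert hρ.mul h4 using 1 <;> noncomm_ring
  have hK : HasComm D (cutoff h r) (-(r⁻¹ • (h * (ρ * h ^ 2 + h ^ 2 * ρ) * h))) := by
    have := HasComm.one.sub (h4.smul r⁻¹)
    rwa [zero_sub] at this
  refine ⟨ρ, hT.nonneg, hT.le_one, hT.norm_le, hT.sq_eq, hT.commute, hh0, ?_,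
    hT.hasBoundedComm hρ, fun n => hT.hasBoundedComm ?_⟩
  · have e : ‖h‖ ^ 2 = ‖Δ‖ := by
      rw [← hh, sq, sq, ← CStarRing.norm_star_mul_self, (IsSelfAdjoint.of_nonneg hh0).star_eq]
    rw [← e, ← pow_mul] at hr
    exact hr
  · convert h6.mul (hK.pow_succ n) using 1
    rw [commCoeff, sub_eq_neg_add, Finset.smul_sum, ← Finset.sum_neg_distrib, Finset.mul_sum]
    congr 1
    refine Finset.sum_congr rfl fun i _ => ?_
    simp only [mul_neg, neg_mul, mul_smul_comm, smul_mul_assoc, mul_assoc]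

end ModularData

/-! ### Powers of `1 + D²` and the difference of unbounded operators -/

section Final

variable {B Y : Type*} [NonUnitalCStarAlgebra B] [PartialOrder B] [StarOrderedRing B]
    [NormedAddCommGroup Y] [NormedSpace ℂ Y] [SMul B Y] [CStarModule B Y] [CompleteSpace Y]

/-- Evaluation at a vector. -/
def AdjointableOp.eval (y : Y) : AdjointableOp B Y →L[ℝ] Y :=
  (LinearMap.mkContinuous
    { toFun := fun T : AdjointableOp B Y => T y
      map_add' := fun S T => S.add_apply T y
      map_smul' := fun c T => by rw [map_smul]; rfl : AdjointableOp B Y →ₗ[ℂ] Y } ‖y‖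
    fun T => (T.norm_apply_le y).trans_eq (mul_comm _ _)).restrictScalars ℝ

variable {D : Y →ₗ.[ℂ] Y} {A F Δ : AdjointableOp B Y}

namespace IsTransform

variable (hT : IsTransform D A F)
include hT

lemma mem_graph_sq {x w : Y} : (x, w) ∈ (pcomp D D).graph ↔ A (x + w) = x := by
  have haa : ∀ y, (A ^ (1 / 2 : ℝ)) ((A ^ (1 / 2 : ℝ)) y) = A y := fun y => by
    rw [← AdjointableOp.mul_apply, rpow_half_mul_self hT.nonneg]
  have hFa : ∀ y, F ((A ^ (1 / 2 : ℝ)) y) = (A ^ (1 / 2 : ℝ)) (F y) := fun y => by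
    rw [← AdjointableOp.mul_apply, (commute_rpow hT.commute _).eq, AdjointableOp.mul_apply]
  have hFF : ∀ y, F (F y) = y - A y := fun y => by
    rw [← AdjointableOp.mul_apply, hT.sq_eq, AdjointableOp.sub_apply, AdjointableOp.one_apply]
  rw [mem_graph_pcomp]
  constructor
  · rintro ⟨v, hxv, hvw⟩
    obtain ⟨y, rfl, rfl⟩ := (hT.mem_graph _ _).mp hxv
    obtain ⟨z, hz, rfl⟩ := (hT.mem_graph _ _).mp hvw
    rw [map_add, ← haa (F z), ← hFa, hz, hFF, map_sub,
      (haa _).symm.trans (congrArg (A ^ (1 / 2 : ℝ)).toCLM (haa y)), add_sub_cancel]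
  · intro h
    set u := x + w
    have hw : w = F (F u) := by rw [hFF, h]; simp [u]
    refine ⟨(A ^ (1 / 2 : ℝ)) (F u), ?_, (hT.mem_graph _ _).mpr ⟨F u, rfl, hw.symm⟩⟩
    exact (hT.mem_graph _ _).mpr ⟨(A ^ (1 / 2 : ℝ)) u, by rw [haa, h], hFa u⟩

lemma resolventOp_eq {l : ℝ} (hl : 0 ≤ l) : resolventOp B D l = resolv A l := by
  have hEA := damp_mul_self hT.nonneg hT.le_one hl
  have hE1 : ∀ y, damp A l (y + (l : ℂ) • A y) = y := fun y => by
    have := congrArg (fun T : AdjointableOp B Y => T y) (damp_mul_one_add hT.nonneg hT.le_one hl)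
    simpa only [AdjointableOp.mul_apply, AdjointableOp.add_apply, AdjointableOp.one_apply,
      AdjointableOp.real_smul_apply] using this
  have hcomm : ∀ y, damp A l (A y) = A (damp A l y) := fun y => by
    rw [← AdjointableOp.mul_apply, (commute_damp hT.nonneg l).eq, AdjointableOp.mul_apply]
  have key : ∀ x y, (x, y) ∈ (addConst (l + 1) (pcomp D D)).graph ↔ resolv A l y = x := by
    intro x y
    rw [← hEA, AdjointableOp.mul_apply, mem_graph_addConst]
    constructor
    · rintro ⟨w, hw, rfl⟩
      have h := (hT.mem_graph_sq).mp hw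
      have e : ((l + 1 : ℝ) : ℂ) • x + w = (l : ℂ) • x + (x + w) := by
        push_cast
        rw [add_smul, one_smul, add_assoc]
      rw [e, map_add, h, map_smul, add_comm, hE1]
    · rintro rfl
      refine ⟨y - ((l + 1 : ℝ) : ℂ) • damp A l (A y), ?_, by abel⟩
      rw [hT.mem_graph_sq]
      have h := hE1 (A y)
      rw [map_add, map_smul, hcomm (A y)] at h
      have e : damp A l (A y) + (y - ((l + 1 : ℝ) : ℂ) • damp A l (A y)) =
          y - (l : ℂ) • damp A l (A y) := by
        push_cast
        rw [add_smul, one_smul]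
        abel
      rw [e, map_sub, map_smul]
      exact sub_eq_of_eq_add h.symm
  rw [resolventOp, boundedInverse, dif_pos ⟨_, key⟩]
  refine AdjointableOp.ext_apply fun y => ?_
  have hex : ∃ S : AdjointableOp B Y, ∀ x y,
      (x, y) ∈ (addConst (l + 1) (pcomp D D)).graph ↔ S y = x := ⟨_, key⟩
  exact (hex.choose_spec _ _).mp ((key _ _).mpr rfl)

lemma negPow_eq (s : ℝ) : negPow B D s = A ^ s := by
  have h0 : resolv A 0 = A := by
    have hsa : IsSelfAdjoint A := .of_nonneg hT.nonneg
    simp [resolv, cfc_id' ℝ A]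
  rw [negPow, hT.resolventOp_eq le_rfl, h0]

lemma denseRange_rpow {s : ℝ} (hs0 : 0 ≤ s) (hs1 : s ≤ 1) :
    DenseRange (A ^ s : AdjointableOp B Y) := by
  refine dense_range_of_mul hT.denseRange (T := A ^ (1 - s)) ?_
  rw [rpow_mul_rpow hT.nonneg hT.le_one hs0 (sub_nonneg.mpr hs1), add_sub_cancel,
    CFC.rpow_one A hT.nonneg]

lemma injective_rpow {s : ℝ} (hs0 : 0 ≤ s) (hs1 : s ≤ 1) :
    Function.Injective (A ^ s : AdjointableOp B Y) :=
  injective_of_denseRange (IsSelfAdjoint.of_nonneg CFC.rpow_nonneg).star_eq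
    (hT.denseRange_rpow hs0 hs1)

lemma mem_graph_posPow {s : ℝ} (hs0 : 0 ≤ s) (hs1 : s ≤ 1) {x y : Y} :
    (x, y) ∈ (posPow B D s).graph ↔ x = (A ^ s) y := by
  rw [posPow, hT.negPow_eq]
  exact mem_graph_inverse_toPMap (hT.injective_rpow hs0 hs1)

lemma mem_graph_boundedTransform {x z : Y} :
    (x, z) ∈ (boundedTransform B D).graph ↔ z = F x := by
  rw [boundedTransform, hT.negPow_eq, mem_graph_pcomp]
  constructor
  · rintro ⟨y, hxy, hyz⟩
    obtain ⟨x', h1, rfl⟩ := (hT.mem_graph _ _).mp hyz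
    rw [mem_graph_toPMap] at hxy
    rw [hT.injective_rpow (by norm_num) (by norm_num) (h1.trans hxy)]
  · rintro rfl
    exact ⟨_, mem_graph_toPMap.mpr rfl, (hT.mem_graph _ _).mpr ⟨x, rfl, rfl⟩⟩

/-- On vectors `x = (1 + D²)^(-p-1/2) η` both terms of the difference are bounded functions of
`F η`. -/
lemma mem_graph_transformDifference {r p : ℝ} (hp0 : 0 ≤ p) (hp1 : p ≤ 1 / 2) {x z : Y} :
    (x, z) ∈ (transformDifference D Δ r p).graph ↔ ∃ η, x = (A ^ (p + 1 / 2)) η ∧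
      z = (Δ ^ 5 * A ^ (1 / 2 : ℝ) - modularIntegral D Δ r) (F η) := by
  have hp1' : p ≤ 1 := by linarith
  have hA : ∀ η, (A ^ p) ((A ^ (1 / 2 : ℝ)) η) = (A ^ (p + 1 / 2)) η := fun η => by
    rw [← AdjointableOp.mul_apply, rpow_mul_rpow hT.nonneg hT.le_one hp0 (by norm_num)]
  have hval : ∀ η, (Δ ^ 5) (F ((A ^ (1 / 2 : ℝ)) η)) - (modularIntegral D Δ r) (F η) =
      (Δ ^ 5 * A ^ (1 / 2 : ℝ) - modularIntegral D Δ r) (F η) := fun η => by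
    rw [AdjointableOp.sub_apply, AdjointableOp.mul_apply, ← AdjointableOp.mul_apply F,
      (commute_rpow hT.commute _).eq, AdjointableOp.mul_apply]
  rw [transformDifference, mem_graph_sub]
  constructor
  · rintro ⟨_, _, h1, h2, rfl⟩
    obtain ⟨_, h1, h3⟩ := mem_graph_pcomp.mp h1
    obtain ⟨_, h1, h4⟩ := mem_graph_pcomp.mp h1
    obtain ⟨_, h2, h5⟩ := mem_graph_pcomp.mp h2
    obtain ⟨_, h7, h6⟩ := mem_graph_pcomp.mp h2
    obtain ⟨η, rfl, rfl⟩ := (hT.mem_graph _ _).mp h6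
    rw [mem_graph_toPMap] at h3 h5
    rw [hT.mem_graph_boundedTransform] at h4
    rw [hT.mem_graph_posPow hp0 hp1'] at h1 h7
    obtain rfl := hT.injective_rpow hp0 hp1' (h1.symm.trans h7)
    exact ⟨η, h7.trans (hA η), by rw [h3, h4, h5, hval]⟩
  · rintro ⟨η, rfl, rfl⟩
    refine ⟨_, _, ?_, ?_, (hval η).symm⟩
    · exact mem_graph_pcomp.mpr ⟨_, mem_graph_pcomp.mpr
        ⟨_, (hT.mem_graph_posPow hp0 hp1').mpr (hA η).symm,
          hT.mem_graph_boundedTransform.mpr rfl⟩, mem_graph_toPMap.mpr rfl⟩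
    · exact mem_graph_pcomp.mpr ⟨_, mem_graph_pcomp.mpr
        ⟨_, (hT.mem_graph_posPow hp0 hp1').mpr (hA η).symm,
          (hT.mem_graph _ _).mpr ⟨η, rfl, rfl⟩⟩, mem_graph_toPMap.mpr rfl⟩

lemma mem_domain_transformDifference {r p : ℝ} (hp0 : 0 ≤ p) (hp1 : p ≤ 1 / 2) {x : Y} :
    x ∈ (transformDifference D Δ r p).domain ↔ ∃ η, x = (A ^ (p + 1 / 2)) η := by
  rw [LinearPMap.mem_domain_iff]
  simp only [hT.mem_graph_transformDifference hp0 hp1]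
  exact ⟨fun ⟨_, η, h, _⟩ => ⟨η, h⟩, fun ⟨η, h⟩ => ⟨_, η, h, rfl⟩⟩

lemma domain_transformDifference {r p : ℝ} (hp0 : 0 ≤ p) (hp1 : p ≤ 1 / 2) :
    (transformDifference D Δ r p).domain = (absPow B D (2 * p + 1)).domain := by
  ext x
  rw [hT.mem_domain_transformDifference hp0 hp1, LinearPMap.mem_domain_iff]
  have e : (2 * p + 1) / 2 = p + 1 / 2 := by ring
  simp only [absPow, mem_graph_pcomp, mem_graph_toPMap, e,
    hT.mem_graph_posPow (s := p + 1 / 2) (by linarith) (by linarith)]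
  exact ⟨fun ⟨η, h⟩ => ⟨_, η, h, rfl⟩, fun ⟨_, η, h, _⟩ => ⟨η, h⟩⟩

lemma integrand_eq {h : AdjointableOp B Y} (hh : h ^ 2 = Δ) {r l : ℝ} (hl : 0 ≤ l) :
    integrand D Δ r l = (l * r) ^ (-(1 / 2) : ℝ) • (h ^ 6 * modResolv A h r l) := by
  have h4 : Δ ^ 2 = h ^ 4 := by rw [← hh, ← pow_mul]
  have h6 : Δ ^ 3 = h ^ 6 := by rw [← hh, ← pow_mul]
  rw [integrand, opX, opK, hT.resolventOp_eq hl, modResolv, cutoff, h4, h6]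
  simp only [mul_assoc]

end IsTransform

end Final

end HilbertModule

end

open HilbertModule in
theorem theoremt {B Y : Type*} [NonUnitalCStarAlgebra B] [PartialOrder B] [StarOrderedRing B]
    [NormedAddCommGroup Y] [NormedSpace ℂ Y] [SMul B Y] [CStarModule B Y] [CompleteSpace Y]
    (D : Y →ₗ.[ℂ] Y)
    (hD_sa : HilbertModule.IsSelfAdjointOp B D) (hD_reg : HilbertModule.IsRegularOp B D)
    (Δ : HilbertModule.AdjointableOp B Y)
    (hΔ_pos : 0 ≤ Δ) (hΔ_dense : DenseRange Δ)
    (hDΔ : HilbertModule.IsModularPair D Δ)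
    (r : ℝ) (hr : ‖Δ‖ ^ 2 < r)
    (p : ℝ) (hp : p ∈ Set.Ico (0 : ℝ) (1 / 2)) :
    MeasureTheory.IntegrableOn (HilbertModule.integrand D Δ r) (Set.Ioi (0 : ℝ)) ∧
    (HilbertModule.transformDifference D Δ r p).domain =
      (HilbertModule.absPow B D (2 * p + 1)).domain ∧
    ∃ T : Y →L[ℂ] Y,
      HilbertModule.transformDifference D Δ r p ≤ T.toLinearMap.toPMap ⊤ := by
  obtain ⟨A, F, hT⟩ := exists_isTransform hD_sa hD_reg
  obtain ⟨ρ, M⟩ := hT.exists_isModularData hΔ_pos hΔ_dense hDΔ hr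
  obtain ⟨hp0, hp1⟩ := hp
  set h := Δ ^ (1 / 2 : ℝ)
  have hh : h ^ 2 = Δ := by rw [sq, rpow_half_mul_self hΔ_pos]
  have hint : EqOn (integrand D Δ r)
      (fun l => (l * r) ^ (-(1 / 2) : ℝ) • (h ^ 6 * modResolv A h r l)) (Ioi 0) := fun l hl =>
    hT.integrand_eq hh (le_of_lt hl)
  refine ⟨M.integrableOn_modResolv.congr_fun hint.symm measurableSet_Ioi,
    hT.domain_transformDifference hp0 hp1.le, ?_⟩
  -- The estimate needs an exponent in `[7/8, 1)`; any exponent above `p + 1/2` will do.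
  obtain ⟨C, -, hC⟩ := M.exists_bound (s := max (p + 1 / 2) (7 / 8)) (G := Y) (le_max_right _ _)
    (max_lt (by linarith) (by norm_num))
  refine exists_extension (C := C) ?_ fun x z hxz => ?_
  · refine (hT.denseRange_rpow (s := p + 1 / 2) (by linarith) (by linarith)).mono ?_
    rintro _ ⟨η, rfl⟩
    exact (hT.mem_domain_transformDifference hp0 hp1.le).mpr ⟨η, rfl⟩
  obtain ⟨η, rfl, rfl⟩ := (hT.mem_graph_transformDifference hp0 hp1.le).mp hxz
  have h10 : Δ ^ 5 = h ^ 10 := by rw [← hh, ← pow_mul]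
  rw [modularIntegral, setIntegral_congr_fun measurableSet_Ioi hint, h10, one_div Real.pi]
  refine hC (AdjointableOp.eval (F η)) ‖(A ^ (p + 1 / 2)) η‖ (fun T => ?_) (norm_nonneg _)
  change ‖(T * A ^ max (p + 1 / 2) (7 / 8)) (F η)‖ ≤ _
  set s := max (p + 1 / 2) (7 / 8)
  have hs : p + 1 / 2 ≤ s := le_max_left _ _
  have e : (A ^ s) (F η) = (F * A ^ (s - (p + 1 / 2))) ((A ^ (p + 1 / 2)) η) := by
    rw [← AdjointableOp.mul_apply, ← AdjointableOp.mul_apply, mul_assoc,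
      rpow_mul_rpow hT.nonneg hT.le_one (sub_nonneg.mpr hs) (by linarith), sub_add_cancel,
      (commute_rpow hT.commute s).eq]
  rw [AdjointableOp.mul_apply, e]
  refine (T.norm_apply_le _).trans (mul_le_mul_of_nonneg_left ?_ (norm_nonneg _))
  refine (AdjointableOp.norm_apply_le _ _).trans (mul_le_of_le_one_left (norm_nonneg _) ?_)
  exact (norm_mul_le _ _).trans (mul_le_one₀ hT.norm_le (norm_nonneg _)
    (norm_rpow_le_one hT.nonneg hT.le_one (sub_nonneg.mpr hs)))
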